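/- **Setting.** Let $k\ge 2$, let $I\ni 0$ be an open interval, $\lambda>0$, $J=\begin{pmatrix}0&-1\\1&0\end{pmatrix}$, $o=(0,0)$. Let $(f_\varepsilon)_{\varepsilon\in I}$ be $C^k$ diffeomorphisms of $\mathbb R^2$ preserving $dx\wedge dy$ such that: * (separatrix) each $f_\varepsilon$ has a separatrix $\Sigma_\varepsilon\ni o$: a compact connected $f_\varepsilon$-invariant set such that $\Sigma_\varepsilon\setminus\{o\}$ is a nonempty connected 1-dimensional manifold and $f_\varepsilon^{n}(z)\to o$ as $n\to\pm\infty$ for all $z\in\Sigma_\varepsilon$; the axes are labelled so that $\Sigma_\varepsilon$ contains $(t,0)$ and $(0,t)$ for all small $t>0$; * (continuity) $\varepsilon\mapsto f_\varepsilon-\mathrm{id}$ is continuous for the $C^k$-norm on $\mathbb R^2$; * (normal form) on a neighbourhood $V_0$ of $o$ independent of $\varepsilon$, $f_\varepsilon$ is the time-1 map of $J\nabla Q_\varepsilon$, where $Q_\varepsilon(x,y)=q_\varepsilon(xy)$, $q_\varepsilon\in C^{k+1}(\mathbb R)$, $q_\varepsilon(0)=0$, $q_\varepsilon'(0)=\lambda$;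 * on $\mathbb R^2$, $f_0$ is the time-1 map of $J\nabla H_0$ for some $C^k$ function $H_0$ with $J\nabla H_0=J\nabla Q_0$ on $V_0$. Let $V$ be any sufficiently small open neighbourhood of $o$, star-shaped about $o$. Let $x_*>0$ be such that $(x_*,0)\in V$ and $f_\varepsilon^{-1}(x_*,0)\notin V$ for $\varepsilon$ near $0$, and let $N$ be the least $n\ge 1$ such that $f_0^{-n}$ maps the segment $\{(x,0): x\text{ lies between the abscissa of } f_0(x_*,0)\text{ (excluded) and } x_*\text{ (included)}\}$ into $V$. For $y_*>0$ put $c=x_*y_*$, $L=\{x_*\}\times\,]0,y_*[$, and let $\tilde{\mathcal F}_\varepsilon=\mathcal F_\varepsilon\cup L$, where $\mathcal F_\varepsilon$ is the open region bounded by the $x$-axis, $L$, the hyperbola $xy=c$ and $f_\varepsilon(L)$. For $z\in\tilde{\mathcal F}_\varepsilon$ let $\tilde n_\varepsilon(z)$ be the least $j\ge 1$ with $f_\varepsilon^{j}(z)\in f_\varepsilon^{-N}(\tilde{\mathcal F}_\varepsilon)$ (if there is one) and $\hat f_\varepsilon(z)=f_\varepsilon^{N+\tilde n_\varepsilon(z)}(z)$.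 Let $$h_\varepsilon(x,y)=\Big(\frac{\ln x-\ln x_*}{q'_\varepsilon(xy)},\;xy\Big),\qquad \Xi_1(x,y)=(\ln x,xy),\qquad \Xi_2(x,y)=(-\ln y,xy),$$ and for a function $s$ of the second variable let $T_s(x,y)=(x+s(y),y)$. **Proposition.** For all $V,x_*,N$ as above there is $\sigma_{0,N}\in C^k(\mathbb R,\mathbb R)$ such that, for every small enough $y_*>0$, there are $\delta\in\,]0,c[$ and $\varepsilon_0>0$ with $]-\varepsilon_0,\varepsilon_0[\,\subset I$ such that the following holds for all $|\varepsilon|<\varepsilon_0$. 0. On $f_0^{-N}(\tilde{\mathcal F}_\varepsilon)$ one has $y>0$ and $\Xi_1\circ f_0^{N}=T_{\sigma_{0,N}}\circ\Xi_2$. The map $h_\varepsilon$ taken modulo $\mathbb Z$ in the first coordinate is a bijection from $\tilde{\mathcal F}_\varepsilon$ onto $\mathbb R/\mathbb Z\times\,]0,c[$; $\tilde n_\varepsilon(z)$ exists for all $z=(x,y)\in\tilde{\mathcal F}_\varepsilon$ with $xy<\delta$; so the renormalized map $\bar f_\varepsilon=h_\varepsilon\circ\hat f_\varepsilon\circ h_\varepsilon^{-1}:\mathbb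 R/\mathbb Z\times\,]0,\delta[\,\to\mathbb R/\mathbb Z\times\,]0,c[$ is well defined. Moreover $q'_\varepsilon>0$ on $]0,c[$. 1. $\bar f_\varepsilon=\bar\eta_\varepsilon\circ T_{l_\varepsilon}$ on $\mathbb R/\mathbb Z\times\,]0,\delta[$, where $l_\varepsilon\in C^k(]0,c[,\mathbb R/\mathbb Z)$ is $$l_\varepsilon(y)=\frac{\sigma_{0,N}(y)}{q'_\varepsilon(y)}-\frac{\ln y}{q'_\varepsilon(y)}\mod\mathbb Z ,$$ and $\bar\eta_\varepsilon$ is a $C^k$ diffeomorphism from $\mathbb R/\mathbb Z\times\,]0,\delta[$ onto an open subset of $\mathbb R/\mathbb Z\times\mathbb R$. 2. $\bar\eta_\varepsilon(x,y)=(x+a_\varepsilon(x,y),\,y+y\,b_\varepsilon(x,y))$ with real functions $a_\varepsilon$ of class $C^k$ and $b_\varepsilon$ of class $C^{k-1}$ on $\mathbb R/\mathbb Z\times[0,\delta[$, that is, up to the boundary $y=0$; and $$\lim_{\varepsilon\to0}\|\bar\eta_\varepsilon-\mathrm{id}\|_{C^k}=\lim_{\varepsilon\to 0}\|(a_\varepsilon,\,y\,b_\varepsilon)\|_{C^k(\mathbb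 R/\mathbb Z\times]0,\delta[)}=0 .$$ 3. There is a probability measure $\bar\pi_\varepsilon$ on $\mathbb R/\mathbb Z\times\,]0,c[$, with positive continuous density with respect to Lebesgue measure, which $\bar f_\varepsilon$ preserves: $\bar\pi_\varepsilon(\bar f_\varepsilon^{-1}(A))=\bar\pi_\varepsilon(A)$ for every Borel set $A\subset\bar f_\varepsilon(\mathbb R/\mathbb Z\times\,]0,\delta[)$. -/

import Mathlib

open Set Filter Topology MeasureTheory
open scoped ENNReal

namespace Sep

/-- The plane `ℝ²`. -/
abbrev Plane : Type := ℝ × ℝ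

/-- The cylinder `ℝ/ℤ × ℝ`. -/
abbrev Cyl : Type := UnitAddCircle × ℝ

/-- The covering map `ℝ² → ℝ/ℤ × ℝ`. -/
noncomputable def proj (p : Plane) : Cyl := ((p.1 : UnitAddCircle), p.2)

/-- The open annulus `ℝ/ℤ × ]0, c[`. -/
def annulus (c : ℝ) : Set Cyl := {w | 0 < w.2 ∧ w.2 < c}

/-- The `C^k`-norm on the open set `U` (with values in `[0, ∞]`): the supremum over `U` of the
norms of all derivatives of order at most `k`. -/
noncomputable def ckNorm (k : ℕ) (U : Set Plane) (g : Plane → Plane) : ℝ≥0∞ :=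
  ⨆ i ∈ Finset.range (k + 1), ⨆ z ∈ U, ‖iteratedFDeriv ℝ i g z‖ₑ

/-- A map between subsets of the cylinder is `C^k` on the open set `S` if locally it lifts to a
`C^k` map of the plane. -/
def CkOn (k : ℕ) (Φ : Cyl → Cyl) (S : Set Cyl) : Prop :=
  ∀ p : Plane, proj p ∈ S →
    ∃ G : Plane → Plane, ContDiffAt ℝ k G p ∧ ∀ᶠ p' in 𝓝 p, Φ (proj p') = proj (G p')

/-- `Φ` is a `C^k` diffeomorphism from the open set `S` of the cylinder onto its (open) image. -/
def IsCkDiffeoOn (k : ℕ) (Φ : Cyl → Cyl) (S : Set Cyl) : Prop :=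
  InjOn Φ S ∧ IsOpen (Φ '' S) ∧ CkOn k Φ S ∧
    ∃ Ψ : Cyl → Cyl, LeftInvOn Ψ Φ S ∧ CkOn k Ψ (Φ '' S)

/-- The Hamiltonian vector field `J ∇ Q`, with `J = (0 -1; 1 0)`. -/
noncomputable def hamField (Q : Plane → ℝ) (z : Plane) : Plane :=
  (-(fderiv ℝ Q z (0, 1)), fderiv ℝ Q z (1, 0))

/-- On `U`, the map `F` is the time-1 map of the (autonomous) vector field `X`. -/
def IsTimeOneMapOn (X : Plane → Plane) (F : Plane → Plane) (U : Set Plane) : Prop :=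
  ∀ z ∈ U, ∃ γ : ℝ → Plane, γ 0 = z ∧ (∀ t, HasDerivAt γ (X (γ t)) t) ∧ F z = γ 1

/-- A `C^k` diffeomorphism of the plane preserving the symplectic form `dx ∧ dy`. -/
structure IsSymplecticDiffeo (k : ℕ) (f : Equiv.Perm Plane) : Prop where
  contDiff : ContDiff ℝ k f
  contDiff_symm : ContDiff ℝ k f.symm
  det_eq_one : ∀ z, (fderiv ℝ f z).det = 1

/-- `S` is a (non-split) separatrix of `f` associated to the fixed point `o = (0,0)`: an invariant
compact connected set containing `o` such that `S \ {o}` is a nonempty connected one-dimensional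
manifold, all of whose points tend to `o` in the future and in the past. -/
structure IsSeparatrix (f : Equiv.Perm Plane) (S : Set Plane) : Prop where
  zero_mem : (0 : Plane) ∈ S
  isCompact : IsCompact S
  isConnected : IsConnected S
  image_eq : f '' S = S
  isConnected_diff : IsConnected (S \ {0})
  manifold : Nonempty (ChartedSpace ℝ ↥(S \ {(0 : Plane)}))
  tendsto_forward : ∀ z ∈ S, Tendsto (fun n : ℕ => f^[n] z) atTop (𝓝 0)
  tendsto_backward : ∀ z ∈ S, Tendsto (fun n : ℕ => f.symm^[n] z) atTop (𝓝 0)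

/-- The standing assumptions on the family `(f_ε)`, `ε ∈ I`, of `C^k` symplectic diffeomorphisms.
`S ε` is the separatrix of `f ε`, `q ε` gives the normal form of `f ε` on the neighbourhood `V` of
the origin, and `H` is the Hamiltonian whose time-1 map is `f 0`. -/
structure IsSeparatrixFamily (k : ℕ) (I : Set ℝ) (f : ℝ → Equiv.Perm Plane) (S : ℝ → Set Plane)
    (lam : ℝ) (q : ℝ → ℝ → ℝ) (V : Set Plane) (H : Plane → ℝ) : Prop where
  isOpen_I : IsOpen I
  ordConnected_I : I.OrdConnected
  zero_mem_I : (0 : ℝ) ∈ I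
  symplectic : ∀ ε ∈ I, IsSymplecticDiffeo k (f ε)
  separatrix : ∀ ε ∈ I, IsSeparatrix (f ε) (S ε)
  /-- The axes are labelled so that the separatrix leaves the origin along the positive half of the
  unstable axis `{0} × ℝ` and comes back along the positive half of the stable axis `ℝ × {0}`. -/
  branches : ∀ ε ∈ I, ∀ᶠ t : ℝ in 𝓝[>] 0, ((t, 0) : Plane) ∈ S ε ∧ ((0, t) : Plane) ∈ S ε
  /-- `ε ↦ f_ε - id` is continuous for the `C^k`-norm on `ℝ²`. -/
  continuous : ∀ ε₀ ∈ I,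
    Tendsto (fun ε => ckNorm k univ (fun z => f ε z - f ε₀ z)) (𝓝[I] ε₀) (𝓝 0)
  lam_pos : 0 < lam
  V_mem : V ∈ 𝓝 (0 : Plane)
  q_contDiff : ∀ ε ∈ I, ContDiff ℝ ((k + 1 : ℕ)) (q ε)
  q_zero : ∀ ε ∈ I, q ε 0 = 0
  q_deriv : ∀ ε ∈ I, deriv (q ε) 0 = lam
  normalForm : ∀ ε ∈ I, IsTimeOneMapOn (hamField (fun z => q ε (z.1 * z.2))) (f ε) V
  H_contDiff : ContDiff ℝ k H
  timeOne : IsTimeOneMapOn (hamField H) (f 0) univ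
  field_eq : ∀ z ∈ V, hamField H z = hamField (fun z => q 0 (z.1 * z.2)) z

/-- The coordinates `Ξ₁(x, y) = (ln x, x y)` on `x > 0`. -/
noncomputable def xi1 (z : Plane) : Plane := (Real.log z.1, z.1 * z.2)

/-- The coordinates `Ξ₂(x, y) = (-ln y, x y)` on `y > 0`. -/
noncomputable def xi2 (z : Plane) : Plane := (-Real.log z.2, z.1 * z.2)

/-- `T_a : (u, v) ↦ (u + a(v), v)` on the plane. -/
def planeTwist (a : ℝ → ℝ) (z : Plane) : Plane := (z.1 + a z.2, z.2)

/-- `T_l : (x, y) ↦ (x + l(y), y)` on the cylinder. -/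
def cylTwist (l : ℝ → UnitAddCircle) (w : Cyl) : Cyl := (w.1 + l w.2, w.2)

/-- The number `N` of backward iterates of `f` needed to bring the piece of separatrix
`]f(x_*), x_*] × {0}` back into `V`. -/
noncomputable def transitTime (f : Equiv.Perm Plane) (V : Set Plane) (xs : ℝ) : ℕ :=
  sInf {n | 1 ≤ n ∧ ∀ x : ℝ, (f (xs, 0)).1 < x → x ≤ xs → f.symm^[n] (x, 0) ∈ V}

/-- The fundamental domain `F ∪ L`: `L` is the open vertical segment from `(x_*, 0)` to
`(x_*, y_*)`, and `F` is the open region bounded by the horizontal axis, by `L`, by the hyperbola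
`xy = x_* y_*` and by the curve `f(L)`. The point `p = (x_*, v / x_*)` is the point of `L` on the
hyperbola `xy = v`, and `f p` is the point of `f(L)` on it. -/
def fundDomain (f : Plane → Plane) (xs ys : ℝ) : Set Plane :=
  {z | 0 < z.1 ∧ 0 < z.1 * z.2 ∧ z.1 * z.2 < xs * ys ∧
    (f (xs, z.1 * z.2 / xs)).1 < z.1 ∧ z.1 ≤ xs}

/-- The set of all `j ≥ 1` with `f^j(z) ∈ f^{-N}(D)`. -/
def returnSet (f : Plane → Plane) (N : ℕ) (D : Set Plane) (z : Plane) : Set ℕ :=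
  {j | 1 ≤ j ∧ f^[N] (f^[j] z) ∈ D}

/-- The first return map `f^(N + ñ)` in `D`, where `ñ(z)` is the least `j ≥ 1` such that
`f^j(z) ∈ f^{-N}(D)`. -/
noncomputable def firstReturn (f : Plane → Plane) (N : ℕ) (D : Set Plane) (z : Plane) : Plane :=
  f^[N + sInf (returnSet f N D z)] z

/-- The normalizing coordinates `h = j ∘ g ∘ Ξ₁`, where `g(u, v) = (u / q'(v), v)` and `j` is the
shift `(x, y) ↦ (x - γ(y), y)` with `γ = ln x_* / q'`, which puts `L` on `{0} × ]0, c[`. -/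
noncomputable def normalize (q : ℝ → ℝ) (xs : ℝ) (z : Plane) : Plane :=
  ((xi1 z).1 / deriv q (xi1 z).2 - Real.log xs / deriv q (xi1 z).2, (xi1 z).2)

/-- The renormalized map `h ∘ f̂ ∘ h⁻¹` of the annulus, where `f̂` is the first return map in the
fundamental domain and `h⁻¹` is the inverse of the bijection from the fundamental domain to the
annulus `ℝ/ℤ × ]0, x_* y_*[` induced by `h`. -/
noncomputable def renorm (f : Plane → Plane) (q : ℝ → ℝ) (N : ℕ) (xs ys : ℝ) (w : Cyl) : Cyl :=
  proj (normalize q xs (firstReturn f N (fundDomain f xs ys)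
    (Function.invFunOn (fun z => proj (normalize q xs z)) (fundDomain f xs ys) w)))

/-- `μ` is a probability measure on `ℝ/ℤ × ]0, c[` with a positive continuous density with respect
to Lebesgue measure. -/
def IsProbWithPosDensity (c : ℝ) (μ : Measure Cyl) : Prop :=
  IsProbabilityMeasure μ ∧ ∃ ρ : Cyl → ℝ, ContinuousOn ρ (annulus c) ∧
    (∀ w ∈ annulus c, 0 < ρ w) ∧
    μ = ((volume : Measure Cyl).restrict (annulus c)).withDensity (fun w => ENNReal.ofReal (ρ w))

/-- `Φ`, defined on `S`, preserves `μ`: `μ(A) = μ(Φ⁻¹(A))` for each Borel set `A` on which `Φ⁻¹` is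
defined. -/
def PreservesOn (Φ : Cyl → Cyl) (S : Set Cyl) (μ : Measure Cyl) : Prop :=
  ∀ A : Set Cyl, MeasurableSet A → A ⊆ Φ '' S → μ (S ∩ Φ ⁻¹' A) = μ A

end Sep

/-! Near the origin the flow of the normal form keeps `v = xy` fixed, so `f_ε` is `(x, y) ↦ (x
e^{-q'(v)}, y e^{q'(v)})`; in the logarithmic coordinates `Ξ₁` and `Ξ₂` it is the translation `u ↦ u
- q'(v)`. A return to the fundamental domain therefore consists of a number of translations followed
by one transition map, `trans` `= Ξ₁ ∘ f_ε^N ∘ Ξ₂⁻¹`, which has to be known only on a compact window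
around the `N`-th preimage of `(x_*, 0)`.

For `ε = 0` the energy is conserved and is a monotone function of `xy` near the origin, so the
transition map preserves `v`; as it also preserves area, it is a shear `T_σ`
(`hasDerivAt_trans_fst`). For every `ε`, the map commutes with its own iterate, so the transition
map commutes with the translation by the frequency (`trans_sub`). Undoing the shear and dividing by
the frequency turns it into `lift`, which commutes with the unit translation and so descends to the
cylinder: this is `η_ε`. Since `lift` is the identity at `ε = 0` and depends continuously on `ε` in
`C^k`, it is close to the identity (`eventually_lift_small`).

The form `y + y b` requires `η_ε` to preserve `y = 0`: the stable and unstable manifolds must still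
coincide in the window when `ε ≠ 0`. An area preserving map of the plane is exact, and a generating
function argument gives one homoclinic point (`exists_homoclinic`). Both branches lie in the
one-dimensional manifold `Σ_ε \ {o}`, in which the stable axis is open by invariance of domain, so
one common point forces coincidence along the window (`unstable_eq_stable`). Then `b` is a Hadamard
quotient, with one derivative less.

The displacement of `lift` is at most `1/2`, so the return time is one of three consecutive integers
(`exists_isLeast`). Modulo `ℤ` this integer disappears, and the return map is `η_ε ∘ T_l`
(`renorm_eq`). Finally, the first return map preserves area, which in the normalized coordinates has
density `q'_ε`. -/

namespace Sep

/-! ### Families of `C^k` maps that are continuous in the parameter at `ε = 0` -/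

section ParametricSmoothness

variable {E F G H : Type} [NormedAddCommGroup E] [NormedSpace ℝ E] [NormedAddCommGroup F]
  [NormedSpace ℝ F] [NormedAddCommGroup G] [NormedSpace ℝ G] [NormedAddCommGroup H]
  [NormedSpace ℝ H]

/-- The family `g ε`, near the point `z`, is `C^k` for `ε` near `0`, and its derivatives of order at
most `k` depend on `(ε, z')` continuously at `(0, z)`. -/
structure FamilyCk (k : ℕ) (g : ℝ → E → F) (z : E) : Prop where
  contDiffAt : ∀ᶠ p : ℝ × E in 𝓝 (0, z), ContDiffAt ℝ k (g p.1) p.2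
  continuousAt : ∀ i ≤ k, ContinuousAt (fun p : ℝ × E => iteratedFDeriv ℝ i (g p.1) p.2) (0, z)

namespace FamilyCk

variable {k : ℕ} {g g' : ℝ → E → F} {z : E}

theorem mono {m : ℕ} (h : FamilyCk k g z) (hm : m ≤ k) : FamilyCk m g z :=
  ⟨h.contDiffAt.mono fun _ hp => hp.of_le (by exact_mod_cast hm),
    fun i hi => h.continuousAt i (hi.trans hm)⟩

theorem continuousAt_zero (h : FamilyCk k g z) :
    ContinuousAt (fun p : ℝ × E => g p.1 p.2) (0, z) := by
  have := h.continuousAt 0 (Nat.zero_le _)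
  have h2 := (continuousMultilinearCurryFin0 ℝ E F).continuous.continuousAt.comp this
  refine h2.congr (Eventually.of_forall fun p => ?_)
  simp [Function.comp]

theorem zero_iff : FamilyCk 0 g z ↔ (∀ᶠ p : ℝ × E in 𝓝 (0, z), ContDiffAt ℝ 0 (g p.1) p.2) ∧
    ContinuousAt (fun p : ℝ × E => g p.1 p.2) (0, z) := by
  refine ⟨fun h => ⟨by exact_mod_cast h.contDiffAt, h.continuousAt_zero⟩, fun h => ⟨by exact_mod_cast h.1, ?_⟩⟩
  intro i hi
  obtain rfl : i = 0 := by omega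
  have h2 := (continuousMultilinearCurryFin0 ℝ E F).symm.continuous.continuousAt.comp h.2
  exact h2

/-- Peels off one derivative, so that the closure properties below can be proved by induction on
`k`, with a target space that changes along the induction. -/
theorem succ_iff : FamilyCk (k + 1) g z ↔
    (∀ᶠ p : ℝ × E in 𝓝 (0, z), ContDiffAt ℝ (k + 1 : ℕ) (g p.1) p.2) ∧
    ContinuousAt (fun p : ℝ × E => g p.1 p.2) (0, z) ∧
    FamilyCk k (fun ε => fderiv ℝ (g ε)) z := by
  constructor
  · intro h
    refine ⟨h.contDiffAt, h.continuousAt_zero, ?_, ?_⟩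
    · filter_upwards [h.contDiffAt] with p hp
      exact hp.fderiv_right (by simp)
    · intro i hi
      have := (continuousMultilinearCurryRightEquiv' ℝ i E F).continuous.continuousAt.comp
        (h.continuousAt (i + 1) (by omega))
      refine this.congr (Eventually.of_forall fun p => ?_)
      simp only [Function.comp, iteratedFDeriv_succ_eq_comp_right]
      exact (continuousMultilinearCurryRightEquiv' ℝ i E F).apply_symm_apply _
  · rintro ⟨h1, h2, h3⟩
    refine ⟨h1, ?_⟩
    rintro (_ | i) hi
    · exact ((continuousMultilinearCurryFin0 ℝ E F).symm.continuous.continuousAt.comp h2)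
    · have := (continuousMultilinearCurryRightEquiv' ℝ i E F).symm.continuous.continuousAt.comp
        (h3.continuousAt i (by omega))
      refine this.congr (Eventually.of_forall fun p => ?_)
      simp only [Function.comp, iteratedFDeriv_succ_eq_comp_right]

theorem congr (h : FamilyCk k g z) (hg : ∀ᶠ p : ℝ × E in 𝓝 (0, z), g p.1 p.2 = g' p.1 p.2) :
    FamilyCk k g' z := by
  have key : ∀ᶠ p : ℝ × E in 𝓝 (0, z), g p.1 =ᶠ[𝓝 p.2] g' p.1 := by
    filter_upwards [hg.eventually_nhds] with p hp
    have : Tendsto (fun y : E => (p.1, y)) (𝓝 p.2) (𝓝 p) :=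
      (Continuous.prodMk_right p.1).tendsto' _ _ rfl
    exact this.eventually hp
  constructor
  · filter_upwards [h.contDiffAt, key] with p hp hk
    exact hp.congr_of_eventuallyEq hk.symm
  · intro i hi
    refine (h.continuousAt i hi).congr ?_
    filter_upwards [key] with p hk
    exact (hk.iteratedFDeriv ℝ i).self_of_nhds

/-- A fixed `C^k` map is a family. -/
theorem const {g₀ : E → F} (h : ∀ᶠ y in 𝓝 z, ContDiffAt ℝ k g₀ y) :
    FamilyCk k (fun _ => g₀) z := by
  have hs : Tendsto (Prod.snd : ℝ × E → E) (𝓝 (0, z)) (𝓝 z) := continuous_snd.tendsto _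
  refine ⟨hs.eventually h, fun i hi => ?_⟩
  have h1 : ContinuousAt (iteratedFDeriv ℝ i g₀) z :=
    (h.self_of_nhds.iteratedFDeriv_right (m := 0) (by simpa using (by exact_mod_cast hi))).continuousAt
  exact ContinuousAt.comp (f := Prod.snd) (x := ((0 : ℝ), z)) h1 continuousAt_snd

theorem const_of_contDiff {g₀ : E → F} (h : ContDiff ℝ k g₀) : FamilyCk k (fun _ => g₀) z :=
  const (Eventually.of_forall fun _ => h.contDiffAt)

theorem continuous_linear {g : ℝ → E → F} (h : FamilyCk k g z) (L : F →L[ℝ] G) :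
    FamilyCk k (fun ε y => L (g ε y)) z := by
  refine ⟨h.contDiffAt.mono fun p hp => L.contDiff.contDiffAt.comp _ hp, fun i hi => ?_⟩
  have h1 : ContinuousAt (fun p : ℝ × E =>
      ContinuousLinearMap.compContinuousMultilinearMapL ℝ (fun _ : Fin i => E) F G L
        (iteratedFDeriv ℝ i (g p.1) p.2)) (0, z) :=
    (ContinuousLinearMap.continuous _).continuousAt.comp (h.continuousAt i hi)
  refine h1.congr ?_
  filter_upwards [h.contDiffAt] with p hp
  exact (L.iteratedFDeriv_comp_left hp (by exact_mod_cast hi)).symm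

theorem add (h : FamilyCk k g z) (h' : FamilyCk k g' z) :
    FamilyCk k (fun ε y => g ε y + g' ε y) z := by
  refine ⟨?_, fun i hi => ?_⟩
  · filter_upwards [h.contDiffAt, h'.contDiffAt] with p hp hp'
    exact hp.add hp'
  · refine ((h.continuousAt i hi).add (h'.continuousAt i hi)).congr ?_
    filter_upwards [h.contDiffAt, h'.contDiffAt] with p hp hp'
    have := iteratedFDeriv_add_apply (i := i) (hp.of_le (by exact_mod_cast hi))
      (hp'.of_le (by exact_mod_cast hi))
    exact this.symm

theorem prodMk {g : ℝ → E → F} {g' : ℝ → E → G} (h : FamilyCk k g z) (h' : FamilyCk k g' z) :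
    FamilyCk k (fun ε y => (g ε y, g' ε y)) z := by
  have := (h.continuous_linear (ContinuousLinearMap.inl ℝ F G)).add
    (h'.continuous_linear (ContinuousLinearMap.inr ℝ F G))
  simpa using this

/-- Induction on `k` through the Leibniz rule: the two terms of the derivative are again bilinear,
through `B.precompR` and `B.precompL`, which is why the spaces are generalized. -/
theorem bilinear {F' G' : Type} [NormedAddCommGroup F'] [NormedSpace ℝ F']
    [NormedAddCommGroup G'] [NormedSpace ℝ G'] {H' : Type} [NormedAddCommGroup H']
    [NormedSpace ℝ H'] (B : F' →L[ℝ] G' →L[ℝ] H')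
    {g : ℝ → E → F'} {g' : ℝ → E → G'} (h : FamilyCk k g z) (h' : FamilyCk k g' z) :
    FamilyCk k (fun ε y => B (g ε y) (g' ε y)) z := by
  induction k generalizing F' G' H' with
  | zero =>
    rw [zero_iff] at h h' ⊢
    constructor
    · filter_upwards [h.1, h'.1] with p hp hp'
      exact B.isBoundedBilinearMap.contDiff.contDiffAt.comp p.2 (hp.prodMk hp')
    · exact (B.isBoundedBilinearMap.continuous).continuousAt.comp (h.2.prodMk h'.2)
  | succ k ih =>
    have hk := h
    have hk' := h'
    rw [succ_iff] at h h' ⊢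
    refine ⟨?_, (B.isBoundedBilinearMap.continuous).continuousAt.comp (h.2.1.prodMk h'.2.1), ?_⟩
    · filter_upwards [h.1, h'.1] with p hp hp'
      exact B.isBoundedBilinearMap.contDiff.contDiffAt.comp p.2 (hp.prodMk hp')
    · refine ((ih (B.precompR E) (hk.mono (Nat.le_succ k)) h'.2.2).add
        (ih (B.precompL E) h.2.2 (hk'.mono (Nat.le_succ k)))).congr ?_
      filter_upwards [h.1, h'.1] with p hp hp'
      exact (B.fderiv_of_bilinear (hp.differentiableAt (by simp))
        (hp'.differentiableAt (by simp))).symm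

/-- Induction on `k` through the chain rule: the derivative is a bilinear expression in `Dg` and in
`Dφ` composed with `g`, to which the induction hypothesis applies. -/
theorem comp {φ : ℝ → F → G} {g : ℝ → E → F} (hφ : FamilyCk k φ (g 0 z)) (hg : FamilyCk k g z) :
    FamilyCk k (fun ε y => φ ε (g ε y)) z := by
  induction k generalizing G with
  | zero =>
    have ht : ContinuousAt (fun p : ℝ × E => (p.1, g p.1 p.2)) (0, z) :=
      continuousAt_fst.prodMk hg.continuousAt_zero
    rw [zero_iff] at hφ hg ⊢
    constructor
    · filter_upwards [hg.1, ht.eventually hφ.1] with p hp hp'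
      exact hp'.comp p.2 hp
    · exact ContinuousAt.comp (f := fun p : ℝ × E => (p.1, g p.1 p.2)) (x := (0, z)) hφ.2 ht
  | succ k ih =>
    have ht : ContinuousAt (fun p : ℝ × E => (p.1, g p.1 p.2)) (0, z) :=
      continuousAt_fst.prodMk hg.continuousAt_zero
    have hgk := hg
    rw [succ_iff] at hφ hg ⊢
    refine ⟨?_, ContinuousAt.comp (f := fun p : ℝ × E => (p.1, g p.1 p.2)) (x := (0, z)) hφ.2.1 ht,
      ?_⟩
    · filter_upwards [hg.1, ht.eventually hφ.1] with p hp hp'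
      exact hp'.comp p.2 hp
    · refine (bilinear (ContinuousLinearMap.compL ℝ E F G) (ih hφ.2.2 (hgk.mono (Nat.le_succ k)))
        hg.2.2).congr ?_
      filter_upwards [hg.1, ht.eventually hφ.1] with p hp hp'
      exact (fderiv_comp p.2 (hp'.differentiableAt (by simp)) (hp.differentiableAt (by simp))).symm

theorem comp_const {φ : F → G} {g : ℝ → E → F}
    (hφ : ∀ᶠ y in 𝓝 (g 0 z), ContDiffAt ℝ k φ y) (hg : FamilyCk k g z) :
    FamilyCk k (fun ε y => φ (g ε y)) z :=
  comp (φ := fun _ => φ) (const hφ) hg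

theorem neg (h : FamilyCk k g z) : FamilyCk k (fun ε y => -g ε y) z := by
  simpa using h.continuous_linear (-ContinuousLinearMap.id ℝ F)

theorem sub (h : FamilyCk k g z) (h' : FamilyCk k g' z) :
    FamilyCk k (fun ε y => g ε y - g' ε y) z := by
  simpa [sub_eq_add_neg] using h.add h'.neg

theorem fst {g : ℝ → E → F × G} (h : FamilyCk k g z) : FamilyCk k (fun ε y => (g ε y).1) z :=
  h.continuous_linear (ContinuousLinearMap.fst ℝ F G)

theorem snd {g : ℝ → E → F × G} (h : FamilyCk k g z) : FamilyCk k (fun ε y => (g ε y).2) z :=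
  h.continuous_linear (ContinuousLinearMap.snd ℝ F G)

theorem mul {a b : ℝ → E → ℝ} (h : FamilyCk k a z) (h' : FamilyCk k b z) :
    FamilyCk k (fun ε y => a ε y * b ε y) z :=
  bilinear (ContinuousLinearMap.mul ℝ ℝ) h h'

theorem inv {a : ℝ → E → ℝ} (h : FamilyCk k a z) (h0 : a 0 z ≠ 0) :
    FamilyCk k (fun ε y => (a ε y)⁻¹) z := by
  refine comp_const (φ := fun x : ℝ => x⁻¹) ?_ h
  filter_upwards [isOpen_ne.mem_nhds h0] with y hy
  exact contDiffAt_inv ℝ hy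

theorem div {a b : ℝ → E → ℝ} (h : FamilyCk k a z) (h' : FamilyCk k b z) (h0 : b 0 z ≠ 0) :
    FamilyCk k (fun ε y => a ε y / b ε y) z := by
  simpa [div_eq_mul_inv] using h.mul (h'.inv h0)

theorem log {a : ℝ → E → ℝ} (h : FamilyCk k a z) (h0 : a 0 z ≠ 0) :
    FamilyCk k (fun ε y => Real.log (a ε y)) z := by
  refine comp_const (φ := Real.log) ?_ h
  filter_upwards [isOpen_ne.mem_nhds h0] with y hy
  exact Real.contDiffAt_log.2 hy

theorem iterate {f : ℝ → E → E} (h : ∀ z, FamilyCk k f z) (n : ℕ) (z : E) :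
    FamilyCk k (fun ε => (f ε)^[n]) z := by
  induction n generalizing z with
  | zero => exact const_of_contDiff contDiff_id
  | succ n ih => exact comp (φ := fun ε => (f ε)^[n]) (ih _) (h z)


end FamilyCk

end ParametricSmoothness

/-! ### Explicit form of the map near the origin -/

section NormalForm

theorem hasFDerivAt_comp_mul {q : ℝ → ℝ} (hq : Differentiable ℝ q) (z : Plane) :
    HasFDerivAt (fun z : Plane => q (z.1 * z.2))
      (deriv q (z.1 * z.2) • (z.1 • ContinuousLinearMap.snd ℝ ℝ ℝ +
        z.2 • ContinuousLinearMap.fst ℝ ℝ ℝ)) z := by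
  have h1 : HasFDerivAt (fun z : Plane => z.1 * z.2)
      (z.1 • ContinuousLinearMap.snd ℝ ℝ ℝ + z.2 • ContinuousLinearMap.fst ℝ ℝ ℝ) z :=
    HasFDerivAt.mul hasFDerivAt_fst hasFDerivAt_snd
  exact (hq _).hasDerivAt.comp_hasFDerivAt z h1

theorem hamField_comp_mul {q : ℝ → ℝ} (hq : Differentiable ℝ q) (z : Plane) :
    hamField (fun z => q (z.1 * z.2)) z =
      (-(deriv q (z.1 * z.2) * z.1), deriv q (z.1 * z.2) * z.2) := by
  simp [hamField, (hasFDerivAt_comp_mul hq z).fderiv]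

/-- The product `xy` is a first integral, so along an orbit the field is linear with constant
coefficient `p = q'(xy)`. Then `x e^{pt}` and `y e^{-pt}` are constant, and no uniqueness theorem is
needed. -/
theorem IsTimeOneMapOn.apply_eq {q : ℝ → ℝ} (hq : Differentiable ℝ q) {F : Plane → Plane}
    {U : Set Plane} (h : IsTimeOneMapOn (hamField (fun z => q (z.1 * z.2))) F U) {z : Plane}
    (hz : z ∈ U) :
    F z = (z.1 * Real.exp (-deriv q (z.1 * z.2)), z.2 * Real.exp (deriv q (z.1 * z.2))) := by
  obtain ⟨γ, h0, hγ, h1⟩ := h z hz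
  simp only [hamField_comp_mul hq] at hγ
  have ha : ∀ t, HasDerivAt (fun t => (γ t).1)
      (-(deriv q ((γ t).1 * (γ t).2) * (γ t).1)) t := fun t => (hγ t).fst
  have hb : ∀ t, HasDerivAt (fun t => (γ t).2)
      (deriv q ((γ t).1 * (γ t).2) * (γ t).2) t := fun t => (hγ t).snd
  have hv : ∀ t, (γ t).1 * (γ t).2 = z.1 * z.2 := by
    intro t
    have hd : ∀ t, HasDerivAt (fun t => (γ t).1 * (γ t).2) 0 t := fun t => by
      convert! (ha t).mul (hb t) using 1; ring
    have := is_const_of_deriv_eq_zero (fun t => (hd t).differentiableAt) (fun t => (hd t).deriv) t 0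
    simpa [h0] using this
  simp only [hv] at ha hb
  set p := deriv q (z.1 * z.2)
  have e1 : ∀ c : ℝ, ∀ t : ℝ, HasDerivAt (fun t => Real.exp (c * t)) (Real.exp (c * t) * c) t := by
    intro c t
    simpa using ((hasDerivAt_id t).const_mul c).exp
  have ca : (γ 1).1 * Real.exp p = z.1 := by
    have hd : ∀ t, HasDerivAt (fun t => (γ t).1 * Real.exp (p * t)) 0 t := fun t => by
      convert! (ha t).mul (e1 p t) using 1; ring
    have := is_const_of_deriv_eq_zero (fun t => (hd t).differentiableAt) (fun t => (hd t).deriv) 1 0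
    simpa [h0] using this
  have cb : (γ 1).2 * Real.exp (-p) = z.2 := by
    have hd : ∀ t, HasDerivAt (fun t => (γ t).2 * Real.exp (-p * t)) 0 t := fun t => by
      convert! (hb t).mul (e1 (-p) t) using 1; ring
    have := is_const_of_deriv_eq_zero (fun t => (hd t).differentiableAt) (fun t => (hd t).deriv) 1 0
    simpa [h0] using this
  rw [h1]
  ext
  · simp [← ca, mul_assoc, ← Real.exp_add]
  · simp [← cb, mul_assoc, ← Real.exp_add]

theorem IsTimeOneMapOn.hamiltonian_eq {H : Plane → ℝ} (hH : Differentiable ℝ H)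
    {F : Plane → Plane} {U : Set Plane} (h : IsTimeOneMapOn (hamField H) F U) {z : Plane}
    (hz : z ∈ U) : H (F z) = H z := by
  obtain ⟨γ, h0, hγ, h1⟩ := h z hz
  have hd : ∀ t, HasDerivAt (fun t => H (γ t)) 0 t := fun t => by
    have := (hH (γ t)).hasFDerivAt.comp_hasDerivAt t (hγ t)
    convert! this using 1
    set L := fderiv ℝ H (γ t) with hL
    have : hamField H (γ t) = (-(L (0, 1))) • ((1, 0) : Plane) + (L (1, 0)) • ((0, 1) : Plane) := by
      simp [hamField, hL]
    rw [this, map_add, map_smul, map_smul]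
    simp; ring
  have := is_const_of_deriv_eq_zero (fun t => (hd t).differentiableAt) (fun t => (hd t).deriv) 1 0
  simpa [h0, h1] using this

theorem plane_mem_ball {R : ℝ} {z : Plane} : z ∈ Metric.ball (0 : Plane) R ↔ |z.1| < R ∧ |z.2| < R := by
  simp [Prod.norm_def]

/-- The plane maps `f`, with generating function `q`, is in normal form on the box of size `R`. -/
def IsNormalOn (f : Plane → Plane) (q : ℝ → ℝ) (R : ℝ) : Prop :=
  ∀ z : Plane, |z.1| < R → |z.2| < R →
    f z = (z.1 * Real.exp (-deriv q (z.1 * z.2)), z.2 * Real.exp (deriv q (z.1 * z.2)))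

/-- Since `|x|` does not increase and `|y|` does not decrease, the orbit stays in the box as soon as
its last ordinate does. -/
theorem IsNormalOn.iterate {f : Plane → Plane} {q : ℝ → ℝ} {R : ℝ} (h : IsNormalOn f q R)
    {z : Plane} (hp : 0 ≤ deriv q (z.1 * z.2)) (h1 : |z.1| < R) {n : ℕ}
    (h2 : |z.2| * Real.exp (n * deriv q (z.1 * z.2)) < R) :
    f^[n] z = (z.1 * Real.exp (-(n * deriv q (z.1 * z.2))),
      z.2 * Real.exp (n * deriv q (z.1 * z.2))) := by
  set p := deriv q (z.1 * z.2) with hpd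
  induction n with
  | zero => simp
  | succ n ih =>
    have hle : Real.exp (n * p) ≤ Real.exp ((n + 1 : ℕ) * p) := by
      apply Real.exp_le_exp.2; push_cast; nlinarith
    have h3 : |z.2| * Real.exp (n * p) < R :=
      lt_of_le_of_lt (mul_le_mul_of_nonneg_left hle (abs_nonneg _)) h2
    have h4 : |z.1 * Real.exp (-(n * p))| < R := by
      rw [abs_mul, abs_of_pos (Real.exp_pos _)]
      refine lt_of_le_of_lt (mul_le_of_le_one_right (abs_nonneg _) ?_) h1
      apply Real.exp_le_one_iff.2
      have : 0 ≤ n * p := by positivity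
      linarith
    have h5 : |z.2 * Real.exp (n * p)| < R := by
      rwa [abs_mul, abs_of_pos (Real.exp_pos _)]
    have hv : z.1 * Real.exp (-(n * p)) * (z.2 * Real.exp (n * p)) = z.1 * z.2 := by
      rw [Real.exp_neg]; field_simp
    rw [Function.iterate_succ_apply', ih h3, h _ h4 h5]
    simp only [hv, ← hpd]
    ext
    · simp only [mul_assoc, ← Real.exp_add]; congr 2; push_cast; ring
    · simp only [mul_assoc, ← Real.exp_add]; congr 2; push_cast; ring

end NormalForm

/-! ### Orbits on the two axes -/

section Family

variable {k : ℕ} {I : Set ℝ} {f : ℝ → Equiv.Perm Plane} {S : ℝ → Set Plane}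
    {lam : ℝ} {q : ℝ → ℝ → ℝ} {V₀ : Set Plane} {H : Plane → ℝ}

/-- The box of size `R` is contained in the normal form neighbourhood, and the frequency of `f 0` is
positive on it. -/
structure IsGoodRadius (q : ℝ → ℝ) (V₀ : Set Plane) (R : ℝ) : Prop where
  pos : 0 < R
  ball_subset : Metric.ball (0 : Plane) R ⊆ V₀
  deriv_pos : ∀ v, |v| < R ^ 2 → 0 < deriv q v

theorem IsSeparatrixFamily.differentiable_q (hf : IsSeparatrixFamily k I f S lam q V₀ H)
    {ε : ℝ} (hε : ε ∈ I) : Differentiable ℝ (q ε) :=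
  (hf.q_contDiff ε hε).differentiable (by simp)

theorem IsSeparatrixFamily.contDiff_deriv_q (hf : IsSeparatrixFamily k I f S lam q V₀ H)
    {ε : ℝ} (hε : ε ∈ I) : ContDiff ℝ k (deriv (q ε)) := by
  have := hf.q_contDiff ε hε
  exact ((contDiff_succ_iff_deriv (n := k)).1 (by exact_mod_cast this)).2.2

theorem IsSeparatrixFamily.exists_isGoodRadius (hf : IsSeparatrixFamily k I f S lam q V₀ H) :
    ∃ R, IsGoodRadius (q 0) V₀ R := by
  obtain ⟨R₁, hR₁, h1⟩ := Metric.mem_nhds_iff.1 hf.V_mem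
  have hc : ∀ᶠ v in 𝓝 (0 : ℝ), 0 < deriv (q 0) v := by
    have := (hf.contDiff_deriv_q hf.zero_mem_I).continuous.tendsto 0
    rw [hf.q_deriv 0 hf.zero_mem_I] at this
    exact this.eventually (lt_mem_nhds hf.lam_pos)
  obtain ⟨R₂, hR₂, h2⟩ := Metric.eventually_nhds_iff.1 hc
  -- The bound by `1` gives `R ^ 2 ≤ R ≤ R₂`, so the products `xy` of points of the box lie where
  -- the frequency is positive.
  refine ⟨min R₁ (min 1 R₂), by positivity, (Metric.ball_subset_ball (min_le_left _ _)).trans h1,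
    fun v hv => h2 ?_⟩
  rw [Real.dist_eq, sub_zero]
  have h3 : min R₁ (min 1 R₂) ≤ 1 := (min_le_right _ _).trans (min_le_left _ _)
  have h4 : min R₁ (min 1 R₂) ≤ R₂ := (min_le_right _ _).trans (min_le_right _ _)
  have h5 : 0 < min R₁ (min 1 R₂) := by positivity
  nlinarith

theorem IsSeparatrixFamily.isNormalOn (hf : IsSeparatrixFamily k I f S lam q V₀ H)
    {R : ℝ} (hR : IsGoodRadius (q 0) V₀ R) {ε : ℝ} (hε : ε ∈ I) : IsNormalOn (f ε) (q ε) R :=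
  fun _ h1 h2 => (hf.normalForm ε hε).apply_eq (hf.differentiable_q hε)
    (hR.ball_subset (plane_mem_ball.2 ⟨h1, h2⟩))

variable {R : ℝ}

theorem IsSeparatrixFamily.iterate_stable (hf : IsSeparatrixFamily k I f S lam q V₀ H)
    (hR : IsGoodRadius (q 0) V₀ R) {ε : ℝ} (hε : ε ∈ I) {x : ℝ} (hx : |x| < R) (n : ℕ) :
    (f ε)^[n] (x, 0) = (x * Real.exp (-(n * lam)), 0) := by
  have := (hf.isNormalOn hR hε).iterate (z := (x, 0)) (n := n)
    (by simp [hf.q_deriv ε hε, hf.lam_pos.le]) hx (by simp [hR.pos])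
  simpa [hf.q_deriv ε hε] using this

theorem IsSeparatrixFamily.iterate_unstable (hf : IsSeparatrixFamily k I f S lam q V₀ H)
    (hR : IsGoodRadius (q 0) V₀ R) {ε : ℝ} (hε : ε ∈ I) {y : ℝ} (n : ℕ)
    (hy : |y| * Real.exp (n * lam) < R) :
    (f ε)^[n] (0, y) = (0, y * Real.exp (n * lam)) := by
  have := (hf.isNormalOn hR hε).iterate (z := (0, y)) (n := n)
    (by simp [hf.q_deriv ε hε, hf.lam_pos.le]) (by simp [hR.pos])
    (by simpa [hf.q_deriv ε hε] using hy)
  simpa [hf.q_deriv ε hε] using this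

theorem IsSeparatrixFamily.symm_iterate_unstable (hf : IsSeparatrixFamily k I f S lam q V₀ H)
    (hR : IsGoodRadius (q 0) V₀ R) {ε : ℝ} (hε : ε ∈ I) {y : ℝ} (n : ℕ) (hy : |y| < R) :
    (f ε).symm^[n] (0, y) = (0, y * Real.exp (-(n * lam))) := by
  have hpos : Real.exp (-(n * lam)) * Real.exp (n * lam) = 1 := by rw [← Real.exp_add]; simp
  have := hf.iterate_unstable hR hε (y := y * Real.exp (-(n * lam))) n (by
    rw [abs_mul, abs_of_pos (Real.exp_pos _), mul_assoc, hpos, mul_one]; exact hy)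
  rw [mul_assoc, hpos, mul_one] at this
  rw [← this]
  exact ((f ε).left_inv.iterate n) _

theorem IsSeparatrix.iterate_mem_iff {g : Equiv.Perm Plane} {T : Set Plane} (h : IsSeparatrix g T)
    (n : ℕ) (z : Plane) : g^[n] z ∈ T ↔ z ∈ T := by
  induction n with
  | zero => simp
  | succ n ih =>
    rw [Function.iterate_succ_apply', ← ih]
    conv_lhs => rw [← h.image_eq]
    exact g.injective.mem_set_image

/-- `branches` only concerns small `t`; forward iteration brings `t` there and the separatrix is
invariant. -/
theorem IsSeparatrixFamily.stable_mem (hf : IsSeparatrixFamily k I f S lam q V₀ H)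
    (hR : IsGoodRadius (q 0) V₀ R) {ε : ℝ} (hε : ε ∈ I) {t : ℝ} (h0 : 0 < t) (ht : t < R) :
    ((t, 0) : Plane) ∈ S ε := by
  have hlim : Tendsto (fun n : ℕ => t * Real.exp (-(n * lam))) atTop (𝓝[>] 0) := by
    rw [tendsto_nhdsWithin_iff]
    refine ⟨?_, Eventually.of_forall fun n => mul_pos h0 (Real.exp_pos _)⟩
    have := (Real.tendsto_exp_neg_atTop_nhds_zero.comp
      (tendsto_natCast_atTop_atTop.atTop_mul_const hf.lam_pos)).const_mul t
    simpa [Function.comp_def] using this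
  obtain ⟨n, hn⟩ := (hlim.eventually (hf.branches ε hε)).exists
  rw [← (hf.separatrix ε hε).iterate_mem_iff n,
    hf.iterate_stable hR hε (by rwa [abs_of_pos h0])]
  exact hn.1

theorem IsSeparatrixFamily.unstable_mem (hf : IsSeparatrixFamily k I f S lam q V₀ H)
    (hR : IsGoodRadius (q 0) V₀ R) {ε : ℝ} (hε : ε ∈ I) {t : ℝ} (h0 : 0 < t) (ht : t < R) :
    ((0, t) : Plane) ∈ S ε := by
  have hlim : Tendsto (fun n : ℕ => t * Real.exp (-(n * lam))) atTop (𝓝[>] 0) := by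
    rw [tendsto_nhdsWithin_iff]
    refine ⟨?_, Eventually.of_forall fun n => mul_pos h0 (Real.exp_pos _)⟩
    have := (Real.tendsto_exp_neg_atTop_nhds_zero.comp
      (tendsto_natCast_atTop_atTop.atTop_mul_const hf.lam_pos)).const_mul t
    simpa [Function.comp_def] using this
  obtain ⟨n, hn⟩ := (hlim.eventually (hf.branches ε hε)).exists
  have h1 := (hf.separatrix ε hε).iterate_mem_iff n (0, t * Real.exp (-(n * lam)))
  have hpos : Real.exp (-(n * lam)) * Real.exp (n * lam) = 1 := by rw [← Real.exp_add]; simp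
  rw [hf.iterate_unstable hR hε, mul_assoc, hpos, mul_one] at h1
  · exact h1.2 hn.2
  · rw [abs_of_pos (by positivity), mul_assoc, hpos, mul_one]; exact ht

end Family

theorem iterate_symm_iterate (g : Equiv.Perm Plane) (n : ℕ) (z : Plane) :
    g^[n] (g.symm^[n] z) = z :=
  Function.RightInverse.iterate g.right_inv n z

/-! ### Energy levels of the unperturbed map and its separatrix -/

section Unperturbed

variable {k : ℕ} {I : Set ℝ} {f : ℝ → Equiv.Perm Plane} {S : ℝ → Set Plane}
    {lam : ℝ} {q : ℝ → ℝ → ℝ} {V₀ : Set Plane} {H : Plane → ℝ} {R : ℝ}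

theorem IsSeparatrixFamily.hamiltonian_apply (hk : 1 ≤ k)
    (hf : IsSeparatrixFamily k I f S lam q V₀ H) (z : Plane) : H (f 0 z) = H z :=
  hf.timeOne.hamiltonian_eq (hf.H_contDiff.differentiable (by exact_mod_cast (by omega : k ≠ 0)))
    (mem_univ z)

theorem IsSeparatrixFamily.hamiltonian_iterate (hk : 1 ≤ k)
    (hf : IsSeparatrixFamily k I f S lam q V₀ H) (n : ℕ) (z : Plane) : H ((f 0)^[n] z) = H z := by
  induction n with
  | zero => rfl
  | succ n ih => rw [Function.iterate_succ_apply', hf.hamiltonian_apply hk, ih]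

theorem IsSeparatrixFamily.hamiltonian_symm_iterate (hk : 1 ≤ k)
    (hf : IsSeparatrixFamily k I f S lam q V₀ H) (n : ℕ) (z : Plane) :
    H ((f 0).symm^[n] z) = H z := by
  rw [← hf.hamiltonian_iterate hk n ((f 0).symm^[n] z), iterate_symm_iterate]

/-- The two Hamiltonian fields agree in the box, so the difference of the Hamiltonians has zero
derivative on this convex set. -/
theorem IsSeparatrixFamily.hamiltonian_eq (hk : 1 ≤ k)
    (hf : IsSeparatrixFamily k I f S lam q V₀ H) (hR : IsGoodRadius (q 0) V₀ R) {z : Plane}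
    (h1 : |z.1| < R) (h2 : |z.2| < R) : H z = H 0 + q 0 (z.1 * z.2) := by
  have hq := hf.differentiable_q hf.zero_mem_I
  have hH : Differentiable ℝ H :=
    hf.H_contDiff.differentiable (by exact_mod_cast (by omega : k ≠ 0))
  have hQ : Differentiable ℝ (fun z : Plane => q 0 (z.1 * z.2)) :=
    fun z => (hasFDerivAt_comp_mul hq z).differentiableAt
  have key : ∀ z ∈ Metric.ball (0 : Plane) R,
      fderiv ℝ (fun z : Plane => H z - q 0 (z.1 * z.2)) z = 0 := by
    intro z hz
    rw [fderiv_fun_sub (hH z) (hQ z), sub_eq_zero]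
    have := hf.field_eq z (hR.ball_subset hz)
    simp only [hamField, Prod.mk.injEq, neg_inj] at this
    ext
    · simpa using this.2
    · simpa using this.1
  have := Metric.isOpen_ball.is_const_of_fderiv_eq_zero (𝕜 := ℝ)
    (convex_ball (0 : Plane) R).isPreconnected (fun z _ => ((hH z).sub (hQ z)).differentiableWithinAt)
    (fun z hz => key z hz) (plane_mem_ball.2 ⟨h1, h2⟩) (Metric.mem_ball_self hR.pos)
  have h0 : q 0 ((0 : Plane).1 * (0 : Plane).2) = 0 := by simpa using hf.q_zero 0 hf.zero_mem_I
  rw [Pi.sub_apply, Pi.sub_apply, h0] at this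
  linarith

theorem IsGoodRadius.injOn (hR : IsGoodRadius (q 0) V₀ R) (hq : Differentiable ℝ (q 0)) :
    StrictMonoOn (q 0) (Ioo (-R ^ 2) (R ^ 2)) := by
  refine strictMonoOn_of_deriv_pos (convex_Ioo _ _) hq.continuous.continuousOn fun v hv => ?_
  rw [interior_Ioo] at hv
  exact hR.deriv_pos v (abs_lt.2 ⟨hv.1, hv.2⟩)

theorem abs_mul_lt_sq {R a b : ℝ} (h1 : |a| < R) (h2 : |b| < R) : |a * b| < R ^ 2 := by
  rw [abs_mul, sq]
  exact mul_lt_mul'' h1 h2 (abs_nonneg _) (abs_nonneg _)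

/-- If both `z` and some iterate of `z` are in the box, then `xy` takes the same value at them. -/
theorem IsSeparatrixFamily.mul_eq_of_iterate (hk : 1 ≤ k)
    (hf : IsSeparatrixFamily k I f S lam q V₀ H) (hR : IsGoodRadius (q 0) V₀ R) {z w : Plane}
    (h1 : |z.1| < R) (h2 : |z.2| < R) (h3 : |w.1| < R) (h4 : |w.2| < R) (hH : H w = H z) :
    w.1 * w.2 = z.1 * z.2 := by
  rw [hf.hamiltonian_eq hk hR h1 h2, hf.hamiltonian_eq hk hR h3 h4] at hH
  have e : ∀ {a b : ℝ}, |a| < R → |b| < R → a * b ∈ Ioo (-R ^ 2) (R ^ 2) := fun ha hb => by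
    have := abs_lt.1 (abs_mul_lt_sq ha hb); exact ⟨this.1, this.2⟩
  exact (hR.injOn (hf.differentiable_q hf.zero_mem_I)).injOn (e h3 h4) (e h1 h2) (by linarith)

/-- The points of the zero energy level which are in the box are on the axes. -/
theorem IsSeparatrixFamily.mul_eq_zero_of_hamiltonian (hk : 1 ≤ k)
    (hf : IsSeparatrixFamily k I f S lam q V₀ H) (hR : IsGoodRadius (q 0) V₀ R) {w : Plane}
    (h3 : |w.1| < R) (h4 : |w.2| < R) (hH : H w = H 0) :
    w.1 * w.2 = 0 := by
  simpa using hf.mul_eq_of_iterate hk hR (z := 0) (by simpa using hR.pos) (by simpa using hR.pos)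
    h3 h4 hH

theorem IsSeparatrixFamily.apply_zero (hf : IsSeparatrixFamily k I f S lam q V₀ H)
    (hR : IsGoodRadius (q 0) V₀ R) {ε : ℝ} (hε : ε ∈ I) : f ε 0 = 0 := by
  rw [hf.isNormalOn hR hε 0 (by simpa using hR.pos) (by simpa using hR.pos)]
  ext <;> simp

theorem IsSeparatrixFamily.symm_iterate_ne_zero (hf : IsSeparatrixFamily k I f S lam q V₀ H)
    (hR : IsGoodRadius (q 0) V₀ R) {ε : ℝ} (hε : ε ∈ I) (n : ℕ) {z : Plane} (hz : z ≠ 0) :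
    (f ε).symm^[n] z ≠ 0 := by
  intro h
  have h0 : (f ε)^[n] 0 = 0 := by
    induction n with
    | zero => rfl
    | succ n ih => exact Function.iterate_fixed (hf.apply_zero hR hε) _
  apply hz
  rw [← iterate_symm_iterate (f ε) n z, h, h0]

/-- The energy is constant along an orbit that tends to the origin. -/
theorem IsSeparatrixFamily.hamiltonian_of_mem (hk : 1 ≤ k)
    (hf : IsSeparatrixFamily k I f S lam q V₀ H) {z : Plane} (hz : z ∈ S 0) : H z = H 0 := by
  have h1 := (hf.separatrix 0 hf.zero_mem_I).tendsto_forward z hz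
  have h2 : Tendsto (fun n : ℕ => H ((f 0)^[n] z)) atTop (𝓝 (H 0)) :=
    (hf.H_contDiff.continuous.tendsto 0).comp h1
  simp only [hf.hamiltonian_iterate hk] at h2
  exact tendsto_nhds_unique tendsto_const_nhds h2

/-- The backward orbit of a point of the separatrix is finally on the unstable axis. -/
theorem IsSeparatrixFamily.backward_axis (hk : 1 ≤ k)
    (hf : IsSeparatrixFamily k I f S lam q V₀ H) (hR : IsGoodRadius (q 0) V₀ R) {z : Plane}
    (hz : z ∈ S 0) (hz0 : z ≠ 0) :
    ∀ᶠ n : ℕ in atTop, ∃ y, y ≠ 0 ∧ |y| < R ∧ (f 0).symm^[n] z = (0, y) := by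
  have h1 := (hf.separatrix 0 hf.zero_mem_I).tendsto_backward z hz
  have h2 := eventually_atTop.1 (h1.eventually (Metric.ball_mem_nhds 0 hR.pos))
  obtain ⟨n₀, hn₀⟩ := h2
  have hax : ∀ n ≥ n₀, ((f 0).symm^[n] z).1 * ((f 0).symm^[n] z).2 = 0 := fun n hn => by
    have := plane_mem_ball.1 (hn₀ n hn)
    refine hf.mul_eq_zero_of_hamiltonian hk hR this.1 this.2 ?_
    rw [hf.hamiltonian_symm_iterate hk, hf.hamiltonian_of_mem hk hz]
  filter_upwards [eventually_ge_atTop n₀] with n hn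
  have hb := plane_mem_ball.1 (hn₀ n hn)
  have hne := hf.symm_iterate_ne_zero hR hf.zero_mem_I n hz0
  by_cases hx : ((f 0).symm^[n] z).1 = 0
  · refine ⟨((f 0).symm^[n] z).2, fun h => hne (Prod.ext hx h), hb.2, Prod.ext hx rfl⟩
  -- A nonzero point of the stable axis is driven away from the origin by backward iteration,
  -- against the bound on the backward orbit.
  exfalso
  set x := ((f 0).symm^[n] z).1 with hxd
  have hP : ∀ m : ℕ, ((f 0).symm^[n + m] z) = (x * Real.exp (m * lam), 0) := by
    intro m
    induction m with
    | zero =>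
      ext
      · simp [hxd]
      · simpa [← hxd, hx] using hax n hn
    | succ m ih =>
      set w := (f 0).symm^[n + (m + 1)] z with hw
      have hfw : f 0 w = (x * Real.exp (m * lam), 0) := by
        rw [← ih, hw, ← add_assoc, Function.iterate_succ_apply']; simp
      have hwb := plane_mem_ball.1 (hn₀ (n + (m + 1)) (by omega))
      have hw0 := hax (n + (m + 1)) (by omega)
      rw [← hw] at hwb hw0
      have hN := hf.isNormalOn hR hf.zero_mem_I w hwb.1 hwb.2
      rw [hw0, hf.q_deriv 0 hf.zero_mem_I, hfw] at hN
      simp only [Prod.mk.injEq] at hN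
      ext
      · have : w.1 = w.1 * Real.exp (-lam) * Real.exp lam := by
          rw [mul_assoc, ← Real.exp_add]; simp
        rw [this, ← hN.1, mul_assoc, ← Real.exp_add]
        simp only; congr 2; push_cast; ring
      · have := hN.2
        simpa [(Real.exp_pos _).ne'] using this.symm
  have hlim : Tendsto (fun m : ℕ => |x| * Real.exp (m * lam)) atTop atTop :=
    (Real.tendsto_exp_atTop.comp (tendsto_natCast_atTop_atTop.atTop_mul_const hf.lam_pos)
      ).const_mul_atTop (abs_pos.2 hx)
  obtain ⟨m, hm⟩ := (hlim.eventually (eventually_ge_atTop R)).exists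
  have := (plane_mem_ball.1 (hn₀ (n + m) (by omega))).1
  rw [hP m, abs_mul, abs_of_pos (Real.exp_pos _)] at this
  linarith

/-- If some backward iterate of `z` is on the unstable axis, then the same iterate of the nearby
points of the zero energy level is on the same half of this axis. -/
theorem IsSeparatrixFamily.eventually_backward_axis (hk : 1 ≤ k)
    (hf : IsSeparatrixFamily k I f S lam q V₀ H) (hR : IsGoodRadius (q 0) V₀ R) {z : Plane}
    {n : ℕ} {U : Set ℝ} (hU : IsOpen U) (hU0 : (0 : ℝ) ∉ U)
    (hz : ∃ y ∈ U, |y| < R ∧ (f 0).symm^[n] z = (0, y)) :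
    ∀ᶠ w in 𝓝 z, H w = H 0 → ∃ y ∈ U, |y| < R ∧ (f 0).symm^[n] w = (0, y) := by
  obtain ⟨y, hy, hyR, hyz⟩ := hz
  have hc : Continuous (f 0).symm^[n] :=
    (hf.symplectic 0 hf.zero_mem_I).contDiff_symm.continuous.iterate n
  have h1 : ∀ᶠ w in 𝓝 z, (f 0).symm^[n] w ∈ Metric.ball (0 : Plane) R :=
    hc.continuousAt.eventually (Metric.isOpen_ball.mem_nhds (by
      rw [hyz, plane_mem_ball]; simpa [hR.pos] using hyR))
  have h2 : ∀ᶠ w in 𝓝 z, ((f 0).symm^[n] w).2 ∈ U :=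
    (continuous_snd.comp hc).continuousAt.eventually (hU.mem_nhds (by simpa [hyz] using hy))
  filter_upwards [h1, h2] with w hw1 hw2 hHw
  rw [plane_mem_ball] at hw1
  have h3 := hf.mul_eq_zero_of_hamiltonian hk hR hw1.1 hw1.2
    (by rw [hf.hamiltonian_symm_iterate hk, hHw])
  have h4 : ((f 0).symm^[n] w).2 ≠ 0 := fun h => hU0 (h ▸ hw2)
  refine ⟨_, hw2, hw1.2, Prod.ext ?_ rfl⟩
  simpa [h4] using h3

/-- The backward orbit of a point of the separatrix is finally on the positive unstable axis. -/
theorem IsSeparatrixFamily.backward_pos_axis (hk : 1 ≤ k)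
    (hf : IsSeparatrixFamily k I f S lam q V₀ H) (hR : IsGoodRadius (q 0) V₀ R) {z : Plane}
    (hz : z ∈ S 0) (hz0 : z ≠ 0) :
    ∃ n : ℕ, ∃ y ∈ Ioi (0 : ℝ), |y| < R ∧ (f 0).symm^[n] z = (0, y) := by
  -- According to the half of the unstable axis reached by the backward orbit, `S 0 \ {0}` splits
  -- into two disjoint open sets. It is connected and the positive part is not empty.
  let P : Set ℝ → Plane → Prop := fun U z =>
    ∃ n : ℕ, ∃ y ∈ U, |y| < R ∧ (f 0).symm^[n] z = (0, y)
  have hopen : ∀ U : Set ℝ, IsOpen U → (0 : ℝ) ∉ U →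
      ∀ w : ↥(S 0 \ {0}), P U w → ∀ᶠ w' : ↥(S 0 \ {0}) in 𝓝 w, P U w' := by
    rintro U hU hU0 w ⟨n, hn⟩
    have := hf.eventually_backward_axis hk hR hU hU0 hn
    have h2 := (continuous_subtype_val.tendsto w).eventually this
    filter_upwards [h2] with w' hw'
    exact ⟨n, hw' (hf.hamiltonian_of_mem hk w'.2.1)⟩
  have hcover : ∀ w : ↥(S 0 \ {0}), P (Ioi 0) w ∨ P (Iio 0) w := by
    intro w
    obtain ⟨n, y, hy, hyR, hyw⟩ := (hf.backward_axis hk hR w.2.1 w.2.2).exists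
    rcases lt_or_gt_of_ne hy with h | h
    · exact Or.inr ⟨n, y, h, hyR, hyw⟩
    · exact Or.inl ⟨n, y, h, hyR, hyw⟩
  have hdisj : ∀ w : Plane, P (Ioi 0) w → ¬ P (Iio 0) w := by
    have key : ∀ w : Plane, ∀ n m : ℕ, ∀ y y' : ℝ, |y| < R → |y'| < R →
        (f 0).symm^[n] w = (0, y) → (f 0).symm^[m] w = (0, y') → 0 < y → 0 < y' := by
      intro w n m y y' hyR hyR' h1 h2 hy
      have e1 := hf.symm_iterate_unstable hR hf.zero_mem_I m hyR
      have e2 := hf.symm_iterate_unstable hR hf.zero_mem_I n hyR'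
      rw [← h1, ← Function.iterate_add_apply, add_comm] at e1
      rw [← h2, ← Function.iterate_add_apply, e1] at e2
      simp only [Prod.mk.injEq, true_and] at e2
      have : 0 < y' * Real.exp (-(n * lam)) := by rw [← e2]; exact mul_pos hy (Real.exp_pos _)
      exact (mul_pos_iff_of_pos_right (Real.exp_pos _)).1 this
    rintro w ⟨n, y, hy, hyR, hyw⟩ ⟨m, y', hy', hyR', hyw'⟩
    exact (lt_asymm hy') (key w n m y y' hyR hyR' hyw hyw' hy)
  have hconn : ConnectedSpace ↥(S 0 \ {0}) :=
    isConnected_iff_connectedSpace.1 (hf.separatrix 0 hf.zero_mem_I).isConnected_diff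
  have hclopen : IsClopen {w : ↥(S 0 \ {0}) | P (Ioi 0) w} := by
    constructor
    · rw [← isOpen_compl_iff, isOpen_iff_mem_nhds]
      intro w hw
      have hw' : P (Iio 0) w := (hcover w).resolve_left hw
      filter_upwards [hopen _ isOpen_Iio (by simp) w hw'] with w' h1 h2
      exact hdisj _ h2 h1
    · rw [isOpen_iff_mem_nhds]
      exact fun w hw => hopen _ isOpen_Ioi (by simp) w hw
  have hmem : ((0, R / 2) : Plane) ∈ S 0 :=
    hf.unstable_mem hR hf.zero_mem_I (by linarith [hR.pos]) (by linarith [hR.pos])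
  have hne : ((0, R / 2) : Plane) ≠ 0 := by
    intro h; have := congrArg Prod.snd h; simp at this; linarith [hR.pos]
  have huniv := hclopen.eq_univ ⟨⟨(0, R / 2), hmem, hne⟩, 0, R / 2, by
    simp only [mem_Ioi]; linarith [hR.pos], by
    rw [abs_of_pos (by linarith [hR.pos])]; linarith [hR.pos], rfl⟩
  have : (⟨z, hz, hz0⟩ : ↥(S 0 \ {0})) ∈ {w : ↥(S 0 \ {0}) | P (Ioi 0) w} := by
    rw [huniv]; trivial
  exact this

/-- Makes the infimum in `transitTime` a minimum. Each point of the closed segment has a backward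
iterate on the unstable axis near the origin, nearby points of the separatrix follow it with the
same exponent, and further backward iterates only contract. Compactness gives a common exponent. -/
theorem IsSeparatrixFamily.transit_nonempty (hk : 1 ≤ k)
    (hf : IsSeparatrixFamily k I f S lam q V₀ H) (hR : IsGoodRadius (q 0) V₀ R) {V : Set Plane}
    (hV : IsOpen V) (h0V : (0 : Plane) ∈ V) {xs : ℝ} (hxs : 0 < xs) (hxR : xs < R) :
    {n | 1 ≤ n ∧ ∀ x : ℝ, (f 0 (xs, 0)).1 < x → x ≤ xs → (f 0).symm^[n] (x, 0) ∈ V}.Nonempty := by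
  obtain ⟨ρ, hρ, hρV⟩ := Metric.isOpen_iff.1 hV 0 h0V
  have hloc : ∀ x ∈ Icc (xs * Real.exp (-lam)) xs, ∃ t ∈ 𝓝[Icc (xs * Real.exp (-lam)) xs] x,
      ∃ n₀, ∀ x' ∈ t, ∀ n ≥ n₀, (f 0).symm^[n] (x', 0) ∈ V := by
    intro x hx
    have hx0 : 0 < x := lt_of_lt_of_le (by positivity) hx.1
    have hxS := hf.stable_mem hR hf.zero_mem_I hx0 (lt_of_le_of_lt hx.2 hxR)
    have hne : ((x, 0) : Plane) ≠ 0 := by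
      intro h; have := congrArg Prod.fst h; simp at this; linarith
    have hball := ((hf.separatrix 0 hf.zero_mem_I).tendsto_backward _ hxS).eventually
      (Metric.ball_mem_nhds 0 hρ)
    obtain ⟨n, ⟨y, hy, hyR, hyz⟩, hn⟩ := ((hf.backward_axis hk hR hxS hne).and hball).exists
    rw [hyz, ← Metric.mem_ball, plane_mem_ball] at hn
    have hU : IsOpen ({y : ℝ | y ≠ 0} ∩ {y | |y| < ρ}) :=
      isOpen_ne.inter (isOpen_lt continuous_abs continuous_const)
    have hev := hf.eventually_backward_axis hk hR (z := (x, 0)) (n := n) hU (by simp)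
      ⟨y, ⟨hy, hn.2⟩, hyR, hyz⟩
    have hcont : Continuous (fun x : ℝ => ((x, 0) : Plane)) := by fun_prop
    have hev2 := (hcont.tendsto x).eventually hev
    have hlt : ∀ᶠ x' in 𝓝 x, x' ∈ Ioo 0 R :=
      isOpen_Ioo.mem_nhds ⟨hx0, lt_of_le_of_lt hx.2 hxR⟩
    refine ⟨_, mem_nhdsWithin_of_mem_nhds (hev2.and hlt), n, ?_⟩
    rintro x' ⟨h1, h2⟩ m hm
    obtain ⟨y', hy', hyR', hyz'⟩ := h1 (hf.hamiltonian_of_mem hk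
      (hf.stable_mem hR hf.zero_mem_I h2.1 h2.2))
    obtain ⟨j, rfl⟩ := Nat.exists_eq_add_of_le hm
    rw [add_comm, Function.iterate_add_apply, hyz', hf.symm_iterate_unstable hR hf.zero_mem_I j hyR']
    apply hρV
    rw [plane_mem_ball]
    refine ⟨by simpa using hρ, ?_⟩
    simp only
    rw [abs_mul, abs_of_pos (Real.exp_pos _)]
    refine lt_of_le_of_lt (mul_le_of_le_one_right (abs_nonneg _) ?_) hy'.2
    apply Real.exp_le_one_iff.2
    have : 0 ≤ j * lam := mul_nonneg (Nat.cast_nonneg _) hf.lam_pos.le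
    linarith
  have hcomp : ∃ n₀, ∀ x' ∈ Icc (xs * Real.exp (-lam)) xs, ∀ n ≥ n₀,
      (f 0).symm^[n] (x', 0) ∈ V := by
    refine isCompact_Icc.induction_on (p := fun t => ∃ n₀, ∀ x' ∈ t, ∀ n ≥ n₀,
      (f 0).symm^[n] (x', 0) ∈ V) ⟨0, by simp⟩ ?_ ?_ hloc
    · rintro s t hst ⟨n, hn⟩
      exact ⟨n, fun x hx => hn x (hst hx)⟩
    · rintro s t ⟨n, hn⟩ ⟨m, hm⟩
      refine ⟨max n m, fun x hx j hj => ?_⟩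
      rcases hx with hx | hx
      · exact hn x hx j ((le_max_left _ _).trans hj)
      · exact hm x hx j ((le_max_right _ _).trans hj)
  obtain ⟨n₀, hn₀⟩ := hcomp
  refine ⟨n₀ + 1, by omega, fun x h1 h2 => hn₀ x ⟨?_, h2⟩ _ (by omega)⟩
  have := hf.iterate_stable hR hf.zero_mem_I (x := xs) (by rwa [abs_of_pos hxs]) 1
  simp only [Function.iterate_one, Nat.cast_one, one_mul] at this
  rw [this] at h1
  exact h1.le

/-- The `N`-th preimage of `(x_*, 0)` is on the positive unstable axis. -/
theorem IsSeparatrixFamily.exists_unstable_base (hk : 1 ≤ k)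
    (hf : IsSeparatrixFamily k I f S lam q V₀ H) (hR : IsGoodRadius (q 0) V₀ R) {V : Set Plane}
    {r : ℝ} (hrR : r ≤ R)
    (hV : IsOpen V) (h0V : (0 : Plane) ∈ V) (hstar : StarConvex ℝ 0 V)
    (hVr : V ⊆ Metric.ball 0 r) {xs : ℝ} (hxs : 0 < xs) (hxV : ((xs, 0) : Plane) ∈ V)
    (hesc : (f 0).symm (xs, 0) ∉ V) (hlr : r * Real.exp lam ≤ R) :
    1 ≤ transitTime (f 0) V xs ∧ ∃ y, 0 < y ∧ y < r ∧
      (f 0)^[transitTime (f 0) V xs] (0, y) = (xs, 0) := by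
  have hxr : xs < r := by
    have := (plane_mem_ball.1 (hVr hxV)).1; rwa [abs_of_pos hxs] at this
  have hxR : xs < R := lt_of_lt_of_le hxr hrR
  have hN := Nat.sInf_mem (hf.transit_nonempty hk hR hV h0V hxs hxR)
  change 1 ≤ transitTime (f 0) V xs ∧ _ at hN
  set N := transitTime (f 0) V xs with hNd
  refine ⟨hN.1, ?_⟩
  have h1 := hf.iterate_stable hR hf.zero_mem_I (x := xs) (by rwa [abs_of_pos hxs]) 1
  simp only [Function.iterate_one, Nat.cast_one, one_mul] at h1
  have hwV : (f 0).symm^[N] (xs, 0) ∈ V := hN.2 xs (by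
    rw [h1]; simp only
    have : Real.exp (-lam) < 1 := by
      rw [Real.exp_lt_one_iff]; linarith [hf.lam_pos]
    nlinarith) le_rfl
  set w := (f 0).symm^[N] (xs, 0) with hw
  have hfw : (f 0)^[N] w = (xs, 0) := iterate_symm_iterate _ N _
  have hwr := plane_mem_ball.1 (hVr hwV)
  have hxS := hf.stable_mem hR hf.zero_mem_I hxs hxR
  have hne : ((xs, 0) : Plane) ≠ 0 := by
    intro h; have := congrArg Prod.fst h; simp at this; linarith
  have hw0 : w.1 * w.2 = 0 := hf.mul_eq_zero_of_hamiltonian hk hR (hwr.1.trans_le hrR)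
    (hwr.2.trans_le hrR) (by
      rw [hw, hf.hamiltonian_symm_iterate hk, hf.hamiltonian_of_mem hk hxS])
  -- If `w` were on the stable axis, it would be `(x_* e^{Nλ}, 0) ∈ V`. As `N ≥ 1`, the point
  -- `f₀⁻¹(x_*, 0) = (x_* e^λ, 0)` would be on the segment from the origin to `w`, hence in the
  -- star-shaped `V`.
  have hw2 : w.2 ≠ 0 := by
    intro h2
    have hwe : w = (w.1, 0) := Prod.ext rfl h2
    rw [hwe, hf.iterate_stable hR hf.zero_mem_I (hwr.1.trans_le hrR)] at hfw
    have hx1 : w.1 = xs * Real.exp (N * lam) := by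
      have := congrArg Prod.fst hfw
      simp only at this
      rw [← this, mul_assoc, ← Real.exp_add]; simp
    apply hesc
    have h3 : (f 0).symm (xs, 0) = (xs * Real.exp lam, 0) := by
      rw [Equiv.symm_apply_eq]
      have := hf.iterate_stable hR hf.zero_mem_I (x := xs * Real.exp lam) (by
        rw [abs_of_pos (by positivity)]
        refine lt_of_lt_of_le ?_ hlr
        exact mul_lt_mul_of_pos_right hxr (Real.exp_pos _)) 1
      simp only [Function.iterate_one, Nat.cast_one, one_mul] at this
      rw [this, mul_assoc, ← Real.exp_add]; simp
    rw [h3]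
    have h4 : ((xs * Real.exp lam, 0) : Plane) = Real.exp (lam - N * lam) • w := by
      rw [hwe, hx1]
      ext
      · simp only [Prod.smul_mk, smul_eq_mul]
        rw [mul_left_comm, ← Real.exp_add]; congr 2; ring
      · simp
    rw [h4]
    refine hstar.smul_mem hwV (Real.exp_pos _).le ?_
    rw [Real.exp_le_one_iff]
    have : (1 : ℝ) ≤ N := by exact_mod_cast hN.1
    nlinarith [hf.lam_pos]
  have hw1 : w.1 = 0 := by simpa [hw2] using hw0
  have hwe : w = (0, w.2) := Prod.ext hw1 rfl
  -- `(0, y)` and `w` have a common backward iterate, so they are on the same half of the axis.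
  obtain ⟨n, y, hy, hyR, hyw⟩ := hf.backward_pos_axis hk hR hxS hne
  have e1 := hf.symm_iterate_unstable hR hf.zero_mem_I N hyR
  have e2 := hf.symm_iterate_unstable hR hf.zero_mem_I n (hwr.2.trans_le hrR)
  rw [← hyw, ← Function.iterate_add_apply, add_comm] at e1
  rw [← hwe, hw, ← Function.iterate_add_apply, e1, ← hw] at e2
  simp only [Prod.mk.injEq, true_and] at e2
  have hpos : 0 < w.2 := by
    have : 0 < w.2 * Real.exp (-(n * lam)) := by
      rw [← e2]; exact mul_pos hy (Real.exp_pos _)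
    exact (mul_pos_iff_of_pos_right (Real.exp_pos _)).1 this
  refine ⟨w.2, hpos, ?_, ?_⟩
  · have := hwr.2; rwa [abs_of_pos hpos] at this
  · rw [← hwe]; exact hfw

end Unperturbed

/-! ### Logarithmic coordinates and the transition map -/

section Coordinates

theorem hasDerivAt_fst_of {γ : ℝ → Plane} {d : Plane} {t : ℝ} (h : HasDerivAt γ d t) :
    HasDerivAt (fun t => (γ t).1) d.1 t :=
  (hasFDerivAt_fst (𝕜 := ℝ) (p := γ t)).comp_hasDerivAt t h

/-- The inverse `(u, v) ↦ (v e^u, e^{-u})` of the coordinates `Ξ₂`. -/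
noncomputable def theta (w : Plane) : Plane := (w.2 * Real.exp w.1, Real.exp (-w.1))

/-- The inverse `(u, v) ↦ (e^u, v e^{-u})` of the coordinates `Ξ₁`. -/
noncomputable def chi (w : Plane) : Plane := (Real.exp w.1, w.2 * Real.exp (-w.1))

/-- The map `Ξ₁ ∘ g^N ∘ Ξ₂⁻¹`. -/
noncomputable def trans (g : Plane → Plane) (N : ℕ) (w : Plane) : Plane := xi1 (g^[N] (theta w))

theorem theta_mul (w : Plane) : (theta w).1 * (theta w).2 = w.2 := by
  simp [theta, mul_assoc, ← Real.exp_add]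

theorem chi_mul (w : Plane) : (chi w).1 * (chi w).2 = w.2 := by
  simp only [chi]; rw [mul_left_comm, ← Real.exp_add]; simp

theorem xi2_theta (w : Plane) : xi2 (theta w) = w := by
  ext
  · simp [xi2, theta]
  · exact theta_mul w

theorem xi1_chi (w : Plane) : xi1 (chi w) = w := by
  ext
  · simp [xi1, chi]
  · exact chi_mul w

theorem chi_xi1 {z : Plane} (hz : 0 < z.1) : chi (xi1 z) = z := by
  ext
  · simp [xi1, chi, Real.exp_log hz]
  · simp only [xi1, chi, Real.exp_neg, Real.exp_log hz]; field_simp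

theorem contDiff_theta {n : WithTop ℕ∞} : ContDiff ℝ n theta := by
  unfold theta; fun_prop

theorem contDiffAt_xi1 {n : WithTop ℕ∞} {z : Plane} (hz : z.1 ≠ 0) : ContDiffAt ℝ n xi1 z := by
  unfold xi1
  exact (contDiffAt_fst.log hz).prodMk (contDiffAt_fst.mul contDiffAt_snd)

theorem det_plane (A : Plane →L[ℝ] Plane) :
    A.det = (A (1, 0)).1 * (A (0, 1)).2 - (A (0, 1)).1 * (A (1, 0)).2 := by
  have : LinearMap.toMatrix (Module.Basis.finTwoProd ℝ) (Module.Basis.finTwoProd ℝ)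
      (A : Plane →ₗ[ℝ] Plane) =
      !![(A (1, 0)).1, (A (0, 1)).1; (A (1, 0)).2, (A (0, 1)).2] := by
    ext i j
    fin_cases i <;> fin_cases j <;> simp [LinearMap.toMatrix_apply]
  rw [ContinuousLinearMap.det, ← LinearMap.det_toMatrix (Module.Basis.finTwoProd ℝ), this,
    Matrix.det_fin_two_of]

theorem det_comp_plane (A B : Plane →L[ℝ] Plane) : (A.comp B).det = A.det * B.det := by
  simp [ContinuousLinearMap.det]

theorem hasFDerivAt_theta (w : Plane) : HasFDerivAt theta
    (((w.2 * Real.exp w.1) • ContinuousLinearMap.fst ℝ ℝ ℝ +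
      Real.exp w.1 • ContinuousLinearMap.snd ℝ ℝ ℝ).prod
      (-(Real.exp (-w.1)) • ContinuousLinearMap.fst ℝ ℝ ℝ)) w := by
  have h1 : HasFDerivAt (fun w : Plane => w.1) (ContinuousLinearMap.fst ℝ ℝ ℝ) w := hasFDerivAt_fst
  have h2 : HasFDerivAt (fun w : Plane => w.2) (ContinuousLinearMap.snd ℝ ℝ ℝ) w := hasFDerivAt_snd
  refine HasFDerivAt.prodMk ?_ ?_
  · convert! h2.mul h1.exp using 1
    ext <;> simp
  · convert! h1.neg.exp using 1
    ext <;> simp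

theorem det_fderiv_theta (w : Plane) : (fderiv ℝ theta w).det = 1 := by
  rw [(hasFDerivAt_theta w).fderiv, det_plane]
  simp [← Real.exp_add]

theorem hasFDerivAt_xi1 {z : Plane} (hz : z.1 ≠ 0) : HasFDerivAt xi1
    ((z.1⁻¹ • ContinuousLinearMap.fst ℝ ℝ ℝ).prod
      (z.1 • ContinuousLinearMap.snd ℝ ℝ ℝ + z.2 • ContinuousLinearMap.fst ℝ ℝ ℝ)) z := by
  have h1 : HasFDerivAt (fun w : Plane => w.1) (ContinuousLinearMap.fst ℝ ℝ ℝ) z := hasFDerivAt_fst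
  have h2 : HasFDerivAt (fun w : Plane => w.2) (ContinuousLinearMap.snd ℝ ℝ ℝ) z := hasFDerivAt_snd
  exact (h1.log hz).prodMk (h1.mul h2)

theorem det_fderiv_xi1 {z : Plane} (hz : z.1 ≠ 0) : (fderiv ℝ xi1 z).det = 1 := by
  rw [(hasFDerivAt_xi1 hz).fderiv, det_plane]
  simp [hz]

theorem det_fderiv_iterate {g : Plane → Plane} (hg : Differentiable ℝ g)
    (hdet : ∀ z, (fderiv ℝ g z).det = 1) (n : ℕ) (z : Plane) : (fderiv ℝ g^[n] z).det = 1 := by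
  induction n generalizing z with
  | zero => simp [det_plane]
  | succ n ih =>
    rw [Function.iterate_succ, fderiv_comp z (hg.iterate n _) (hg z), det_comp_plane, ih, hdet,
      one_mul]

/-- Both changes of coordinates have Jacobian `1`. -/
theorem det_fderiv_trans {g : Plane → Plane} (hg : Differentiable ℝ g)
    (hdet : ∀ z, (fderiv ℝ g z).det = 1) {N : ℕ} {w : Plane} (hw : 0 < (g^[N] (theta w)).1) :
    DifferentiableAt ℝ (trans g N) w ∧ (fderiv ℝ (trans g N) w).det = 1 := by
  have h1 : DifferentiableAt ℝ theta w := (hasFDerivAt_theta w).differentiableAt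
  have h2 : DifferentiableAt ℝ g^[N] (theta w) := hg.iterate N _
  have h3 : DifferentiableAt ℝ xi1 (g^[N] (theta w)) := (hasFDerivAt_xi1 hw.ne').differentiableAt
  have e : trans g N = xi1 ∘ (g^[N] ∘ theta) := rfl
  rw [e]
  refine ⟨h3.comp w (h2.comp w h1), ?_⟩
  rw [fderiv_comp w (by exact h3) (h2.comp w h1), det_comp_plane, fderiv_comp w h2 h1,
    det_comp_plane, det_fderiv_theta, det_fderiv_iterate hg hdet]
  simp only [Function.comp_apply]
  rw [det_fderiv_xi1 hw.ne']; norm_num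

/-- If the area preserving map `Ξ₁ ∘ g^N ∘ Ξ₂⁻¹` preserves the second coordinate, then it is a
translation on each horizontal line. -/
theorem hasDerivAt_trans_fst {g : Plane → Plane} (hg : Differentiable ℝ g)
    (hdet : ∀ z, (fderiv ℝ g z).det = 1) {N : ℕ} {w : Plane} (hw : 0 < (g^[N] (theta w)).1)
    (hloc : ∀ᶠ w' in 𝓝 w, (trans g N w').2 = w'.2) :
    HasDerivAt (fun u => (trans g N (u, w.2)).1) 1 w.1 := by
  obtain ⟨h1, h2⟩ := det_fderiv_trans hg hdet hw
  set L := fderiv ℝ (trans g N) w with hL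
  have hsnd : HasFDerivAt (fun w' => (trans g N w').2) (ContinuousLinearMap.snd ℝ ℝ ℝ) w :=
    hasFDerivAt_snd.congr_of_eventuallyEq hloc
  have hsnd' : HasFDerivAt (fun w' => (trans g N w').2)
      ((ContinuousLinearMap.snd ℝ ℝ ℝ).comp L) w := h1.hasFDerivAt.snd
  have e := hsnd'.unique hsnd
  have e1 : (L (1, 0)).2 = 0 := by simpa using DFunLike.congr_fun e ((1, 0) : Plane)
  have e2 : (L (0, 1)).2 = 1 := by simpa using DFunLike.congr_fun e ((0, 1) : Plane)
  -- The second row of the Jacobian matrix is `(0, 1)` and its determinant is `1`.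
  have e3 : (L (1, 0)).1 = 1 := by
    rw [det_plane, e1, e2] at h2; simpa using h2
  have hline : HasDerivAt (fun u : ℝ => ((u, w.2) : Plane)) (1, 0) w.1 :=
    (hasDerivAt_id w.1).prodMk (hasDerivAt_const _ _)
  have h3 : HasFDerivAt (trans g N) L (w.1, w.2) := h1.hasFDerivAt
  have h4 := HasFDerivAt.comp_hasDerivAt (l := trans g N) (f := fun u : ℝ => ((u, w.2) : Plane)) w.1
    h3 hline
  rw [← e3]
  exact hasDerivAt_fst_of h4

/-- The point with coordinates `w` and its image under `g^N` are in the box of size `R`, and the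
image is on the right of the vertical axis. -/
def InWindow (g : Plane → Plane) (N : ℕ) (R : ℝ) (w : Plane) : Prop :=
  (|(theta w).1| < R ∧ |(theta w).2| < R) ∧
    (|(g^[N] (theta w)).1| < R ∧ |(g^[N] (theta w)).2| < R) ∧ 0 < (g^[N] (theta w)).1

/-- `g` commutes with `g^N` and acts in both coordinate systems as the translation by minus the
frequency. The frequency is taken at the initial value of `v` on one side and at its final value on
the other. -/
theorem trans_sub {g : Plane → Plane} {q : ℝ → ℝ} {R : ℝ} (hg : IsNormalOn g q R) {N : ℕ}
    {w : Plane} (hw : InWindow g N R w) :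
    trans g N (w.1 - deriv q w.2, w.2) =
      ((trans g N w).1 - deriv q (trans g N w).2, (trans g N w).2) := by
  obtain ⟨⟨h1, h2⟩, ⟨h3, h4⟩, h5⟩ := hw
  have e1 : theta (w.1 - deriv q w.2, w.2) = g (theta w) := by
    rw [hg _ h1 h2, theta_mul]
    ext
    · simp [theta, mul_assoc, ← Real.exp_add, sub_eq_add_neg]
    · simp [theta, ← Real.exp_add, sub_eq_add_neg, add_comm]
  have e2 : g^[N] (g (theta w)) = g (g^[N] (theta w)) := by
    rw [← Function.iterate_succ_apply, Function.iterate_succ_apply']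
  have e3 : (trans g N w).2 = (g^[N] (theta w)).1 * (g^[N] (theta w)).2 := rfl
  unfold trans at *
  rw [e1, e2, hg _ h3 h4]
  set z := g^[N] (theta w)
  rw [e3]
  ext
  · simp [xi1, Real.log_mul h5.ne' (Real.exp_pos _).ne', sub_eq_add_neg]
  · simp only [xi1]; rw [mul_mul_mul_comm, ← Real.exp_add]; simp

end Coordinates

/-! ### Extension of a germ by a cutoff -/

section Extension

/-- The dynamics defines `σ` only near `0`; the cutoff makes it an element of `C^k(ℝ)`. -/
theorem exists_contDiff_eq {k : ℕ} {g : ℝ → ℝ} {ρ : ℝ} (hρ : 0 < ρ)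
    (hg : ∀ v, |v| < ρ → ContDiffAt ℝ k g v) :
    ∃ s : ℝ → ℝ, ContDiff ℝ k s ∧ ∀ v, |v| ≤ ρ / 2 → s v = g v := by
  let χ : ContDiffBump (0 : ℝ) := ⟨ρ / 2, 3 * ρ / 4, by positivity, by linarith⟩
  refine ⟨fun v => χ v * g v, ?_, fun v hv => ?_⟩
  · rw [contDiff_iff_contDiffAt]
    intro v
    by_cases hv : |v| < ρ
    · exact χ.contDiffAt.mul (hg v hv)
    · have : (fun v => χ v * g v) =ᶠ[𝓝 v] fun _ => 0 := by
        have ho : IsOpen {v : ℝ | 3 * ρ / 4 < |v|} := isOpen_lt continuous_const continuous_abs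
        filter_upwards [ho.mem_nhds (show 3 * ρ / 4 < |v| by linarith [not_lt.1 hv])] with x hx
        rw [χ.zero_of_le_dist, zero_mul]
        rw [Real.dist_eq, sub_zero]; exact le_of_lt hx
      exact contDiffAt_const.congr_of_eventuallyEq this
  · have : χ v = 1 := χ.one_of_mem_closedBall (by simpa [χ] using hv)
    simp [this]

end Extension

/-! ### Dependence of the transition map on `ε`, and the window around the separatrix -/

section Family

variable {k : ℕ} {I : Set ℝ} {f : ℝ → Equiv.Perm Plane} {S : ℝ → Set Plane}
    {lam : ℝ} {q : ℝ → ℝ → ℝ} {V₀ : Set Plane} {H : Plane → ℝ} {R : ℝ}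

theorem IsSeparatrixFamily.I_mem_nhds (hf : IsSeparatrixFamily k I f S lam q V₀ H) :
    I ∈ 𝓝 (0 : ℝ) := hf.isOpen_I.mem_nhds hf.zero_mem_I

/-- Write `f_ε = f₀ + (f_ε - f₀)`: the norm is a supremum over the whole plane, so the derivatives
of the second term tend to `0` jointly in `ε` and the point. -/
theorem IsSeparatrixFamily.family_map (hf : IsSeparatrixFamily k I f S lam q V₀ H) (z : Plane) :
    FamilyCk k (fun ε => (f ε : Plane → Plane)) z := by
  have hI : ∀ᶠ p : ℝ × Plane in 𝓝 (0, z), p.1 ∈ I :=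
    (continuous_fst.tendsto ((0 : ℝ), z)).eventually hf.I_mem_nhds
  have h0 : ContDiff ℝ k (f 0) := (hf.symplectic 0 hf.zero_mem_I).contDiff
  refine ⟨hI.mono fun p hp => (hf.symplectic _ hp).contDiff.contDiffAt, fun i hi => ?_⟩
  have hA : ContinuousAt (fun p : ℝ × Plane => iteratedFDeriv ℝ i (f 0) p.2) (0, z) :=
    ((h0.continuous_iteratedFDeriv (by exact_mod_cast hi)).comp continuous_snd).continuousAt
  have hc := hf.continuous 0 hf.zero_mem_I
  rw [nhdsWithin_eq_nhds.2 hf.I_mem_nhds] at hc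
  have hB : Tendsto (fun p : ℝ × Plane => iteratedFDeriv ℝ i (fun z => f p.1 z - f 0 z) p.2)
      (𝓝 (0, z)) (𝓝 0) := by
    rw [tendsto_zero_iff_enorm_tendsto_zero]
    refine tendsto_of_tendsto_of_tendsto_of_le_of_le tendsto_const_nhds
      (hc.comp (continuous_fst.tendsto ((0 : ℝ), z))) (fun _ => zero_le) fun p => ?_
    simp only [Function.comp_apply, ckNorm]
    exact le_iSup₂_of_le i (Finset.mem_range.2 (by omega)) (le_iSup₂_of_le p.2 (mem_univ _) le_rfl)
  have hsum := hA.tendsto.add hB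
  rw [add_zero] at hsum
  refine hsum.congr' ?_
  filter_upwards [hI] with p hp
  have hd : ContDiffAt ℝ i (fun z => f p.1 z - f 0 z) p.2 :=
    ((hf.symplectic _ hp).contDiff.sub h0).contDiffAt.of_le (by exact_mod_cast hi)
  have := iteratedFDeriv_add_apply (i := i) (h0.contDiffAt.of_le (by exact_mod_cast hi)) hd
  rw [← this]
  congr 1
  ext z <;> simp

/-- Continuity of `ε ↦ q_ε` is not assumed. It is recovered from `f_ε`, which sends `(R/2, 2v/R)` to
a point of abscissa `(R/2) e^{-q_ε'(v)}`. -/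
theorem IsSeparatrixFamily.family_deriv (hf : IsSeparatrixFamily k I f S lam q V₀ H)
    (hR : IsGoodRadius (q 0) V₀ R) {v : ℝ} (hv : |v| < R ^ 2 / 2) :
    FamilyCk k (fun ε => deriv (q ε)) v := by
  have hRp := hR.pos
  have key : ∀ ε ∈ I, ∀ v : ℝ, |v| < R ^ 2 / 2 →
      ((f ε) (R / 2, v * (2 / R))).1 = R / 2 * Real.exp (-deriv (q ε) v) := by
    intro ε hε v hv
    have h1 : |R / 2| < R := by rw [abs_of_pos (by positivity)]; linarith
    have h2 : |v * (2 / R)| < R := by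
      rw [abs_mul, abs_of_pos (by positivity : 0 < 2 / R), ← lt_div_iff₀ (by positivity)]
      calc |v| < R ^ 2 / 2 := hv
        _ = R / (2 / R) := by field_simp
    rw [hf.isNormalOn hR hε (R / 2, v * (2 / R)) h1 h2]
    have : R / 2 * (v * (2 / R)) = v := by field_simp
    simp only [this]
  have h1 : FamilyCk k (fun (ε : ℝ) (v : ℝ) => ((f ε) (R / 2, v * (2 / R))).1) v :=
    (FamilyCk.comp (φ := fun ε => (f ε : Plane → Plane)) (hf.family_map _)
      (FamilyCk.const_of_contDiff (g₀ := fun v : ℝ => ((R / 2, v * (2 / R)) : Plane))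
        (by fun_prop))).fst
  have h2 : FamilyCk k (fun (_ : ℝ) (_ : ℝ) => R / 2) v :=
    FamilyCk.const_of_contDiff contDiff_const
  have h3 := ((h1.div h2 (by positivity)).log (by
    rw [key 0 hf.zero_mem_I v hv]; positivity)).neg
  refine h3.congr ?_
  have hI : ∀ᶠ p : ℝ × ℝ in 𝓝 (0, v), p.1 ∈ I :=
    (continuous_fst.tendsto ((0 : ℝ), v)).eventually hf.I_mem_nhds
  have hV : ∀ᶠ p : ℝ × ℝ in 𝓝 (0, v), |p.2| < R ^ 2 / 2 :=
    (continuous_snd.tendsto ((0 : ℝ), v)).eventually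
      ((isOpen_lt continuous_abs continuous_const).mem_nhds hv)
  filter_upwards [hI, hV] with p hp hp'
  rw [key _ hp _ hp', mul_div_cancel_left₀ _ (by positivity), Real.log_exp, neg_neg]

theorem IsSeparatrixFamily.family_iterate_theta (hf : IsSeparatrixFamily k I f S lam q V₀ H)
    (N : ℕ) (w : Plane) : FamilyCk k (fun ε w => (f ε)^[N] (theta w)) w :=
  FamilyCk.comp (φ := fun ε => (f ε)^[N]) (FamilyCk.iterate hf.family_map N _)
    (FamilyCk.const_of_contDiff contDiff_theta)

theorem IsSeparatrixFamily.family_trans (hf : IsSeparatrixFamily k I f S lam q V₀ H)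
    {N : ℕ} {w : Plane} (hw : 0 < ((f 0)^[N] (theta w)).1) :
    FamilyCk k (fun ε => trans (f ε) N) w := by
  refine FamilyCk.comp_const (φ := xi1) ?_ (hf.family_iterate_theta N w)
  filter_upwards [continuous_fst.continuousAt.eventually (lt_mem_nhds hw)] with y hy
  exact contDiffAt_xi1 hy.ne'

theorem IsSeparatrixFamily.inWindow_eventually (hf : IsSeparatrixFamily k I f S lam q V₀ H)
    {N : ℕ} {w : Plane} (hw : InWindow (f 0) N R w) :
    ∀ᶠ p : ℝ × Plane in 𝓝 (0, w), InWindow (f p.1) N R p.2 := by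
  have h1 : ContinuousAt (fun p : ℝ × Plane => theta p.2) (0, w) :=
    ((contDiff_theta (n := 0)).continuous.comp continuous_snd).continuousAt
  have h2 := (hf.family_iterate_theta N w).continuousAt_zero
  obtain ⟨⟨a1, a2⟩, ⟨a3, a4⟩, a5⟩ := hw
  have ho : ∀ {g : ℝ × Plane → Plane}, ContinuousAt g (0, w) → |(g (0, w)).1| < R →
      |(g (0, w)).2| < R → ∀ᶠ p in 𝓝 (0, w), |(g p).1| < R ∧ |(g p).2| < R := by
    intro g hg b1 b2
    filter_upwards [hg.eventually (Metric.isOpen_ball.mem_nhds (plane_mem_ball.2 ⟨b1, b2⟩))]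
      with p hp
    exact plane_mem_ball.1 hp
  filter_upwards [ho h1 a1 a2, ho h2 a3 a4, h2.fst.eventually (lt_mem_nhds a5)] with p b1 b2 b3
  exact ⟨b1, b2, b3⟩

/-- The energy is conserved and determines `xy` in the box. -/
theorem IsSeparatrixFamily.trans_zero_snd (hk : 1 ≤ k)
    (hf : IsSeparatrixFamily k I f S lam q V₀ H)
    (hR : IsGoodRadius (q 0) V₀ R) {N : ℕ} {w : Plane} (hw : InWindow (f 0) N R w) :
    (trans (f 0) N w).2 = w.2 := by
  rw [← theta_mul w]
  exact hf.mul_eq_of_iterate hk hR hw.1.1 hw.1.2 hw.2.1.1 hw.2.1.2 (hf.hamiltonian_iterate hk _ _)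

theorem IsSeparatrixFamily.hasDerivAt_trans_zero_fst (hk : 1 ≤ k)
    (hf : IsSeparatrixFamily k I f S lam q V₀ H)
    (hR : IsGoodRadius (q 0) V₀ R) {N : ℕ} {w : Plane} (hw : InWindow (f 0) N R w) :
    HasDerivAt (fun u => (trans (f 0) N (u, w.2)).1) 1 w.1 := by
  have hs := hf.symplectic 0 hf.zero_mem_I
  refine hasDerivAt_trans_fst (hs.contDiff.differentiable (by exact_mod_cast (by omega : k ≠ 0)))
    hs.det_eq_one hw.2.2 ?_
  have h1 : Tendsto (fun w' : Plane => ((0 : ℝ), w')) (𝓝 w) (𝓝 (0, w)) :=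
    (Continuous.prodMk_right (0 : ℝ)).tendsto w
  filter_upwards [h1.eventually (hf.inWindow_eventually hw)] with w' hw'
  exact hf.trans_zero_snd hk hR hw'

/-- The transition map of `f 0` along the separatrix. -/
theorem IsSeparatrixFamily.iterate_zero_axis (hk : 1 ≤ k)
    (hf : IsSeparatrixFamily k I f S lam q V₀ H)
    (hR : IsGoodRadius (q 0) V₀ R) {N : ℕ} {xs ub A : ℝ} (hA : 0 ≤ A) (hxs : 0 < xs)
    (hxA : xs * Real.exp A < R) (huA : Real.exp (-ub) * Real.exp A < R)
    (hbase : (f 0)^[N] (theta (ub, 0)) = (xs, 0)) {u : ℝ} (hu : u ∈ Icc (ub - A) (ub + A)) :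
    (f 0)^[N] (theta (u, 0)) = (xs * Real.exp (u - ub), 0) := by
  have hcont : Continuous (fun u : ℝ => (f 0)^[N] (theta (u, 0))) :=
    ((hf.symplectic 0 hf.zero_mem_I).contDiff.continuous.iterate N).comp
      ((contDiff_theta (n := 0)).continuous.comp (by fun_prop))
  -- The derivative is known to be `1` only where the window conditions hold, and these follow from
  -- the formula being proved; hence a connectedness argument instead of a direct integration.
  let T : Set (Icc (ub - A) (ub + A)) :=
    {u | (f 0)^[N] (theta (u, 0)) = (xs * Real.exp (u - ub), 0)}
  have hclosed : IsClosed T := by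
    refine isClosed_eq (hcont.comp continuous_subtype_val) ?_
    fun_prop
  have hopen : IsOpen T := by
    rw [isOpen_iff_mem_nhds]
    rintro ⟨u, hu⟩ hT
    change (f 0)^[N] (theta (u, 0)) = (xs * Real.exp (u - ub), 0) at hT
    have hw : InWindow (f 0) N R (u, 0) := by
      refine ⟨⟨by simpa [theta] using hR.pos, ?_⟩, ⟨?_, ?_⟩, ?_⟩
      · simp only [theta, abs_of_pos (Real.exp_pos _)]
        refine lt_of_le_of_lt ?_ huA
        rw [← Real.exp_add, Real.exp_le_exp]; linarith [hu.1]
      · rw [hT]; simp only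
        rw [abs_of_pos (by positivity)]
        refine lt_of_le_of_lt (mul_le_mul_of_nonneg_left ?_ hxs.le) hxA
        rw [Real.exp_le_exp]; linarith [hu.2]
      · rw [hT]; simpa using hR.pos
      · rw [hT]; simp only; positivity
    have hT1 : Tendsto (fun u : ℝ => ((0 : ℝ), ((u, 0) : Plane))) (𝓝 u) (𝓝 (0, (u, 0))) :=
      Continuous.tendsto (by fun_prop) u
    obtain ⟨ρ, hρ, hball⟩ := Metric.eventually_nhds_iff_ball.1
      (hT1.eventually (hf.inWindow_eventually hw))
    have hder : ∀ u' ∈ Metric.ball u ρ,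
        HasDerivAt (fun u => (trans (f 0) N (u, 0)).1 - u) 0 u' := fun u' hu' => by
      have := (hf.hasDerivAt_trans_zero_fst hk hR (hball u' hu')).fun_sub (hasDerivAt_id' u')
      simpa using this
    have hev : ∀ᶠ u' in 𝓝 u, (f 0)^[N] (theta (u', 0)) = (xs * Real.exp (u' - ub), 0) := by
      filter_upwards [Metric.ball_mem_nhds u hρ] with u' hu'
      have hc := Metric.isOpen_ball.is_const_of_deriv_eq_zero
        (convex_ball u ρ).isPreconnected
        (fun x hx => (hder x hx).differentiableAt.differentiableWithinAt)
        (fun x hx => (hder x hx).deriv) hu' (Metric.mem_ball_self hρ)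
      have hsnd := hf.trans_zero_snd hk hR (hball u' hu')
      have hpos := (hball u' hu').2.2
      simp only at hpos
      rw [← chi_xi1 hpos]
      change chi (trans (f 0) N (u', 0)) = _
      have e1 : (trans (f 0) N (u, 0)).1 = Real.log xs + (u - ub) := by
        simp [trans, xi1, hT, Real.log_mul hxs.ne' (Real.exp_pos _).ne']
      have e2 : trans (f 0) N (u', 0) = (Real.log xs + (u' - ub), 0) := by
        ext
        · simp only; linarith
        · simpa using hsnd
      rw [e2]
      simp [chi, Real.exp_add, Real.exp_log hxs]
    exact (continuous_subtype_val.tendsto (⟨u, hu⟩ : Icc (ub - A) (ub + A))).eventually hev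
  have hne : (Icc (ub - A) (ub + A)).Nonempty := ⟨u, hu⟩
  have : ConnectedSpace (Icc (ub - A) (ub + A)) :=
    isConnected_iff_connectedSpace.1 (isConnected_Icc (by linarith))
  have huniv := IsClopen.eq_univ (s := T) ⟨hclosed, hopen⟩
    ⟨⟨ub, by constructor <;> linarith⟩, by simpa [T] using hbase⟩
  have : (⟨u, hu⟩ : Icc (ub - A) (ub + A)) ∈ T := by rw [huniv]; trivial
  exact this

/-- The window conditions are open and hold for `ε = 0` along a compact segment of the unstable
axis. -/
theorem IsSeparatrixFamily.exists_window (hk : 1 ≤ k)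
    (hf : IsSeparatrixFamily k I f S lam q V₀ H)
    (hR : IsGoodRadius (q 0) V₀ R) {N : ℕ} {xs ub A : ℝ} (hA : 0 ≤ A) (hxs : 0 < xs)
    (hxA : xs * Real.exp A < R) (huA : Real.exp (-ub) * Real.exp A < R)
    (hbase : (f 0)^[N] (theta (ub, 0)) = (xs, 0)) :
    ∃ ρ > 0, ∀ ε v, |ε| < ρ → |v| < ρ → ε ∈ I ∧ ∀ u ∈ Icc (ub - A) (ub + A),
      InWindow (f ε) N R (u, v) := by
  have hev : ∀ u ∈ Icc (ub - A) (ub + A), ∀ᶠ p : (ℝ × ℝ) × ℝ in 𝓝 ((0, 0), u),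
      InWindow (f p.1.1) N R (p.2, p.1.2) := by
    intro u hu
    have hT := hf.iterate_zero_axis hk hR hA hxs hxA huA hbase hu
    have hw : InWindow (f 0) N R (u, 0) := by
      refine ⟨⟨by simpa [theta] using hR.pos, ?_⟩, ⟨?_, ?_⟩, ?_⟩
      · simp only [theta, abs_of_pos (Real.exp_pos _)]
        refine lt_of_le_of_lt ?_ huA
        rw [← Real.exp_add, Real.exp_le_exp]; linarith [hu.1]
      · rw [hT]; simp only
        rw [abs_of_pos (by positivity)]
        refine lt_of_le_of_lt (mul_le_mul_of_nonneg_left ?_ hxs.le) hxA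
        rw [Real.exp_le_exp]; linarith [hu.2]
      · rw [hT]; simpa using hR.pos
      · rw [hT]; simp only; positivity
    have hc : Tendsto (fun p : (ℝ × ℝ) × ℝ => (p.1.1, ((p.2, p.1.2) : Plane))) (𝓝 ((0, 0), u))
        (𝓝 (0, (u, 0))) := Continuous.tendsto (by fun_prop) ((0, 0), u)
    exact hc.eventually (hf.inWindow_eventually hw)
  have h1 := isCompact_Icc.eventually_forall_of_forall_eventually
    (P := fun (p : ℝ × ℝ) u => InWindow (f p.1) N R (u, p.2)) hev
  have h2 : ∀ᶠ p : ℝ × ℝ in 𝓝 (0, 0), p.1 ∈ I :=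
    (continuous_fst.tendsto ((0 : ℝ), (0 : ℝ))).eventually hf.I_mem_nhds
  obtain ⟨ρ, hρ, hball⟩ := Metric.eventually_nhds_iff_ball.1 (h2.and h1)
  refine ⟨ρ, hρ, fun ε v hε hv => ?_⟩
  exact hball (ε, v) (by
    rw [show ((0 : ℝ), (0 : ℝ)) = (0 : Plane) from rfl, plane_mem_ball]; exact ⟨hε, hv⟩)

/-- The transition map of `f 0` near the separatrix. -/
theorem IsSeparatrixFamily.exists_trans_zero (hk : 1 ≤ k)
    (hf : IsSeparatrixFamily k I f S lam q V₀ H)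
    (hR : IsGoodRadius (q 0) V₀ R) {N : ℕ} {xs ub A ρ : ℝ} (hA : 0 < A)
    (hbase : (f 0)^[N] (theta (ub, 0)) = (xs, 0)) (hρ : 0 < ρ)
    (hwin : ∀ v, |v| < ρ → ∀ u ∈ Icc (ub - A) (ub + A), InWindow (f 0) N R (u, v)) :
    ∃ s : ℝ → ℝ, ContDiff ℝ k s ∧ s 0 = Real.log xs - ub ∧
      ∀ w : Plane, w.1 ∈ Icc (ub - A) (ub + A) → |w.2| ≤ ρ / 2 →
        trans (f 0) N w = (w.1 + s w.2, w.2) := by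
  have hub : ub ∈ Icc (ub - A) (ub + A) := by constructor <;> linarith
  -- The translation length on the horizontal line of height `v` is read at the single abscissa
  -- `ub`.
  obtain ⟨s, hs, hs'⟩ := exists_contDiff_eq (k := k) (g := fun v => (trans (f 0) N (ub, v)).1 - ub)
    hρ fun v hv => by
      have h1 := (hf.family_trans (hwin v hv ub hub).2.2).contDiffAt.self_of_nhds
      have h2 : ContDiffAt ℝ k (fun v : ℝ => ((ub, v) : Plane)) v := by fun_prop
      exact ((h1.comp v h2).fst).sub contDiffAt_const
  refine ⟨s, hs, ?_, ?_⟩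
  · rw [hs' 0 (by simp; positivity)]
    simp [trans, xi1, hbase]
  · rintro ⟨u, v⟩ hu hv
    have hv' : |v| < ρ := lt_of_le_of_lt hv (by linarith)
    have h2 := hf.trans_zero_snd hk hR (hwin v hv' u hu)
    have hder : ∀ x ∈ Icc (ub - A) (ub + A),
        HasDerivAt (fun u => (trans (f 0) N (u, v)).1 - u) 0 x := fun x hx => by
      have := (hf.hasDerivAt_trans_zero_fst hk hR (hwin v hv' x hx)).fun_sub (hasDerivAt_id' x)
      simpa using this
    have hc := (convex_Icc (ub - A) (ub + A)).is_const_of_fderivWithin_eq_zero (𝕜 := ℝ)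
      (f := fun u => (trans (f 0) N (u, v)).1 - u)
      (fun x hx => (hder x hx).differentiableAt.differentiableWithinAt)
      (fun x hx => by
        have : HasFDerivWithinAt (fun u => (trans (f 0) N (u, v)).1 - u) (0 : ℝ →L[ℝ] ℝ)
          (Icc (ub - A) (ub + A)) x := by
            have := (hder x hx).hasFDerivAt.hasFDerivWithinAt (s := Icc (ub - A) (ub + A))
            convert! this using 1
            ext; simp
        exact this.fderivWithin (uniqueDiffOn_Icc (by linarith) x hx)) hu hub
    ext
    · simp only at hv hc ⊢
      rw [hs' v hv]; linarith
    · exact h2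

end Family

/-! ### Arcs in one-dimensional manifolds -/

section InvarianceOfDomain

/-- Invariance of domain in dimension one. -/
theorem isOpen_image_Ioo_of_injOn {X : Type*} [TopologicalSpace X] [ChartedSpace ℝ X] {γ : ℝ → X}
    {a b : ℝ} (hc : ContinuousOn γ (Ioo a b)) (hi : InjOn γ (Ioo a b)) :
    IsOpen (γ '' Ioo a b) := by
  rw [isOpen_iff_mem_nhds]
  rintro _ ⟨t, ht, rfl⟩
  set e := chartAt ℝ (γ t) with he
  have hsrc : γ t ∈ e.source := mem_chart_source ℝ (γ t)
  have hnhds : Ioo a b ∩ γ ⁻¹' e.source ∈ 𝓝 t :=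
    inter_mem (isOpen_Ioo.mem_nhds ht)
      ((hc.continuousAt (isOpen_Ioo.mem_nhds ht)).preimage_mem_nhds (e.open_source.mem_nhds hsrc))
  obtain ⟨d, hd, hsub⟩ := Metric.nhds_basis_closedBall.mem_iff.1 hnhds
  rw [Real.closedBall_eq_Icc] at hsub
  have hlt : t - d ≤ t + d := by linarith
  have hφc : ContinuousOn (fun s => e (γ s)) (Icc (t - d) (t + d)) :=
    e.continuousOn.comp (hc.mono fun s hs => (hsub hs).1) fun s hs => (hsub hs).2
  have hφi : InjOn (fun s => e (γ s)) (Icc (t - d) (t + d)) := fun s hs s' hs' h =>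
    hi (hsub hs).1 (hsub hs').1 (e.injOn (hsub hs).2 (hsub hs').2 h)
  have htmem : t ∈ Icc (t - d) (t + d) := ⟨by linarith, by linarith⟩
  have hl : t - d ∈ Icc (t - d) (t + d) := ⟨by linarith, by linarith⟩
  have hr : t + d ∈ Icc (t - d) (t + d) := ⟨by linarith, by linarith⟩
  -- In a chart the arc is a continuous injective real function, hence strictly monotone, and the
  -- intermediate value theorem applies.
  have hN : (fun s => e (γ s)) '' Ioo (t - d) (t + d) ∈ 𝓝 (e (γ t)) := by
    rcases ContinuousOn.strictMonoOn_of_injOn_Icc' hlt hφc hφi with h | h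
    · exact mem_of_superset (Ioo_mem_nhds (h hl htmem (by linarith)) (h htmem hr (by linarith)))
        (intermediate_value_Ioo hlt hφc)
    · exact mem_of_superset (Ioo_mem_nhds (h htmem hr (by linarith)) (h hl htmem (by linarith)))
        (intermediate_value_Ioo' hlt hφc)
  have := (e.continuousAt hsrc).preimage_mem_nhds hN
  filter_upwards [this, e.open_source.mem_nhds hsrc] with x hx hxs
  obtain ⟨s, hs, hse⟩ := hx
  have hs' := hsub (Ioo_subset_Icc_self hs)
  exact ⟨s, hs'.1, e.injOn hs'.2 hxs hse⟩

/-- Used to see that the stable axis is open in the separatrix. The manifold structure is only an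
abstract atlas on the subtype, so the arc is first lifted to the subtype, with a constant value
outside the interval. -/
theorem isOpen_arc {Y : Type*} [TopologicalSpace Y] {T : Set Y} (hT : Nonempty (ChartedSpace ℝ T))
    {g : ℝ → Y} {a b : ℝ} (hc : ContinuousOn g (Ioo a b)) (hi : InjOn g (Ioo a b))
    (hm : MapsTo g (Ioo a b) T) : IsOpen {x : T | (x : Y) ∈ g '' Ioo a b} := by
  obtain ⟨hch⟩ := hT
  classical
  rcases (Ioo a b).eq_empty_or_nonempty with h | ⟨t₀, ht₀⟩
  · simp [h]
  let γ : ℝ → T := fun t => if h : t ∈ Ioo a b then ⟨g t, hm h⟩ else ⟨g t₀, hm ht₀⟩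
  have hγ : ∀ t ∈ Ioo a b, (γ t : Y) = g t := fun t ht => by simp only [γ, dif_pos ht]
  have h1 : ContinuousOn γ (Ioo a b) := by
    rw [IsInducing.subtypeVal.continuousOn_iff]
    exact hc.congr hγ
  have h2 : InjOn γ (Ioo a b) := fun t ht t' ht' h => by
    apply hi ht ht'; rw [← hγ t ht, ← hγ t' ht', h]
  convert! isOpen_image_Ioo_of_injOn h1 h2 using 1
  ext x
  constructor
  · rintro ⟨t, ht, hx⟩
    exact ⟨t, ht, Subtype.ext ((hγ t ht).trans hx)⟩
  · rintro ⟨t, ht, rfl⟩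
    exact ⟨t, ht, (hγ t ht).symm⟩

end InvarianceOfDomain

/-! ### Exactness of area preserving maps -/

section Exactness

/-- The `1`-form `g^*(y dx) - y dx`. -/
noncomputable def liouvilleDiff (g : Plane → Plane) (z : Plane) : Plane →L[ℝ] ℝ :=
  (g z).2 • (ContinuousLinearMap.fst ℝ ℝ ℝ).comp (fderiv ℝ g z) -
    z.2 • ContinuousLinearMap.fst ℝ ℝ ℝ

/-- The form is closed: the second derivatives of `g` cancel by symmetry and what remains is a
multiple of `det - 1`. The Poincaré lemma then holds on the convex plane. -/
theorem exists_primitive {g : Plane → Plane} (hg : ContDiff ℝ 2 g)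
    (hdet : ∀ z, (fderiv ℝ g z).det = 1) :
    ∃ G : Plane → ℝ, ∀ z, HasFDerivAt G (liouvilleDiff g z) z := by
  have hgd : Differentiable ℝ g := hg.differentiable (by simp)
  have hg1 : ContDiff ℝ 1 (fderiv ℝ g) := hg.fderiv_right (by norm_num)
  have hg1d : Differentiable ℝ (fderiv ℝ g) := hg1.differentiable (by simp)
  have hω : ∀ z, HasFDerivAt (liouvilleDiff g)
      (((g z).2 • ((ContinuousLinearMap.compL ℝ Plane Plane ℝ (ContinuousLinearMap.fst ℝ ℝ ℝ)).comp
        (fderiv ℝ (fderiv ℝ g) z)) +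
        (((ContinuousLinearMap.snd ℝ ℝ ℝ).comp (fderiv ℝ g z)).smulRight
          ((ContinuousLinearMap.fst ℝ ℝ ℝ).comp (fderiv ℝ g z)))) -
        (ContinuousLinearMap.snd ℝ ℝ ℝ).smulRight (ContinuousLinearMap.fst ℝ ℝ ℝ)) z := by
    intro z
    have a1 : HasFDerivAt (fun z => (g z).2) ((ContinuousLinearMap.snd ℝ ℝ ℝ).comp (fderiv ℝ g z)) z :=
      (hgd z).hasFDerivAt.snd
    have a2 : HasFDerivAt (fun z => (ContinuousLinearMap.fst ℝ ℝ ℝ).comp (fderiv ℝ g z))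
        ((ContinuousLinearMap.compL ℝ Plane Plane ℝ (ContinuousLinearMap.fst ℝ ℝ ℝ)).comp
        (fderiv ℝ (fderiv ℝ g) z)) z :=
      (ContinuousLinearMap.compL ℝ Plane Plane ℝ (ContinuousLinearMap.fst ℝ ℝ ℝ)).hasFDerivAt.comp z
        (hg1d z).hasFDerivAt
    have a3 : HasFDerivAt (fun z : Plane => z.2 • ContinuousLinearMap.fst ℝ ℝ ℝ)
        ((ContinuousLinearMap.snd ℝ ℝ ℝ).smulRight (ContinuousLinearMap.fst ℝ ℝ ℝ)) z :=
      HasFDerivAt.smul_const (𝕜 := ℝ) (E := Plane) (F := Plane →L[ℝ] ℝ)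
        (hasFDerivAt_snd (𝕜 := ℝ) (p := z)) (ContinuousLinearMap.fst ℝ ℝ ℝ)
    exact (a1.smul a2).sub a3
  obtain ⟨G, hG⟩ := Convex.exists_forall_hasFDerivAt_of_fderiv_symmetric (𝕜 := ℝ)
    (ω := liouvilleDiff g) convex_univ isOpen_univ
    (fun z _ => (hω z).differentiableAt.differentiableWithinAt) (by
      intro z _ x y
      rw [(hω z).fderiv]
      have hsymm : IsSymmSndFDerivAt ℝ g z :=
        hg.contDiffAt.isSymmSndFDerivAt (by simp)
      have hs := hsymm x y
      have hd := hdet z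
      rw [det_plane] at hd
      have ex : ∀ x : Plane, fderiv ℝ g z x = x.1 • fderiv ℝ g z (1, 0) + x.2 • fderiv ℝ g z (0, 1) := by
        intro x
        rw [← map_smul, ← map_smul, ← map_add]
        congr 1; ext <;> simp
      simp only [_root_.sub_apply, _root_.add_apply,
        _root_.smul_apply, ContinuousLinearMap.comp_apply,
        ContinuousLinearMap.compL_apply, ContinuousLinearMap.smulRight_apply,
        ContinuousLinearMap.coe_fst', ContinuousLinearMap.coe_snd', smul_eq_mul, hs]
      rw [ex x, ex y]
      simp only [Prod.fst_add, Prod.snd_add, Prod.smul_fst, Prod.smul_snd, smul_eq_mul]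
      linear_combination (y.2 * x.1 - x.2 * y.1) * (-hd))
  exact ⟨G, fun z => hG z (mem_univ z)⟩

/-- The pullbacks of `g^*(y dx) - y dx` under the successive iterates telescope. -/
theorem hasFDerivAt_primitive_iterate {g : Plane → Plane} (hg : Differentiable ℝ g) {G : Plane → ℝ}
    (hG : ∀ z, HasFDerivAt G (liouvilleDiff g z) z) (N : ℕ) (z : Plane) :
    HasFDerivAt (fun z => ∑ n ∈ Finset.range N, G (g^[n] z)) (liouvilleDiff g^[N] z) z := by
  induction N with
  | zero =>
    have : liouvilleDiff g^[0] z = 0 := by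
      ext <;> simp [liouvilleDiff]
    simp only [Finset.range_zero, Finset.sum_empty, this]
    exact hasFDerivAt_const _ _
  | succ N ih =>
    simp only [Finset.sum_range_succ]
    have h1 := (hG (g^[N] z)).comp z (hg.iterate N z).hasFDerivAt
    refine (ih.add h1).congr_fderiv ?_
    have h2 : fderiv ℝ g^[N + 1] z = (fderiv ℝ g (g^[N] z)).comp (fderiv ℝ g^[N] z) := by
      rw [Function.iterate_succ']
      exact fderiv_comp z (hg _) (hg.iterate N z)
    refine ContinuousLinearMap.ext fun h => ?_
    simp only [liouvilleDiff, _root_.sub_apply, _root_.add_apply,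
        _root_.smul_apply, ContinuousLinearMap.comp_apply,
        ContinuousLinearMap.coe_fst', smul_eq_mul, h2, Function.iterate_succ_apply']
    ring

/-- In the box, `g^*(y dx) - y dx = -v q''(v) dv = d(q(v) - v q'(v))` with `v = xy`. -/
theorem primitive_eq {g : Plane → Plane} {q : ℝ → ℝ} {R : ℝ} (hR : 0 < R) (hg : IsNormalOn g q R)
    (hq : Differentiable ℝ q) (hq' : Differentiable ℝ (deriv q)) (hq0 : q 0 = 0) {G : Plane → ℝ}
    (hG : ∀ z, HasFDerivAt G (liouvilleDiff g z) z) {z : Plane} (h1 : |z.1| < R) (h2 : |z.2| < R) :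
    G z = G 0 + (q (z.1 * z.2) - z.1 * z.2 * deriv q (z.1 * z.2)) := by
  have hv : ∀ z : Plane, HasFDerivAt (𝕜 := ℝ) (fun z : Plane => z.1 * z.2)
      (z.1 • ContinuousLinearMap.snd ℝ ℝ ℝ + z.2 • ContinuousLinearMap.fst ℝ ℝ ℝ) z := fun z =>
    HasFDerivAt.mul (hasFDerivAt_fst (𝕜 := ℝ) (p := z)) (hasFDerivAt_snd (𝕜 := ℝ) (p := z))
  have key : ∀ z ∈ Metric.ball (0 : Plane) R, HasFDerivAt
      (fun z : Plane => G z - (q (z.1 * z.2) - z.1 * z.2 * deriv q (z.1 * z.2)))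
      (0 : Plane →L[ℝ] ℝ) z := by
    intro z hz
    set v := z.1 * z.2 with hvd
    have hb := plane_mem_ball.1 hz
    have hev : g =ᶠ[𝓝 z] fun z => (z.1 * Real.exp (-deriv q (z.1 * z.2)),
        z.2 * Real.exp (deriv q (z.1 * z.2))) := by
      filter_upwards [Metric.isOpen_ball.mem_nhds hz] with w hw
      exact hg w (plane_mem_ball.1 hw).1 (plane_mem_ball.1 hw).2
    have hp := (hq' v).hasDerivAt.comp_hasFDerivAt z (hv z)
    have hqv := (hq v).hasDerivAt.comp_hasFDerivAt z (hv z)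
    have hf1 : HasFDerivAt (fun w : Plane => (g w).1) _ z :=
      ((hasFDerivAt_fst (𝕜 := ℝ) (p := z)).mul hp.neg.exp).congr_of_eventuallyEq
        (hev.mono fun w hw => congrArg Prod.fst hw)
    have hgd : DifferentiableAt ℝ g z := by
      refine DifferentiableAt.congr_of_eventuallyEq ?_ hev
      have e1 := ((hasFDerivAt_fst (𝕜 := ℝ) (p := z)).mul hp.neg.exp).differentiableAt
      have e2 := ((hasFDerivAt_snd (𝕜 := ℝ) (p := z)).mul hp.exp).differentiableAt
      exact e1.prodMk e2
    have hf1' : HasFDerivAt (fun w : Plane => (g w).1)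
      ((ContinuousLinearMap.fst ℝ ℝ ℝ).comp (fderiv ℝ g z)) z := hgd.hasFDerivAt.fst
    have hL := hf1'.unique hf1
    have hprod := (hv z).mul hp
    refine ((hG z).sub (hqv.sub hprod)).congr_fderiv ?_
    rw [liouvilleDiff, hL, hg z hb.1 hb.2]
    refine ContinuousLinearMap.ext fun h => ?_
    have he : Real.exp (deriv q v) * Real.exp (-deriv q v) = 1 := by rw [← Real.exp_add]; simp
    simp only [_root_.sub_apply, _root_.add_apply,
        _root_.smul_apply, _root_.neg_apply,
        ContinuousLinearMap.coe_fst', ContinuousLinearMap.coe_snd', smul_eq_mul,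
        Function.comp_apply, _root_.zero_apply, Pi.neg_apply, ← hvd]
    rw [hvd] at he ⊢
    linear_combination (z.2 * h.1 - z.2 * z.1 * deriv (deriv q) (z.1 * z.2) * (z.1 * h.2 + z.2 * h.1)) * he
  have := Metric.isOpen_ball.is_const_of_fderiv_eq_zero (𝕜 := ℝ)
    (convex_ball (0 : Plane) R).isPreconnected
    (fun z hz => (key z hz).differentiableAt.differentiableWithinAt)
    (fun z hz => (key z hz).fderiv) (plane_mem_ball.2 ⟨h1, h2⟩) (Metric.mem_ball_self hR)
  have h0 : ((0 : Plane).1 * (0 : Plane).2) = 0 := by simp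
  simp only [h0, hq0, zero_mul, sub_zero] at this
  linarith

end Exactness

/-! ### Existence of a homoclinic point -/

section Homoclinic

/-- An area preserving map of the plane, in normal form near the origin, whose unstable manifold is
a graph over the stable manifold, has a homoclinic point. -/
theorem exists_homoclinic {g : Plane → Plane} {q : ℝ → ℝ} {R lam ub ρ : ℝ} {N : ℕ} {U' : ℝ → ℝ}
    (hgc : ContDiff ℝ 2 g) (hdet : ∀ z, (fderiv ℝ g z).det = 1) (hR : 0 < R)
    (hg : IsNormalOn g q R) (hq : Differentiable ℝ q) (hq' : Differentiable ℝ (deriv q))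
    (hq0 : q 0 = 0) (hlam : deriv q 0 = lam) (hlam0 : 0 < lam)
    (hpos : ∀ v, |v| < ρ → 0 < deriv q v)
    (hwin : ∀ u ∈ Icc (ub - lam) (ub + lam), InWindow g N R (u, 0))
    (hV : ∀ u ∈ Icc (ub - lam) (ub + lam), |(trans g N (u, 0)).2| < ρ)
    (hU : ∀ u ∈ Icc (ub - lam) (ub + lam), HasDerivAt (fun u => (trans g N (u, 0)).1) (U' u) u)
    (hU' : ∀ u ∈ Icc (ub - lam) (ub + lam), 0 ≤ U' u) :
    ∃ u ∈ Icc (ub - lam) (ub + lam), (trans g N (u, 0)).2 = 0 := by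
  have hgd : Differentiable ℝ g := hgc.differentiable (by simp)
  set U : ℝ → ℝ := fun u => (trans g N (u, 0)).1 with hUd
  set V : ℝ → ℝ := fun u => (trans g N (u, 0)).2 with hVd
  set J := Icc (ub - lam) (ub + lam) with hJ
  obtain ⟨G, hG⟩ := exists_primitive hgc hdet
  -- On the unstable axis `y dx = 0`. Hence `K` is a primitive of `Y dX` along the image curve `(X,
  -- Y)`, and `Y dX = V dU` because `X = e^U` and `XY = V`.
  set K : ℝ → ℝ := fun u => ∑ n ∈ Finset.range N, G (g^[n] (theta (u, 0))) with hK
  have hline : ∀ u : ℝ, HasDerivAt (fun u : ℝ => theta (u, 0)) (0, -Real.exp (-u)) u := by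
    intro u
    have := ((hasDerivAt_id' u).neg.exp)
    have h2 : HasDerivAt (fun u : ℝ => ((0 : ℝ), Real.exp (-u))) (0, -Real.exp (-u)) u :=
      (hasDerivAt_const u (0 : ℝ)).prodMk (by simpa using this)
    simpa [theta] using h2
  have hX : ∀ u ∈ J, (g^[N] (theta (u, 0))).1 = Real.exp (U u) := fun u hu => by
    simp [hUd, trans, xi1, Real.exp_log (hwin u hu).2.2]
  have hXder : ∀ u ∈ J, (fderiv ℝ g^[N] (theta (u, 0)) (0, -Real.exp (-u))).1 =
      (g^[N] (theta (u, 0))).1 * U' u := by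
    intro u hu
    have e1 := ((hgd.iterate N) (theta (u, 0))).hasFDerivAt.comp_hasDerivAt u (hline u)
    have e2 := (hasDerivAt_fst_of e1).log (hwin u hu).2.2.ne'
    have e3 := e2.unique (hU u hu)
    have h0 : (g^[N] (theta (u, 0))).1 ≠ 0 := (hwin u hu).2.2.ne'
    rw [← e3]
    simp only [Function.comp_apply]
    field_simp
  have hKder : ∀ u ∈ J, HasDerivAt K (V u * U' u) u := by
    intro u hu
    have e := (hasFDerivAt_primitive_iterate hgd hG N (theta (u, 0))).comp_hasDerivAt u (hline u)
    convert! e using 1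
    simp only [liouvilleDiff, _root_.sub_apply, _root_.smul_apply,
      ContinuousLinearMap.comp_apply, ContinuousLinearMap.coe_fst', smul_eq_mul, hXder u hu]
    simp only [hVd, trans, xi1]
    ring
  have hVc : ContinuousOn V J := by
    have : Continuous fun u : ℝ => (g^[N] (theta (u, 0))).1 * (g^[N] (theta (u, 0))).2 := by
      have h1 : Continuous fun u : ℝ => g^[N] (theta (u, 0)) :=
        (hgd.continuous.iterate N).comp ((contDiff_theta (n := 0)).continuous.comp (by fun_prop))
      exact h1.fst.mul h1.snd
    exact this.continuousOn
  have hshift : ∀ u ∈ J, U (u - lam) = U u - deriv q (V u) ∧ V (u - lam) = V u := by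
    intro u hu
    have := trans_sub hg (hwin u hu)
    simp only [hlam] at this
    simp only [hUd, hVd]
    rw [this]
    exact ⟨rfl, rfl⟩
  -- Replacing `u` by `u - lam` advances the orbit by one step, so only the two end terms of the sum
  -- change; both are taken in the box, where `G` is explicit.
  have hKshift : ∀ u ∈ J, K (u - lam) = K u + (q (V u) - V u * deriv q (V u)) := by
    intro u hu
    have e1 : theta (u - lam, 0) = g (theta (u, 0)) := by
      rw [hg _ (hwin u hu).1.1 (hwin u hu).1.2, theta_mul]
      simp [theta, hlam, ← Real.exp_add, sub_eq_add_neg, add_comm]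
    have e2 : K (u - lam) = ∑ n ∈ Finset.range N, G (g^[n + 1] (theta (u, 0))) := by
      simp only [hK, e1, Function.iterate_succ_apply]
    have e3 := Finset.sum_range_succ (fun n => G (g^[n] (theta (u, 0)))) N
    rw [Finset.sum_range_succ'] at e3
    have e4 := primitive_eq hR hg hq hq' hq0 hG (hwin u hu).2.1.1 (hwin u hu).2.1.2
    have e5 := primitive_eq hR hg hq hq' hq0 hG (hwin u hu).1.1 (hwin u hu).1.2
    rw [theta_mul] at e5
    simp only [hq0, zero_mul, sub_zero, add_zero] at e5
    have e6 : (g^[N] (theta (u, 0))).1 * (g^[N] (theta (u, 0))).2 = V u := rfl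
    rw [e6] at e4
    simp only [Function.iterate_zero, id_eq] at e3
    rw [e2]
    simp only [hK]
    linarith
  have hmono : StrictMonoOn q (Ioo (-ρ) ρ) := by
    refine strictMonoOn_of_deriv_pos (convex_Ioo _ _) hq.continuous.continuousOn fun v hv => ?_
    rw [interior_Ioo] at hv
    exact hpos v (abs_lt.2 hv)
  have hρ : 0 < ρ := lt_of_le_of_lt (abs_nonneg _) (hV ub ⟨by linarith, by linarith⟩)
  have hVmem : ∀ u ∈ J, V u ∈ Ioo (-ρ) ρ := fun u hu => abs_lt.1 (hV u hu)
  have hMder : ∀ c : ℝ, ∀ u ∈ J, HasDerivAt (fun u => K u - c * U u) ((V u - c) * U' u) u := by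
    intro c u hu
    convert! (hKder u hu).fun_sub ((hU u hu).const_mul c) using 1
    ring
  have hsub : Icc ub (ub + lam) ⊆ J := Icc_subset_Icc (by linarith) le_rfl
  have hne : (Icc ub (ub + lam)).Nonempty := ⟨ub, by constructor <;> linarith⟩
  -- `V` has period `lam`, so a bound on one period is also valid on the period that ends at `u₁`.
  have hper : ∀ {P : ℝ → Prop}, (∀ u ∈ Icc ub (ub + lam), P (V u)) →
      ∀ u₁ ∈ Icc ub (ub + lam), ∀ u ∈ Icc (u₁ - lam) u₁, P (V u) ∧ u ∈ J := by
    intro P h u₁ h1 u hu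
    have huJ : u ∈ J := ⟨by linarith [hu.1, h1.1], by linarith [hu.2, h1.2]⟩
    refine ⟨?_, huJ⟩
    rcases le_total ub u with h' | h'
    · exact h u ⟨h', by linarith [hu.2, h1.2]⟩
    · have hm : u + lam ∈ Icc ub (ub + lam) := ⟨by linarith [huJ.1], by linarith⟩
      have := (hshift (u + lam) (hsub hm)).2
      rw [add_sub_cancel_right] at this
      rw [this]; exact h _ hm
  by_contra! hcon
  -- With the constant `c = V u`, the terms in `q'` cancel and `K - c U` decreases by exactly `q(c)`
  -- from `u - lam` to `u`.
  have hMdiff : ∀ u ∈ J, (K (u - lam) - V u * U (u - lam)) - (K u - V u * U u) = q (V u) := by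
    intro u hu
    rw [hKshift u hu, (hshift u hu).1]; ring
  have hsign : (∀ u ∈ J, 0 < V u) ∨ (∀ u ∈ J, V u < 0) := by
    by_contra! h
    obtain ⟨⟨u, hu, h1⟩, ⟨u', hu', h2⟩⟩ := h
    have := isPreconnected_Icc.intermediate_value hu hu' hVc ⟨h1, h2⟩
    obtain ⟨x, hx, hx0⟩ := this
    exact hcon x hx hx0
  rcases hsign with hs | hs
  -- If `V > 0`, take `u₁` where `V` is minimal. The derivative `(V - V u₁) U'` of `K - V(u₁) U` is
  -- nonnegative over the period ending at `u₁`, although this function decreases there by `q(V u₁)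
  -- > 0`. The case `V < 0` uses a maximum.
  · obtain ⟨u₁, h1, hmin⟩ := isCompact_Icc.exists_isMinOn hne (hVc.mono hsub)
    have hp := hper (P := fun v => V u₁ ≤ v) fun u hu => hmin hu
    have hant : MonotoneOn (fun u => K u - V u₁ * U u) (Icc (u₁ - lam) u₁) := by
      refine monotoneOn_of_deriv_nonneg (convex_Icc _ _)
        (fun u hu => (hMder _ u (hp u₁ h1 u hu).2).continuousAt.continuousWithinAt)
        (fun u hu => (hMder _ u (hp u₁ h1 u (interior_subset hu)).2).differentiableAt.differentiableWithinAt)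
        fun u hu => ?_
      rw [(hMder _ u (hp u₁ h1 u (interior_subset hu)).2).deriv]
      exact mul_nonneg (by linarith [(hp u₁ h1 u (interior_subset hu)).1])
        (hU' u (hp u₁ h1 u (interior_subset hu)).2)
    have := hant (a := u₁ - lam) (b := u₁) ⟨le_rfl, by linarith⟩ ⟨by linarith, le_rfl⟩ (by linarith)
    have h2 := hMdiff u₁ (hsub h1)
    have h3 : q 0 < q (V u₁) := hmono ⟨by linarith, hρ⟩ (hVmem u₁ (hsub h1)) (hs u₁ (hsub h1))
    simp only at this
    linarith
  · obtain ⟨u₁, h1, hmax⟩ := isCompact_Icc.exists_isMaxOn hne (hVc.mono hsub)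
    have hp := hper (P := fun v => v ≤ V u₁) fun u hu => hmax hu
    have hant : AntitoneOn (fun u => K u - V u₁ * U u) (Icc (u₁ - lam) u₁) := by
      refine antitoneOn_of_deriv_nonpos (convex_Icc _ _)
        (fun u hu => (hMder _ u (hp u₁ h1 u hu).2).continuousAt.continuousWithinAt)
        (fun u hu => (hMder _ u (hp u₁ h1 u (interior_subset hu)).2).differentiableAt.differentiableWithinAt)
        fun u hu => ?_
      rw [(hMder _ u (hp u₁ h1 u (interior_subset hu)).2).deriv]
      exact mul_nonpos_of_nonpos_of_nonneg (by linarith [(hp u₁ h1 u (interior_subset hu)).1])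
        (hU' u (hp u₁ h1 u (interior_subset hu)).2)
    have := hant (a := u₁ - lam) (b := u₁) ⟨le_rfl, by linarith⟩ ⟨by linarith, le_rfl⟩ (by linarith)
    have h2 := hMdiff u₁ (hsub h1)
    have h3 : q (V u₁) < q 0 := hmono (hVmem u₁ (hsub h1)) ⟨by linarith, hρ⟩ (hs u₁ (hsub h1))
    simp only at this
    linarith

end Homoclinic

/-! ### Persistence of the coincidence of the stable and unstable manifolds -/

section Family

variable {k : ℕ} {I : Set ℝ} {f : ℝ → Equiv.Perm Plane} {S : ℝ → Set Plane}
    {lam : ℝ} {q : ℝ → ℝ → ℝ} {V₀ : Set Plane} {H : Plane → ℝ} {R : ℝ}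

/-- If the unstable manifold meets the stable manifold in the window, then they coincide there. -/
theorem IsSeparatrixFamily.unstable_eq_stable (hf : IsSeparatrixFamily k I f S lam q V₀ H)
    (hR : IsGoodRadius (q 0) V₀ R) {ε : ℝ} (hε : ε ∈ I) {N : ℕ} {a b u₀ : ℝ}
    (hwin : ∀ u ∈ Icc a b, InWindow (f ε) N R (u, 0)) (hu₀ : u₀ ∈ Icc a b)
    (h₀ : ((f ε)^[N] (theta (u₀, 0))).2 = 0) {u : ℝ} (hu : u ∈ Icc a b) :
    ((f ε)^[N] (theta (u, 0))).2 = 0 := by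
  have hcont : Continuous (fun u : ℝ => (f ε)^[N] (theta (u, 0))) :=
    ((hf.symplectic ε hε).contDiff.continuous.iterate N).comp
      ((contDiff_theta (n := 0)).continuous.comp (by fun_prop))
  have hmem : ∀ x ∈ Ioo 0 R, ((x, 0) : Plane) ∈ S ε \ {0} := fun x hx =>
    ⟨hf.stable_mem hR hε hx.1 hx.2, fun h => hx.1.ne' (congrArg Prod.fst h)⟩
  have hopen := isOpen_arc (hf.separatrix ε hε).manifold (g := fun x : ℝ => ((x, 0) : Plane))
    (a := 0) (b := R) (by fun_prop) (fun x _ y _ h => congrArg Prod.fst h) hmem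
  have hS : ∀ u ∈ Icc a b, (f ε)^[N] (theta (u, 0)) ∈ S ε \ {0} := by
    intro u hu
    have h1 := (hwin u hu).1.2
    simp only [theta, abs_of_pos (Real.exp_pos _)] at h1
    have h2 := hf.unstable_mem hR hε (Real.exp_pos _) h1
    refine ⟨?_, ?_⟩
    · rw [(hf.separatrix ε hε).iterate_mem_iff]
      simpa [theta] using h2
    · intro h
      have h3 := (hwin u hu).2.2
      rw [mem_singleton_iff.1 h] at h3
      simp at h3
  -- The condition is closed; it is open because the piece of stable axis in the box is open in the
  -- manifold `S ε \ {0}`, in which the image curve lies.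
  let T : Set (Icc a b) := {u | ((f ε)^[N] (theta (u, 0))).2 = 0}
  have hclosed : IsClosed T :=
    isClosed_eq ((continuous_snd.comp hcont).comp continuous_subtype_val) continuous_const
  have hTopen : IsOpen T := by
    let φ : Icc a b → ↥(S ε \ {0}) := fun u => ⟨(f ε)^[N] (theta (u, 0)), hS u u.2⟩
    have hφ : Continuous φ := (hcont.comp continuous_subtype_val).subtype_mk _
    convert! hopen.preimage hφ using 1
    ext u
    constructor
    · intro h
      have h1 := (hwin u u.2).2
      exact ⟨((f ε)^[N] (theta (u, 0))).1, ⟨h1.2, (abs_lt.1 h1.1.1).2⟩, Prod.ext rfl (Eq.symm h)⟩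
    · rintro ⟨x, _, hx⟩
      exact (congrArg Prod.snd hx).symm
  have : PreconnectedSpace (Icc a b) := isPreconnected_iff_preconnectedSpace.1 isPreconnected_Icc
  have huniv := IsClopen.eq_univ (s := T) ⟨hclosed, hTopen⟩ ⟨⟨u₀, hu₀⟩, h₀⟩
  have : (⟨u, hu⟩ : Icc a b) ∈ T := by rw [huniv]; trivial
  exact this

/-- For `ε` close to `0`, the stable and unstable manifolds coincide in the window. -/
theorem IsSeparatrixFamily.eventually_unstable_eq_stable (hk : 2 ≤ k)
    (hf : IsSeparatrixFamily k I f S lam q V₀ H)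
    (hR : IsGoodRadius (q 0) V₀ R) {N : ℕ} {ub A ρ : ℝ} (hA : lam ≤ A) (hρ : 0 < ρ)
    (hwin : ∀ ε v, |ε| < ρ → |v| < ρ → ε ∈ I ∧ ∀ u ∈ Icc (ub - A) (ub + A),
      InWindow (f ε) N R (u, v)) :
    ∀ᶠ ε in 𝓝 (0 : ℝ), ∀ u ∈ Icc (ub - A) (ub + A), (trans (f ε) N (u, 0)).2 = 0 := by
  have hlam := hf.lam_pos
  have hkk : (2 : WithTop ℕ∞) ≤ k := by exact_mod_cast hk
  have hε : ∀ᶠ ε in 𝓝 (0 : ℝ), |ε| < ρ :=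
    (isOpen_lt continuous_abs continuous_const).mem_nhds (by simpa using hρ)
  have hz : ∀ v : ℝ, v = 0 → |v| < ρ := fun v hv => by rw [hv]; simpa using hρ
  obtain ⟨ρ', hρ', hp⟩ : ∃ ρ' > 0, ∀ ε v, |ε| < ρ' → |v| < ρ' → 0 < deriv (q ε) v := by
    have h1 := (hf.family_deriv hR (v := 0) (by simpa using pow_pos hR.pos 2)).continuousAt_zero
    have h2 : ∀ᶠ p : ℝ × ℝ in 𝓝 (0, 0), 0 < deriv (q p.1) p.2 := by
      refine h1.eventually (lt_mem_nhds ?_)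
      simp only [hf.q_deriv 0 hf.zero_mem_I, hlam]
    obtain ⟨ρ', hρ', hb⟩ := Metric.eventually_nhds_iff_ball.1 h2
    refine ⟨ρ', hρ', fun ε v h3 h4 => hb (ε, v) ?_⟩
    rw [show ((0 : ℝ), (0 : ℝ)) = (0 : Plane) from rfl, plane_mem_ball]; exact ⟨h3, h4⟩
  have hcoe : ∀ u : ℝ, Tendsto (fun p : ℝ × ℝ => (p.1, ((p.2, 0) : Plane))) (𝓝 (0, u))
      (𝓝 (0, (u, 0))) := fun u => Continuous.tendsto (by fun_prop) ((0 : ℝ), u)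
  have hV : ∀ᶠ ε in 𝓝 (0 : ℝ), ∀ u ∈ Icc (ub - A) (ub + A), |(trans (f ε) N (u, 0)).2| < ρ' := by
    refine isCompact_Icc.eventually_forall_of_forall_eventually fun u hu => ?_
    have hw := (hwin 0 0 (hz 0 rfl) (hz 0 rfl)).2 u hu
    have h1 := (hf.family_trans (k := k) hw.2.2).continuousAt_zero.snd.abs
    have h2 : |(trans (f 0) N (u, 0)).2| < ρ' := by
      rw [hf.trans_zero_snd (by omega) hR hw]; simpa using hρ'
    exact (hcoe u).eventually (h1.eventually (Iio_mem_nhds h2))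
  -- At `ε = 0` this partial derivative is `1` along the compact segment, so it stays positive for
  -- small `ε`: the unstable manifold remains a graph over the stable one.
  have hU : ∀ᶠ ε in 𝓝 (0 : ℝ), ∀ u ∈ Icc (ub - A) (ub + A),
      DifferentiableAt ℝ (trans (f ε) N) (u, 0) ∧
        0 < (fderiv ℝ (trans (f ε) N) (u, 0) (1, 0)).1 := by
    refine isCompact_Icc.eventually_forall_of_forall_eventually fun u hu => ?_
    have hw := (hwin 0 0 (hz 0 rfl) (hz 0 rfl)).2 u hu
    have h1 : FamilyCk (0 + 1) (fun ε => trans (f ε) N) (u, 0) :=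
      (hf.family_trans (k := k) hw.2.2).mono (by omega)
    have h2 := FamilyCk.succ_iff.1 h1
    have h3 := h2.2.2.continuousAt_zero
    have h4 : ContinuousAt (fun p : ℝ × Plane => (fderiv ℝ (trans (f p.1) N) p.2 (1, 0)).1)
        (0, (u, 0)) := by
      have : Continuous (fun L : Plane →L[ℝ] Plane => (L (1, 0)).1) := by fun_prop
      exact this.continuousAt.comp h3
    have h5 : (fderiv ℝ (trans (f 0) N) (u, 0) (1, 0)).1 = 1 := by
      have e1 := hf.hasDerivAt_trans_zero_fst (by omega) hR hw
      have hd := (h2.1.self_of_nhds.differentiableAt (by simp)).hasFDerivAt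
      have hline : HasDerivAt (fun u : ℝ => ((u, 0) : Plane)) (1, 0) u :=
        (hasDerivAt_id u).prodMk (hasDerivAt_const _ _)
      have e2 := HasFDerivAt.comp_hasDerivAt (l := trans (f 0) N)
        (f := fun u : ℝ => ((u, 0) : Plane)) u hd hline
      exact (hasDerivAt_fst_of e2).unique e1
    have h6 := (hcoe u).eventually (h4.eventually (lt_mem_nhds (a := 0) (by
      simp only [h5]; exact one_pos)))
    filter_upwards [(hcoe u).eventually h2.1, h6] with p a1 a2
    exact ⟨a1.differentiableAt (by simp), a2⟩
  have hε' : ∀ᶠ ε in 𝓝 (0 : ℝ), |ε| < ρ' :=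
    (isOpen_lt continuous_abs continuous_const).mem_nhds (by simpa using hρ')
  filter_upwards [hε, hε', hV, hU] with ε e1 e2 e3 e4 u hu
  obtain ⟨hI, hw⟩ := hwin ε 0 e1 (hz 0 rfl)
  have hsub : Icc (ub - lam) (ub + lam) ⊆ Icc (ub - A) (ub + A) :=
    Icc_subset_Icc (by linarith) (by linarith)
  have hs := hf.symplectic ε hI
  obtain ⟨u₀, hu₀, h₀⟩ := exists_homoclinic (ub := ub) (N := N)
    (U' := fun u => (fderiv ℝ (trans (f ε) N) (u, 0) (1, 0)).1) (hs.contDiff.of_le hkk)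
    hs.det_eq_one hR.pos (hf.isNormalOn hR hI) (hf.differentiable_q hI)
    ((hf.contDiff_deriv_q hI).differentiable (by exact_mod_cast (by omega : k ≠ 0)))
    (hf.q_zero ε hI) (hf.q_deriv ε hI) hlam (hp ε · e2) (fun u hu => hw u (hsub hu))
    (fun u hu => e3 u (hsub hu)) (fun u hu => by
      have hline : HasDerivAt (fun u : ℝ => ((u, 0) : Plane)) (1, 0) u :=
        (hasDerivAt_id u).prodMk (hasDerivAt_const _ _)
      have := HasFDerivAt.comp_hasDerivAt (l := trans (f ε) N)
        (f := fun u : ℝ => ((u, 0) : Plane)) u (e4 u (hsub hu)).1.hasFDerivAt hline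
      exact hasDerivAt_fst_of this) (fun u hu => (e4 u (hsub hu)).2.le)
  have h0' : ((f ε)^[N] (theta (u₀, 0))).2 = 0 := by
    have h1 : ((f ε)^[N] (theta (u₀, 0))).1 * ((f ε)^[N] (theta (u₀, 0))).2 = 0 := h₀
    have h2 := (hw u₀ (hsub hu₀)).2.2
    simpa [h2.ne'] using h1
  have := hf.unstable_eq_stable hR hI hw (hsub hu₀) h0' hu
  simp [trans, xi1, this]

end Family

/-- The transition map `g^N` read in the normalized coordinates `((ln x - ln x_*) / q'(xy), xy)`, up
to the twist by `s`. -/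
noncomputable def lift (g : Plane → Plane) (q : ℝ → ℝ) (s : ℝ → ℝ) (N : ℕ) (ux : ℝ) (w : Plane) :
    Plane :=
  (((trans g N (ux + w.1 * deriv q w.2 - s w.2, w.2)).1 - ux) /
      deriv q (trans g N (ux + w.1 * deriv q w.2 - s w.2, w.2)).2,
    (trans g N (ux + w.1 * deriv q w.2 - s w.2, w.2)).2)

/-! ### The normalized transition map and its distance to the identity -/

section Family

variable {k : ℕ} {I : Set ℝ} {f : ℝ → Equiv.Perm Plane} {S : ℝ → Set Plane}
    {lam : ℝ} {q : ℝ → ℝ → ℝ} {V₀ : Set Plane} {H : Plane → ℝ} {R : ℝ}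

/-- The uniform estimates for the family near the separatrix: `s` is the function `σ`, the estimates
hold for `|ε| < ρ` and `|xy| ≤ ρ`, and `ub` is the coordinate of the base point on the unstable
axis. -/
structure IsTransition (k : ℕ) (I : Set ℝ) (f : ℝ → Equiv.Perm Plane) (lam : ℝ) (q : ℝ → ℝ → ℝ)
    (R : ℝ) (N : ℕ) (ux ub : ℝ) (s : ℝ → ℝ) (ρ : ℝ) : Prop where
  pos : 0 < ρ
  le_sq : ρ < R ^ 2 / 2
  contDiff : ContDiff ℝ k s
  trans_zero : ∀ w : Plane, w.1 ∈ Icc (ub - 4 * lam) (ub + 4 * lam) → |w.2| ≤ ρ →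
    trans (f 0) N w = (w.1 + s w.2, w.2)
  s_near : ∀ v, |v| ≤ ρ → |s v - (ux - ub)| ≤ lam / 4
  mem : ∀ ε, |ε| < ρ → ε ∈ I
  freq : ∀ ε v, |ε| < ρ → |v| ≤ ρ → 3 * lam / 4 < deriv (q ε) v ∧ deriv (q ε) v < 5 * lam / 4
  window : ∀ ε v, |ε| < ρ → |v| ≤ ρ → ∀ u ∈ Icc (ub - 4 * lam) (ub + 4 * lam),
    InWindow (f ε) N R (u, v)

theorem IsSeparatrixFamily.exists_isTransition (hk : 2 ≤ k)
    (hf : IsSeparatrixFamily k I f S lam q V₀ H)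
    (hR : IsGoodRadius (q 0) V₀ R) {N : ℕ} {xs ub : ℝ} (hxs : 0 < xs)
    (hxA : xs * Real.exp (4 * lam) < R) (huA : Real.exp (-ub) * Real.exp (4 * lam) < R)
    (hbase : (f 0)^[N] (theta (ub, 0)) = (xs, 0)) :
    ∃ s ρ, IsTransition k I f lam q R N (Real.log xs) ub s ρ := by
  have hlam := hf.lam_pos
  have hRp := hR.pos
  obtain ⟨ρ₁, h1, hwin⟩ := hf.exists_window (by omega) hR (A := 4 * lam) (by linarith) hxs hxA huA
    hbase
  obtain ⟨s, hs, hs0, htr⟩ := hf.exists_trans_zero (by omega) hR (A := 4 * lam) (by linarith)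
    hbase h1 fun v hv => (hwin 0 v (by simpa using h1) hv).2
  obtain ⟨ρ₂, h2, hp⟩ : ∃ ρ' > 0, ∀ ε v, |ε| < ρ' → |v| < ρ' →
      3 * lam / 4 < deriv (q ε) v ∧ deriv (q ε) v < 5 * lam / 4 := by
    have h1 := (hf.family_deriv hR (v := 0) (by simpa using pow_pos hR.pos 2)).continuousAt_zero
    have h2 : ∀ᶠ p : ℝ × ℝ in 𝓝 (0, 0), 3 * lam / 4 < deriv (q p.1) p.2 ∧
        deriv (q p.1) p.2 < 5 * lam / 4 := by
      refine h1.eventually (Ioo_mem_nhds ?_ ?_)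
      · simp only [hf.q_deriv 0 hf.zero_mem_I]; linarith
      · simp only [hf.q_deriv 0 hf.zero_mem_I]; linarith
    obtain ⟨ρ', hρ', hb⟩ := Metric.eventually_nhds_iff_ball.1 h2
    refine ⟨ρ', hρ', fun ε v h3 h4 => hb (ε, v) ?_⟩
    rw [show ((0 : ℝ), (0 : ℝ)) = (0 : Plane) from rfl, plane_mem_ball]; exact ⟨h3, h4⟩
  obtain ⟨ρ₃, h3, hnear⟩ : ∃ ρ' > 0, ∀ v, |v| < ρ' → |s v - s 0| ≤ lam / 4 := by
    obtain ⟨ρ', hρ', hb⟩ := Metric.continuousAt_iff.1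
      (hs.continuous.continuousAt (x := 0)) (lam / 4) (by linarith)
    refine ⟨ρ', hρ', fun v hv => ?_⟩
    have := hb (x := v) (by rwa [Real.dist_eq, sub_zero])
    rw [Real.dist_eq] at this; exact this.le
  set ρ := min (min (ρ₁ / 2) (ρ₂ / 2)) (min (ρ₃ / 2) (R ^ 2 / 4)) with hρ
  have a1 : ρ ≤ ρ₁ / 2 := (min_le_left _ _).trans (min_le_left _ _)
  have a2 : ρ ≤ ρ₂ / 2 := (min_le_left _ _).trans (min_le_right _ _)
  have a3 : ρ ≤ ρ₃ / 2 := (min_le_right _ _).trans (min_le_left _ _)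
  have a4 : ρ ≤ R ^ 2 / 4 := (min_le_right _ _).trans (min_le_right _ _)
  have hR2 : 0 < R ^ 2 := by positivity
  exact ⟨s, ρ,
    { pos := by positivity
      le_sq := by linarith
      contDiff := hs
      trans_zero := fun w hw hv => htr w hw (by linarith)
      s_near := fun v hv => by rw [← hs0]; exact hnear v (by linarith)
      mem := fun ε hε => (hwin ε 0 (by linarith) (by simpa using h1)).1
      freq := fun ε v hε hv => hp ε v (by linarith) (by linarith)
      window := fun ε v hε hv => (hwin ε v (by linarith) (by linarith)).2 }⟩

variable {N : ℕ} {ux ub ρ : ℝ} {s : ℝ → ℝ}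

/-- Three normalized units, each shorter than `5 lam / 4`, and the variation `lam / 4` of `s` fit in
the half-width of the window: `3 · 5/4 + 1/4 = 4`. -/
theorem IsTransition.arg_mem (hT : IsTransition k I f lam q R N ux ub s ρ) (hlam : 0 < lam) {ε : ℝ}
    {w : Plane} (hε : |ε| < ρ) (h1 : |w.1| ≤ 3) (h2 : |w.2| ≤ ρ) :
    ux + w.1 * deriv (q ε) w.2 - s w.2 ∈ Icc (ub - 4 * lam) (ub + 4 * lam) := by
  have a1 := abs_le.1 (hT.s_near _ h2)
  obtain ⟨a2, a3⟩ := hT.freq ε _ hε h2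
  have a4 : |w.1 * deriv (q ε) w.2| ≤ 3 * (5 * lam / 4) := by
    rw [abs_mul, abs_of_pos (show 0 < deriv (q ε) w.2 by linarith)]
    exact mul_le_mul h1 a3.le (by linarith) (by norm_num)
  have a5 := abs_le.1 a4
  constructor <;> linarith

theorem IsTransition.window_arg (hT : IsTransition k I f lam q R N ux ub s ρ) (hlam : 0 < lam)
    {ε : ℝ} {w : Plane} (hε : |ε| < ρ) (h1 : |w.1| ≤ 3) (h2 : |w.2| ≤ ρ) :
    InWindow (f ε) N R (ux + w.1 * deriv (q ε) w.2 - s w.2, w.2) :=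
  hT.window ε _ hε h2 _ (hT.arg_mem hlam hε h1 h2)

/-- At `ε = 0` the transition map is the shear by `s`, which `lift` undoes in advance. -/
theorem IsTransition.lift_zero (hT : IsTransition k I f lam q R N ux ub s ρ) (hlam : 0 < lam)
    {w : Plane} (h1 : |w.1| ≤ 3) (h2 : |w.2| ≤ ρ) : lift (f 0) (q 0) s N ux w = w := by
  have hε : |(0 : ℝ)| < ρ := by simpa using hT.pos
  have hp := (hT.freq 0 _ hε h2).1
  have h3 := hT.trans_zero (ux + w.1 * deriv (q 0) w.2 - s w.2, w.2) (hT.arg_mem hlam hε h1 h2) h2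
  have h4 : deriv (q 0) w.2 ≠ 0 := by linarith
  unfold lift
  rw [h3]
  ext
  · simp only; field_simp; ring
  · rfl

theorem IsSeparatrixFamily.family_lift (hf : IsSeparatrixFamily k I f S lam q V₀ H)
    (hR : IsGoodRadius (q 0) V₀ R)
    (hT : IsTransition k I f lam q R N ux ub s ρ)
    {w : Plane} (h1 : |w.1| ≤ 3) (h2 : |w.2| ≤ ρ) :
    FamilyCk k (fun ε w => lift (f ε) (q ε) s N ux w - w) w := by
  have hlam := hf.lam_pos
  have hε : |(0 : ℝ)| < ρ := by simpa using hT.pos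
  have hid1 : FamilyCk k (fun _ (w : Plane) => w.1) w := FamilyCk.const_of_contDiff contDiff_fst
  have hid2 : FamilyCk k (fun _ (w : Plane) => w.2) w := FamilyCk.const_of_contDiff contDiff_snd
  have hux : FamilyCk k (fun _ (_ : Plane) => ux) w := FamilyCk.const_of_contDiff contDiff_const
  have hp : FamilyCk k (fun ε (w : Plane) => deriv (q ε) w.2) w :=
    FamilyCk.comp (φ := fun ε => deriv (q ε)) (hf.family_deriv hR (h2.trans_lt hT.le_sq)) hid2
  have hs : FamilyCk k (fun _ (w : Plane) => s w.2) w :=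
    FamilyCk.const_of_contDiff (hT.contDiff.comp contDiff_snd)
  have harg : FamilyCk k (fun ε (w : Plane) => (ux + w.1 * deriv (q ε) w.2 - s w.2, w.2)) w :=
    ((hux.add (hid1.mul hp)).sub hs).prodMk hid2
  have hF : FamilyCk k (fun ε (w : Plane) =>
      trans (f ε) N (ux + w.1 * deriv (q ε) w.2 - s w.2, w.2)) w :=
    FamilyCk.comp (φ := fun ε => trans (f ε) N)
      (hf.family_trans (hT.window_arg hlam hε h1 h2).2.2) harg
  have hval := hT.trans_zero (ux + w.1 * deriv (q 0) w.2 - s w.2, w.2) (hT.arg_mem hlam hε h1 h2) h2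
  have hpV : FamilyCk k (fun ε (w : Plane) =>
      deriv (q ε) (trans (f ε) N (ux + w.1 * deriv (q ε) w.2 - s w.2, w.2)).2) w := by
    refine FamilyCk.comp (φ := fun ε => deriv (q ε)) (hf.family_deriv hR ?_) hF.snd
    simp only [hval]
    exact h2.trans_lt hT.le_sq
  have h0 : deriv (q 0) (trans (f 0) N (ux + w.1 * deriv (q 0) w.2 - s w.2, w.2)).2 ≠ 0 := by
    rw [hval]
    have := (hT.freq 0 _ hε h2).1
    simp only; linarith
  exact (((hF.fst.sub hux).div hpV h0).prodMk hF.snd).sub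
    (FamilyCk.const_of_contDiff contDiff_id)

/-- The lift of the transition map is `C^k`-close to the identity. -/
theorem IsSeparatrixFamily.eventually_lift_small (hf : IsSeparatrixFamily k I f S lam q V₀ H)
    (hR : IsGoodRadius (q 0) V₀ R) (hT : IsTransition k I f lam q R N ux ub s ρ) {τ : ℝ}
    (hτ : 0 < τ) :
    ∀ᶠ ε in 𝓝 (0 : ℝ), ∀ w ∈ Icc (-5 / 2 : ℝ) (5 / 2) ×ˢ Icc (-(ρ / 2)) (ρ / 2),
      ContDiffAt ℝ k (fun w => lift (f ε) (q ε) s N ux w - w) w ∧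
        ∀ i ≤ k, ‖iteratedFDeriv ℝ i (fun w => lift (f ε) (q ε) s N ux w - w) w‖ < τ := by
  refine (isCompact_Icc.prod isCompact_Icc).eventually_forall_of_forall_eventually ?_
  rintro w ⟨hw1, hw2⟩
  have hρ := hT.pos
  have h1 : |w.1| ≤ 5 / 2 := abs_le.2 ⟨by linarith [hw1.1], hw1.2⟩
  have h2 : |w.2| ≤ ρ / 2 := abs_le.2 hw2
  have hfam := hf.family_lift hR hT (w := w) (by linarith) (by linarith)
  -- At `ε = 0` the displacement vanishes on a whole neighbourhood of `w`, so its derivatives vanish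
  -- at `w`. Joint continuity makes them small for `(ε, w')` near `(0, w)`, and compactness for all
  -- `w'`.
  have hzero : (fun w => lift (f 0) (q 0) s N ux w - w) =ᶠ[𝓝 w] fun _ => 0 := by
    have e1 : ∀ᶠ w' : Plane in 𝓝 w, |w'.1| < 3 :=
      (isOpen_lt (continuous_abs.comp continuous_fst) continuous_const).mem_nhds
        (show |w.1| < 3 by linarith)
    have e2 : ∀ᶠ w' : Plane in 𝓝 w, |w'.2| < ρ :=
      (isOpen_lt (continuous_abs.comp continuous_snd) continuous_const).mem_nhds
        (show |w.2| < ρ by linarith)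
    filter_upwards [e1, e2] with w' b1 b2
    rw [hT.lift_zero hf.lam_pos b1.le b2.le, sub_self]
  have hall : ∀ᶠ p : ℝ × Plane in 𝓝 (0, w), ∀ i ∈ Finset.range (k + 1),
      ‖iteratedFDeriv ℝ i (fun w => lift (f p.1) (q p.1) s N ux w - w) p.2‖ < τ := by
    rw [Filter.eventually_all_finset]
    intro i hi
    have hc := (hfam.continuousAt i (by simpa [Nat.lt_succ_iff] using hi)).norm
    have h0 : ‖iteratedFDeriv ℝ i (fun w => lift (f 0) (q 0) s N ux w - w) w‖ < τ := by
      rw [(hzero.iteratedFDeriv ℝ i).self_of_nhds]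
      have : iteratedFDeriv ℝ i (fun _ : Plane => (0 : Plane)) w = 0 := by
        simp
      rw [this]; simpa using hτ
    exact hc.eventually (Iio_mem_nhds h0)
  filter_upwards [hfam.contDiffAt, hall] with p a1 a2
  exact ⟨a1, fun i hi => a2 i (Finset.mem_range.2 (by omega))⟩

/-- This is `trans_sub` after division by the frequency, which turns the translation by the
frequency into the unit translation. -/
theorem lift_sub_one {g : Plane → Plane} {q : ℝ → ℝ} {R : ℝ} (hg : IsNormalOn g q R)
    {w : Plane} (hw : InWindow g N R (ux + w.1 * deriv q w.2 - s w.2, w.2))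
    (hp : deriv q (lift g q s N ux w).2 ≠ 0) :
    lift g q s N ux (w.1 - 1, w.2) = ((lift g q s N ux w).1 - 1, (lift g q s N ux w).2) := by
  have := trans_sub hg hw
  have e : ux + (w.1 - 1) * deriv q w.2 - s w.2 = ux + w.1 * deriv q w.2 - s w.2 - deriv q w.2 := by
    ring
  unfold lift at hp ⊢
  simp only at hp this ⊢
  rw [e, this]
  ext
  · simp only; field_simp; ring
  · rfl

end Family

/-! ### The circle and the covering of the cylinder by the plane -/

section Circle

theorem circle_eq_iff {x y : ℝ} : (x : UnitAddCircle) = y ↔ ∃ n : ℤ, x - y = n := by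
  rw [← sub_eq_zero, ← AddCircle.coe_sub, AddCircle.coe_eq_zero_iff]
  simp [eq_comm]

/-- The representative in `[-1, 0[` of a point of the circle. -/
noncomputable def rep (θ : UnitAddCircle) : ℝ := (AddCircle.equivIco 1 (-1) θ : ℝ)

theorem coe_rep (θ : UnitAddCircle) : ((rep θ : ℝ) : UnitAddCircle) = θ := AddCircle.coe_equivIco

theorem rep_mem (θ : UnitAddCircle) : rep θ ∈ Ico (-1 : ℝ) 0 := by
  have := (AddCircle.equivIco 1 (-1) θ).2
  simpa [rep] using this

theorem proj_rep (w : Cyl) : proj (rep w.1, w.2) = w := Prod.ext (coe_rep w.1) rfl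

theorem proj_add_int (p : Plane) (n : ℤ) : proj (p.1 + n, p.2) = proj p := by
  refine Prod.ext ?_ rfl
  exact circle_eq_iff.2 ⟨n, by ring⟩

theorem proj_eq_iff {p p' : Plane} : proj p = proj p' ↔ ∃ n : ℤ, p = (p'.1 + n, p'.2) := by
  constructor
  · intro h
    obtain ⟨n, hn⟩ := circle_eq_iff.1 (congrArg Prod.fst h)
    exact ⟨n, Prod.ext (by simp only; linarith) (show p.2 = p'.2 from (Prod.mk.inj h).2)⟩
  · rintro ⟨n, rfl⟩
    exact proj_add_int p' n

theorem continuous_proj : Continuous proj :=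
  ((AddCircle.continuous_mk' 1).comp continuous_fst).prodMk continuous_snd

theorem isOpenMap_proj : IsOpenMap proj :=
  IsOpenMap.prodMap (QuotientAddGroup.isOpenMap_coe) IsOpenMap.id

end Circle

/-! ### From locally periodic functions on the plane to functions on the cylinder -/

section Periodize

variable {E : Type} {g : Plane → E} {r : ℝ}

/-- The function on the cylinder defined by the restriction of `g` to `[-1, 0[ × ℝ`. -/
noncomputable def periodize (g : Plane → E) (w : Cyl) : E := g (rep w.1, w.2)

/-- The function `g` is `1`-periodic in the first variable, as long as this variable is in
`[-5/2, 5/2]`. -/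
def IsLocallyPeriodic (g : Plane → E) (r : ℝ) : Prop :=
  ∀ s v : ℝ, |v| < r → |s| ≤ 5 / 2 → |s - 1| ≤ 5 / 2 → g (s - 1, v) = g (s, v)

theorem IsLocallyPeriodic.sub_nat (hg : IsLocallyPeriodic g r) {v : ℝ} (hv : |v| < r) (m : ℕ)
    {x : ℝ} (hx : |x| ≤ 5 / 2) (hxm : |x - m| ≤ 5 / 2) : g (x - m, v) = g (x, v) := by
  induction m with
  | zero => simp
  | succ m ih =>
    have h1 := abs_le.1 hx
    have h2 := abs_le.1 hxm
    push_cast at h2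
    have hm : (0 : ℝ) ≤ m := Nat.cast_nonneg m
    have h3 : |x - m| ≤ 5 / 2 := abs_le.2 ⟨by linarith, by linarith⟩
    rw [← ih h3, ← hg (x - m) v hv h3 (abs_le.2 ⟨by linarith, by linarith⟩)]
    push_cast; congr 2; ring

theorem IsLocallyPeriodic.eq_of_sub (hg : IsLocallyPeriodic g r) {v : ℝ} (hv : |v| < r) {x y : ℝ}
    {n : ℤ} (hx : |x| ≤ 5 / 2) (hy : |y| ≤ 5 / 2) (hn : x - y = n) : g (x, v) = g (y, v) := by
  rcases Int.eq_nat_or_neg n with ⟨m, rfl | rfl⟩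
  · have e : y = x - m := by push_cast at hn; linarith
    rw [e] at hy ⊢
    exact (hg.sub_nat hv m hx hy).symm
  · have e : x = y - m := by push_cast at hn; linarith
    rw [e] at hx ⊢
    exact hg.sub_nat hv m hy hx

theorem IsLocallyPeriodic.periodize_eq (hg : IsLocallyPeriodic g r) {p : Plane} (hp : |p.2| < r)
    {n : ℤ} (hn : |p.1 - n| ≤ 5 / 2) : periodize g (proj p) = g (p.1 - n, p.2) := by
  have h1 := rep_mem (proj p).1
  obtain ⟨m, hm⟩ := circle_eq_iff.1 (coe_rep (proj p).1)
  refine hg.eq_of_sub (n := m + n) hp (abs_le.2 ⟨by linarith [h1.1], by linarith [h1.2]⟩) hn ?_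
  push_cast; linarith

/-- Although `rep` jumps, near `p` the periodization is a single translate of `g`: the interval
`[-5/2, 5/2]` leaves room on both sides of `[-1, 0[`. Smoothness and derivative bounds follow. -/
theorem IsLocallyPeriodic.eventually_eq (hg : IsLocallyPeriodic g r) {p : Plane} (hp : |p.2| < r) :
    ∃ n : ℤ, |p.1 - n| ≤ 1 ∧
      (fun p' => periodize g (proj p')) =ᶠ[𝓝 p] fun p' => g (p' - ((n : ℝ), 0)) := by
  obtain ⟨n, hn⟩ := circle_eq_iff.1 (coe_rep (proj p).1)
  have h1 := rep_mem (proj p).1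
  refine ⟨-n, ?_, ?_⟩
  · push_cast
    rw [abs_le]
    constructor <;> linarith [h1.1, h1.2]
  · have e1 : ∀ᶠ p' : Plane in 𝓝 p, |p'.1 - ((-n : ℤ) : ℝ)| < 5 / 2 :=
      (isOpen_lt (by fun_prop) continuous_const).mem_nhds (by
        change |p.1 - ((-n : ℤ) : ℝ)| < 5 / 2
        push_cast
        rw [abs_lt]
        constructor <;> linarith [h1.1, h1.2])
    have e2 : ∀ᶠ p' : Plane in 𝓝 p, |p'.2| < r :=
      (isOpen_lt (by fun_prop) continuous_const).mem_nhds hp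
    filter_upwards [e1, e2] with p' a1 a2
    rw [hg.periodize_eq a2 a1.le]
    congr 1
    ext <;> simp

variable [NormedAddCommGroup E] [NormedSpace ℝ E]

theorem IsLocallyPeriodic.contDiffAt (hg : IsLocallyPeriodic g r) {n : WithTop ℕ∞}
    (hc : ∀ w : Plane, |w.1| ≤ 5 / 2 → |w.2| < r → ContDiffAt ℝ n g w) {p : Plane}
    (hp : |p.2| < r) : ContDiffAt ℝ n (fun p => periodize g (proj p)) p := by
  obtain ⟨m, hm, hev⟩ := hg.eventually_eq hp
  refine ContDiffAt.congr_of_eventuallyEq ?_ hev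
  refine ContDiffAt.comp p (hc _ ?_ ?_) (contDiffAt_id.sub contDiffAt_const)
  · simp only [Prod.fst_sub]; linarith
  · simpa using hp

theorem IsLocallyPeriodic.norm_iteratedFDeriv_le (hg : IsLocallyPeriodic g r) {i : ℕ} {C : ℝ}
    (hc : ∀ w : Plane, |w.1| ≤ 5 / 2 → |w.2| < r → ‖iteratedFDeriv ℝ i g w‖ ≤ C) {p : Plane}
    (hp : |p.2| < r) : ‖iteratedFDeriv ℝ i (fun p => periodize g (proj p)) p‖ ≤ C := by
  obtain ⟨m, hm, hev⟩ := hg.eventually_eq hp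
  rw [(hev.iteratedFDeriv ℝ i).self_of_nhds, iteratedFDeriv_comp_sub]
  refine hc _ ?_ ?_
  · simp only [Prod.fst_sub]; linarith
  · simpa using hp

end Periodize

/-! ### Perturbations of the identity on the cylinder -/

section Diffeo

/-- On the convex strip the lift is the identity plus a `1/2`-Lipschitz map, hence injective, and
its derivative is invertible by a Neumann series. As the lift commutes with integer translations,
injectivity passes to the cylinder. -/
theorem isCkDiffeoOn_of_small {k : ℕ} (hk : 1 ≤ k) {G : Cyl → Plane} {δ : ℝ}
    (hG : ∀ p : Plane, p.2 ∈ Ioo 0 δ → ContDiffAt ℝ k (fun p => G (proj p)) p)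
    (hd : ∀ p : Plane, p.2 ∈ Ioo 0 δ → ‖fderiv ℝ (fun p => G (proj p)) p‖ ≤ 1 / 2) :
    IsCkDiffeoOn k (fun w => (w.1 + ((G w).1 : UnitAddCircle), w.2 + (G w).2)) (annulus δ) := by
  set η : Cyl → Cyl := fun w => (w.1 + ((G w).1 : UnitAddCircle), w.2 + (G w).2) with hη
  set φ : Plane → Plane := fun p => p + G (proj p) with hφ
  set Ω : Set Plane := {p | p.2 ∈ Ioo 0 δ} with hΩ
  have hΩo : IsOpen Ω := isOpen_Ioo.preimage continuous_snd
  have hΩc : Convex ℝ Ω := (convex_Ioo 0 δ).linear_preimage (LinearMap.snd ℝ ℝ ℝ)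
  have hkk : (k : WithTop ℕ∞) ≠ 0 := by exact_mod_cast (by omega : k ≠ 0)
  have hηφ : ∀ p, η (proj p) = proj (φ p) := fun p => rfl
  have hper : ∀ p (n : ℤ), φ (p.1 + n, p.2) = ((φ p).1 + n, (φ p).2) := by
    intro p n
    simp only [hφ, proj_add_int]
    ext <;> simp; ring
  have hinj : InjOn φ Ω := by
    intro p hp p' hp' h
    have := hΩc.norm_image_sub_le_of_norm_fderiv_le (𝕜 := ℝ) (f := fun p => G (proj p))
      (fun x hx => (hG x hx).differentiableAt hkk) hd hp hp'
    have e : G (proj p') - G (proj p) = p - p' := by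
      simp only [hφ] at h
      linear_combination (exp := 1) -h
    rw [e, norm_sub_rev] at this
    have h0 : ‖p' - p‖ = 0 := by linarith [norm_nonneg (p' - p)]
    exact (sub_eq_zero.1 (norm_eq_zero.1 h0)).symm
  have hmem : ∀ p, proj p ∈ annulus δ ↔ p ∈ Ω := fun p => Iff.rfl
  have hinjη : InjOn η (annulus δ) := by
    intro w hw w' hw' h
    rw [← proj_rep w, ← proj_rep w', hηφ, hηφ] at h
    obtain ⟨n, hn⟩ := proj_eq_iff.1 h
    rw [← hper] at hn
    have := hinj (show ((rep w.1, w.2) : Plane) ∈ Ω from hw)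
      (show ((rep w'.1 + n, w'.2) : Plane) ∈ Ω from hw') hn
    rw [← proj_rep w, this]
    exact (proj_add_int (rep w'.1, w'.2) n).trans (proj_rep w')
  have hφc : ∀ p ∈ Ω, ContDiffAt ℝ k φ p := fun p hp => contDiffAt_id.add (hG p hp)
  have hφe : ∀ p ∈ Ω, ∃ L : Plane ≃L[ℝ] Plane, HasFDerivAt φ (L : Plane →L[ℝ] Plane) p := by
    intro p hp
    set A := fderiv ℝ (fun p => G (proj p)) p with hA
    have hlt : ‖-A‖ < 1 := by rw [norm_neg]; linarith [hd p hp]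
    refine ⟨ContinuousLinearEquiv.unitsEquiv ℝ Plane (Units.oneSub (-A) hlt), ?_⟩
    have h1 : HasFDerivAt φ (ContinuousLinearMap.id ℝ Plane + A) p :=
      (hasFDerivAt_id p).add ((hG p hp).differentiableAt hkk).hasFDerivAt
    convert! h1 using 1
    ext <;> simp
  have himg : η '' annulus δ = proj '' (φ '' Ω) := by
    ext w
    constructor
    · rintro ⟨w, hw, rfl⟩
      refine ⟨φ (rep w.1, w.2), ⟨_, hw, rfl⟩, ?_⟩
      rw [← hηφ, proj_rep]
    · rintro ⟨_, ⟨p, hp, rfl⟩, rfl⟩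
      exact ⟨proj p, hp, hηφ p⟩
  refine ⟨hinjη, ?_, ?_, Function.invFunOn η (annulus δ), hinjη.leftInvOn_invFunOn, ?_⟩
  · rw [himg]
    refine isOpenMap_proj _ ?_
    rw [isOpen_iff_mem_nhds]
    rintro _ ⟨p, hp, rfl⟩
    obtain ⟨L, hL⟩ := hφe p hp
    have hs : HasStrictFDerivAt φ (L : Plane →L[ℝ] Plane) p :=
      (hφc p hp).hasStrictFDerivAt' hL hkk
    rw [← hs.map_nhds_eq_of_equiv]
    exact image_mem_map (hΩo.mem_nhds hp)
  · intro p hp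
    exact ⟨φ, hφc p hp, Eventually.of_forall hηφ⟩
  · intro p' hp'
    rw [himg] at hp'
    obtain ⟨_, ⟨p₁, hp₁, rfl⟩, hpp⟩ := hp'
    obtain ⟨n, hn⟩ := proj_eq_iff.1 hpp.symm
    rw [← hper] at hn
    set p : Plane := (p₁.1 + n, p₁.2) with hpd
    have hp : p ∈ Ω := hp₁
    obtain ⟨L, hL⟩ := hφe p hp
    set ψ := (hφc p hp).localInverse hL hkk with hψ
    have hψc : ContDiffAt ℝ k ψ p' := by
      rw [hn]; exact (hφc p hp).to_localInverse hL hkk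
    have hψp : ψ p' = p := by rw [hn]; exact (hφc p hp).localInverse_apply_image hL hkk
    refine ⟨ψ, hψc, ?_⟩
    have hs : HasStrictFDerivAt φ (L : Plane →L[ℝ] Plane) p :=
      (hφc p hp).hasStrictFDerivAt' hL hkk
    have h1 : ∀ᶠ y in 𝓝 p', φ (ψ y) = y := by
      rw [hn]; exact hs.eventually_right_inverse
    have h2 : ∀ᶠ y in 𝓝 p', ψ y ∈ Ω :=
      hψc.continuousAt.eventually (hΩo.mem_nhds (by rw [hψp]; exact hp))
    filter_upwards [h1, h2] with y hy1 hy2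
    conv_lhs => rw [← hy1, ← hηφ]
    exact hinjη.leftInvOn_invFunOn ((hmem _).2 hy2)

end Diffeo

/-! ### Division by the second coordinate -/

section Hadamard

theorem exists_bound_of_isOpen {F : Type*} [NormedAddCommGroup F] {h : ℝ × Plane → F}
    {Ω : Set (ℝ × Plane)} {U : Set Plane} (hU : IsOpen U)
    (hsub : ∀ p ∈ U, ∀ t ∈ Icc (0 : ℝ) 1, (t, p) ∈ Ω) (hc : ContinuousOn h Ω) {p₀ : Plane}
    (hp₀ : p₀ ∈ U) :
    ∃ d > 0, ∃ C, Metric.closedBall p₀ d ⊆ U ∧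
      ∀ t ∈ Icc (0 : ℝ) 1, ∀ p ∈ Metric.closedBall p₀ d, ‖h (t, p)‖ ≤ C := by
  obtain ⟨d, hd, hdU⟩ := Metric.nhds_basis_closedBall.mem_iff.1 (hU.mem_nhds hp₀)
  have hK : IsCompact (Icc (0 : ℝ) 1 ×ˢ Metric.closedBall p₀ d) :=
    isCompact_Icc.prod (isCompact_closedBall p₀ d)
  obtain ⟨C, hC⟩ := hK.exists_bound_of_continuousOn
    (hc.mono fun x hx => hsub x.2 (hdU hx.2) x.1 hx.1)
  exact ⟨d, hd, C, hdU, fun t ht p hp => hC (t, p) ⟨ht, hp⟩⟩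

theorem continuousOn_slice {F : Type*} [NormedAddCommGroup F] {h : ℝ × Plane → F}
    {Ω : Set (ℝ × Plane)} {U : Set Plane}
    (hsub : ∀ p ∈ U, ∀ t ∈ Icc (0 : ℝ) 1, (t, p) ∈ Ω) (hc : ContinuousOn h Ω) {p : Plane}
    (hp : p ∈ U) : ContinuousOn (fun t => h (t, p)) (Icc 0 1) :=
  hc.comp (by fun_prop) fun t ht => hsub p hp t ht

/-- Smoothness of integrals with parameters. -/
theorem contDiffOn_integral {n : ℕ} {F : Type} [NormedAddCommGroup F] [NormedSpace ℝ F]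
    [CompleteSpace F] {h : ℝ × Plane → F} {Ω : Set (ℝ × Plane)} (hΩ : IsOpen Ω) {U : Set Plane}
    (hU : IsOpen U) (hsub : ∀ p ∈ U, ∀ t ∈ Icc (0 : ℝ) 1, (t, p) ∈ Ω) (hh : ContDiffOn ℝ n h Ω) :
    ContDiffOn ℝ n (fun p => ∫ t in (0 : ℝ)..1, h (t, p)) U := by
  have hI : uIoc (0 : ℝ) 1 ⊆ Icc 0 1 := by rw [uIoc_of_le zero_le_one]; exact Ioc_subset_Icc_self
  have hmeas : ∀ {F : Type} [NormedAddCommGroup F] {h : ℝ × Plane → F}, ContinuousOn h Ω →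
      ∀ p ∈ U, AEStronglyMeasurable (fun t => h (t, p)) (volume.restrict (uIoc (0 : ℝ) 1)) := by
    intro F _ h hc p hp
    exact ((continuousOn_slice hsub hc hp).mono hI).aestronglyMeasurable measurableSet_uIoc
  induction n generalizing F with
  | zero =>
    have hc := hh.continuousOn
    rw [Nat.cast_zero, contDiffOn_zero]
    intro p₀ hp₀
    obtain ⟨d, hd, C, hdU, hC⟩ := exists_bound_of_isOpen hU hsub hc hp₀
    refine ContinuousAt.continuousWithinAt ?_
    refine intervalIntegral.continuousAt_of_dominated_interval (bound := fun _ => C) ?_ ?_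
      intervalIntegrable_const ?_
    · filter_upwards [hU.mem_nhds hp₀] with p hp using hmeas hc p hp
    · filter_upwards [Metric.closedBall_mem_nhds p₀ hd] with p hp
      exact Eventually.of_forall fun t ht => hC t (hI ht) p hp
    · refine Eventually.of_forall fun t ht => ?_
      have h1 : ContinuousAt h (t, p₀) := hc.continuousAt (hΩ.mem_nhds (hsub p₀ hp₀ t (hI ht)))
      exact ContinuousAt.comp (f := fun p : Plane => (t, p)) (x := p₀) h1 (by fun_prop)
  | succ n ih =>
    have hc := hh.continuousOn
    have hh' := (contDiffOn_succ_iff_fderiv_of_isOpen (n := n) hΩ).1 (by exact_mod_cast hh)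
    set h' : ℝ × Plane → (Plane →L[ℝ] F) := fun x =>
      (fderiv ℝ h x).comp (ContinuousLinearMap.inr ℝ ℝ Plane) with hh'd
    have h'c : ContDiffOn ℝ n h' Ω := hh'.2.2.clm_comp contDiffOn_const
    -- Differentiation under the integral sign yields an integral of the same kind with one order of
    -- smoothness less, which allows the induction.
    have hder : ∀ p₀ ∈ U, HasFDerivAt (fun p => ∫ t in (0 : ℝ)..1, h (t, p))
        (∫ t in (0 : ℝ)..1, h' (t, p₀)) p₀ := by
      intro p₀ hp₀
      obtain ⟨d, hd, C, hdU, hC⟩ := exists_bound_of_isOpen hU hsub h'c.continuousOn hp₀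
      refine intervalIntegral.hasFDerivAt_integral_of_dominated_of_fderiv_le
        (F := fun p t => h (t, p)) (F' := fun p t => h' (t, p)) (bound := fun _ => C)
        (Metric.closedBall_mem_nhds p₀ hd) ?_ ?_ ?_ ?_ intervalIntegrable_const ?_
      · filter_upwards [hU.mem_nhds hp₀] with p hp using hmeas hc p hp
      · refine ContinuousOn.intervalIntegrable ?_
        rw [uIcc_of_le zero_le_one]
        exact continuousOn_slice hsub hc hp₀
      · exact hmeas h'c.continuousOn p₀ hp₀
      · exact Eventually.of_forall fun t ht p hp => hC t (hI ht) p hp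
      · refine Eventually.of_forall fun t ht p hp => ?_
        have h1 := (hh'.1.differentiableAt
          (hΩ.mem_nhds (hsub p (hdU hp) t (hI ht)))).hasFDerivAt
        have h2 : HasFDerivAt (fun p : Plane => (t, p)) (ContinuousLinearMap.inr ℝ ℝ Plane) p :=
          hasFDerivAt_prodMk_right t p
        exact h1.comp p h2
    have : ContDiffOn ℝ (n + 1) (fun p => ∫ t in (0 : ℝ)..1, h (t, p)) U := by
      rw [contDiffOn_succ_iff_fderiv_of_isOpen hU]
      refine ⟨fun p hp => (hder p hp).differentiableAt.differentiableWithinAt, by simp, ?_⟩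
      exact (ih h'c).congr fun p hp => (hder p hp).fderiv
    exact_mod_cast this

/-- The quotient of a function vanishing on the horizontal axis by the second coordinate. -/
noncomputable def hadamardQuot (D : Plane → ℝ) (p : Plane) : ℝ :=
  ∫ t in (0 : ℝ)..1, fderiv ℝ D (p.1, t * p.2) (0, 1)

theorem abs_mul_lt_of_mem {t v r : ℝ} (ht : t ∈ Icc (0 : ℝ) 1) (hv : |v| < r) : |t * v| < r := by
  rw [abs_mul, abs_of_nonneg ht.1]
  exact lt_of_le_of_lt (mul_le_of_le_one_left (abs_nonneg _) ht.2) hv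

theorem contDiffOn_hadamardQuot {D : Plane → ℝ} {r : ℝ} {n : ℕ}
    (hD : ContDiffOn ℝ (n + 1) D {p | |p.2| < r}) :
    ContDiffOn ℝ n (hadamardQuot D) {p | |p.2| < r} := by
  have hopen : IsOpen {p : Plane | |p.2| < r} := isOpen_lt (by fun_prop) continuous_const
  refine contDiffOn_integral (h := fun x : ℝ × Plane => fderiv ℝ D (x.2.1, x.1 * x.2.2) (0, 1))
    (Ω := {x | |x.1 * x.2.2| < r}) (isOpen_lt (by fun_prop) continuous_const) hopen
    (fun p hp t ht => abs_mul_lt_of_mem ht hp) ?_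
  have h1 := ((contDiffOn_succ_iff_fderiv_of_isOpen hopen).1 hD).2.2
  have h2 : ContDiffOn ℝ n (fun x : ℝ × Plane => fderiv ℝ D (x.2.1, x.1 * x.2.2))
      {x | |x.1 * x.2.2| < r} :=
    h1.comp (g := fderiv ℝ D) (f := fun x : ℝ × Plane => ((x.2.1, x.1 * x.2.2) : Plane))
      (by fun_prop) fun x hx => hx
  exact h2.clm_apply contDiffOn_const

/-- Fundamental theorem of calculus on the vertical segment from `(x, 0)` to `(x, y)`. -/
theorem mul_hadamardQuot {D : Plane → ℝ} {r : ℝ} (hD : ContDiffOn ℝ 1 D {p | |p.2| < r})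
    (h0 : ∀ x, D (x, 0) = 0) {p : Plane} (hp : |p.2| < r) : p.2 * hadamardQuot D p = D p := by
  have hopen : IsOpen {p : Plane | |p.2| < r} := isOpen_lt (by fun_prop) continuous_const
  have hmem : ∀ t ∈ Icc (0 : ℝ) 1, ((p.1, t * p.2) : Plane) ∈ {p : Plane | |p.2| < r} :=
    fun t ht => abs_mul_lt_of_mem ht hp
  have hder : ∀ t ∈ Icc (0 : ℝ) 1, HasDerivAt (fun t : ℝ => D (p.1, t * p.2))
      (p.2 * fderiv ℝ D (p.1, t * p.2) (0, 1)) t := by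
    intro t ht
    have h1 := ((hD.contDiffAt (hopen.mem_nhds (hmem t ht))).differentiableAt (by simp)).hasFDerivAt
    have h2 : HasDerivAt (fun t : ℝ => ((p.1, t * p.2) : Plane)) (0, p.2) t := by
      refine (hasDerivAt_const t p.1).prodMk ?_
      simpa using (hasDerivAt_id' t).mul_const p.2
    have h3 := HasFDerivAt.comp_hasDerivAt (l := D) (f := fun t : ℝ => ((p.1, t * p.2) : Plane)) t
      h1 h2
    have e : ((0, p.2) : Plane) = p.2 • ((0, 1) : Plane) := by ext <;> simp
    rw [e, map_smul, smul_eq_mul] at h3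
    exact h3
  have hc : ContinuousOn (fun t : ℝ => p.2 * fderiv ℝ D (p.1, t * p.2) (0, 1)) (Icc 0 1) := by
    have h1 : ContinuousOn (fderiv ℝ D) {p | |p.2| < r} :=
      hD.continuousOn_fderiv_of_isOpen hopen (by simp)
    have h2 : ContinuousOn (fun t : ℝ => fderiv ℝ D (p.1, t * p.2)) (Icc 0 1) :=
      h1.comp (f := fun t : ℝ => ((p.1, t * p.2) : Plane)) (by fun_prop) hmem
    exact continuousOn_const.mul (h2.clm_apply continuousOn_const)
  have := intervalIntegral.integral_eq_sub_of_hasDerivAt (a := 0) (b := 1)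
    (f := fun t : ℝ => D (p.1, t * p.2)) (f' := fun t => p.2 * fderiv ℝ D (p.1, t * p.2) (0, 1))
    (by rw [uIcc_of_le zero_le_one]; exact hder)
    (ContinuousOn.intervalIntegrable (by rwa [uIcc_of_le zero_le_one]))
  rw [intervalIntegral.integral_const_mul] at this
  simpa [h0, hadamardQuot] using this

end Hadamard

/-! ### First return to the fundamental domain -/

section ReturnMap

/-- The estimates on a single map `g` near its separatrix which are needed to study the first return
in the fundamental domain. -/
structure IsReturn (g : Plane → Plane) (q : ℝ → ℝ) (s : ℝ → ℝ) (N : ℕ)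
    (lam R ρ ub xs ys δ : ℝ) : Prop where
  lam_pos : 0 < lam
  normal : IsNormalOn g q R
  xs_pos : 0 < xs
  xs_lt : xs < R
  ub_lt : Real.exp (-ub) * Real.exp (4 * lam) < R
  freq : ∀ v, |v| ≤ ρ → 3 * lam / 4 < deriv q v ∧ deriv q v < 5 * lam / 4
  s_near : ∀ v, |v| ≤ ρ → |s v - (Real.log xs - ub)| ≤ lam / 4
  window : ∀ v, |v| ≤ ρ → ∀ u ∈ Icc (ub - 4 * lam) (ub + 4 * lam), InWindow g N R (u, v)
  lift_fst : ∀ w : Plane, |w.1| ≤ 5 / 2 → |w.2| < ρ / 2 →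
    |(lift g q s N (Real.log xs) w).1 - w.1| ≤ 1 / 2
  lift_snd : ∀ w : Plane, |w.1| ≤ 5 / 2 → 0 < w.2 → w.2 < ρ / 2 →
    0 < (lift g q s N (Real.log xs) w).2 ∧ (lift g q s N (Real.log xs) w).2 < 2 * w.2
  ys_pos : 0 < ys
  c_lt : xs * ys < ρ / 2
  ys_lt : ys * Real.exp ((N + 1) * (5 * lam / 4)) < R
  δ_le : δ ≤ xs * ys / 2
  δ_le_exp : δ ≤ Real.exp (Real.log xs - ub - 8 * lam)

variable {g : Plane → Plane} {q s : ℝ → ℝ} {N : ℕ} {lam R ρ ub xs ys δ : ℝ}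

namespace IsReturn

theorem abs_le (h : IsReturn g q s N lam R ρ ub xs ys δ) {v : ℝ} (hv : v ∈ Ioo 0 (xs * ys)) :
    |v| ≤ ρ := by
  rw [abs_of_pos hv.1]
  have := h.c_lt
  have := hv.1
  linarith [hv.2]

theorem deriv_pos (h : IsReturn g q s N lam R ρ ub xs ys δ) {v : ℝ} (hv : v ∈ Ioo 0 (xs * ys)) :
    0 < deriv q v := by
  linarith [(h.freq v (h.abs_le hv)).1, h.lam_pos]

theorem apply_segment (h : IsReturn g q s N lam R ρ ub xs ys δ) {v : ℝ}
    (hv : v ∈ Ioo 0 (xs * ys)) : (g (xs, v / xs)).1 = xs * Real.exp (-deriv q v) := by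
  have hx := h.xs_pos
  have h1 : |v / xs| < R := by
    rw [abs_of_pos (div_pos hv.1 hx), div_lt_iff₀ hx]
    have h2 : ys ≤ ys * Real.exp ((N + 1) * (5 * lam / 4)) := by
      refine le_mul_of_one_le_right h.ys_pos.le (Real.one_le_exp ?_)
      have := h.lam_pos
      positivity
    have := hv.2
    nlinarith [h.ys_lt]
  have h3 : xs * (v / xs) = v := by field_simp
  rw [h.normal (xs, v / xs) (by rw [abs_of_pos hx]; exact h.xs_lt) h1]
  simp only [h3]

/-- In the normalized coordinates the domain is `]-1, 0] × ]0, c[`: the segment `L` is `t = 0`, and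
its image, which is excluded, is `t = -1`. -/
theorem mem_fundDomain_iff (h : IsReturn g q s N lam R ρ ub xs ys δ) {z : Plane} :
    z ∈ fundDomain g xs ys ↔ ∃ t ∈ Ioc (-1 : ℝ) 0, ∃ v ∈ Ioo 0 (xs * ys),
      z = chi (Real.log xs + t * deriv q v, v) := by
  have hx := h.xs_pos
  constructor
  · rintro ⟨h1, h2, h3, h4, h5⟩
    have hv : z.1 * z.2 ∈ Ioo 0 (xs * ys) := ⟨h2, h3⟩
    have hp := h.deriv_pos hv
    rw [h.apply_segment hv] at h4
    refine ⟨(Real.log z.1 - Real.log xs) / deriv q (z.1 * z.2), ⟨?_, ?_⟩, z.1 * z.2, hv, ?_⟩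
    · rw [lt_div_iff₀ hp]
      have := Real.log_lt_log (by positivity) h4
      rw [Real.log_mul hx.ne' (Real.exp_pos _).ne', Real.log_exp] at this
      linarith
    · refine div_nonpos_of_nonpos_of_nonneg ?_ hp.le
      linarith [Real.log_le_log h1 h5]
    · rw [div_mul_cancel₀ _ hp.ne', add_sub_cancel]
      exact (chi_xi1 h1).symm
  · rintro ⟨t, ht, v, hv, rfl⟩
    have hp := h.deriv_pos hv
    refine ⟨Real.exp_pos _, by rw [chi_mul]; exact hv.1, by rw [chi_mul]; exact hv.2, ?_, ?_⟩
    · rw [chi_mul, h.apply_segment hv]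
      simp only [chi, Real.exp_add, Real.exp_log hx]
      refine mul_lt_mul_of_pos_left (Real.exp_lt_exp.2 ?_) hx
      nlinarith [ht.1]
    · simp only [chi, Real.exp_add, Real.exp_log hx]
      refine mul_le_of_le_one_right hx.le (Real.exp_le_one_iff.2 ?_)
      nlinarith [ht.2]

theorem chi_injective {w w' : Plane} (h : chi w = chi w') : w = w' := by
  rw [← xi1_chi w, h, xi1_chi]

theorem normalize_chi {t v : ℝ} (hp : deriv q v ≠ 0) :
    normalize q xs (chi (Real.log xs + t * deriv q v, v)) = (t, v) := by
  unfold normalize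
  rw [xi1_chi]
  ext
  · simp only; field_simp; ring
  · rfl

theorem chi_mem_iff (h : IsReturn g q s N lam R ρ ub xs ys δ) {t v : ℝ}
    (hv : v ∈ Ioo 0 (xs * ys)) :
    chi (Real.log xs + t * deriv q v, v) ∈ fundDomain g xs ys ↔ t ∈ Ioc (-1 : ℝ) 0 := by
  rw [h.mem_fundDomain_iff]
  refine ⟨?_, fun ht => ⟨t, ht, v, hv, rfl⟩⟩
  rintro ⟨t', ht', v', hv', e⟩
  have e := chi_injective e
  simp only [Prod.mk.injEq] at e
  obtain ⟨e1, rfl⟩ := e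
  have hp := h.deriv_pos hv
  have : t = t' := by
    have : t * deriv q v = t' * deriv q v := by linarith
    exact mul_right_cancel₀ hp.ne' this
  rwa [this]

theorem exists_coe_eq (θ : UnitAddCircle) : ∃ t ∈ Ioc (-1 : ℝ) 0, (t : UnitAddCircle) = θ := by
  have h1 := rep_mem θ
  rcases eq_or_lt_of_le h1.1 with h | h
  · refine ⟨0, by norm_num, ?_⟩
    rw [← coe_rep θ, ← h]
    exact circle_eq_iff.2 ⟨1, by norm_num⟩
  · exact ⟨rep θ, ⟨h, h1.2.le⟩, coe_rep θ⟩

theorem eq_of_coe_eq {t t' : ℝ} (ht : t ∈ Ioc (-1 : ℝ) 0) (ht' : t' ∈ Ioc (-1 : ℝ) 0)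
    (h : (t : UnitAddCircle) = t') : t = t' := by
  obtain ⟨n, hn⟩ := circle_eq_iff.1 h
  have h1 : (-1 : ℝ) < n := by linarith [ht.1, ht'.2]
  have h2 : (n : ℝ) < 1 := by linarith [ht.2, ht'.1]
  have h3 : n = 0 := by
    have : -1 < n := by exact_mod_cast h1
    have : n < 1 := by exact_mod_cast h2
    omega
  rw [h3] at hn
  push_cast at hn; linarith

theorem bijOn (h : IsReturn g q s N lam R ρ ub xs ys δ) :
    BijOn (fun z => proj (normalize q xs z)) (fundDomain g xs ys) (annulus (xs * ys)) := by
  refine ⟨?_, ?_, ?_⟩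
  · intro z hz
    obtain ⟨t, ht, v, hv, rfl⟩ := h.mem_fundDomain_iff.1 hz
    simp only [normalize_chi (h.deriv_pos hv).ne']
    exact hv
  · intro z hz z' hz' he
    obtain ⟨t, ht, v, hv, rfl⟩ := h.mem_fundDomain_iff.1 hz
    obtain ⟨t', ht', v', hv', rfl⟩ := h.mem_fundDomain_iff.1 hz'
    simp only [normalize_chi (h.deriv_pos hv).ne', normalize_chi (h.deriv_pos hv').ne', proj,
      Prod.mk.injEq] at he
    obtain ⟨he, rfl⟩ := he
    rw [eq_of_coe_eq ht ht' he]
  · rintro ⟨θ, v⟩ hv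
    obtain ⟨t, ht, rfl⟩ := exists_coe_eq θ
    have hv' : v ∈ Ioo 0 (xs * ys) := hv
    refine ⟨chi (Real.log xs + t * deriv q v, v), (h.chi_mem_iff hv').2 ht, ?_⟩
    simp only [normalize_chi (h.deriv_pos hv').ne']
    rfl

theorem iterate_chi (h : IsReturn g q s N lam R ρ ub xs ys δ) {t v : ℝ} {n : ℕ}
    (hv : v ∈ Ioo 0 (xs * ys)) (ht : t ≤ 0)
    (hR : (chi (Real.log xs + t * deriv q v, v)).2 * Real.exp (n * deriv q v) < R) :
    g^[n] (chi (Real.log xs + t * deriv q v, v)) =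
      chi (Real.log xs + (t - n) * deriv q v, v) := by
  have hp := h.deriv_pos hv
  have hc := chi_mul (Real.log xs + t * deriv q v, v)
  have h1 : (chi (Real.log xs + t * deriv q v, v)).1 < R := by
    refine lt_of_le_of_lt ?_ h.xs_lt
    simp only [chi, Real.exp_add, Real.exp_log h.xs_pos]
    exact mul_le_of_le_one_right h.xs_pos.le (Real.exp_le_one_iff.2 (by nlinarith))
  have h0 : 0 < (chi (Real.log xs + t * deriv q v, v)).1 := Real.exp_pos _
  have h0' : 0 < (chi (Real.log xs + t * deriv q v, v)).2 := mul_pos hv.1 (Real.exp_pos _)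
  rw [h.normal.iterate (by rw [hc]; exact hp.le) (by rwa [abs_of_pos h0])
    (by rw [hc, abs_of_pos h0']; exact hR), hc]
  ext
  · simp only [chi, ← Real.exp_add]; congr 1; ring
  · simp only [chi, mul_assoc, ← Real.exp_add]; congr 2; ring

/-- As long as the orbit is in the box each step lowers `t` by `1`, so it cannot be in `]-1, 0]`
again. -/
theorem iterate_not_mem (h : IsReturn g q s N lam R ρ ub xs ys δ) {t v : ℝ} {n : ℕ} (hn : 1 ≤ n)
    (hv : v ∈ Ioo 0 (xs * ys)) (ht : t ≤ 0)
    (hR : (chi (Real.log xs + t * deriv q v, v)).2 * Real.exp (n * deriv q v) < R) :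
    g^[n] (chi (Real.log xs + t * deriv q v, v)) ∉ fundDomain g xs ys := by
  rw [h.iterate_chi hv ht hR, h.chi_mem_iff hv]
  intro h1
  have : (1 : ℝ) ≤ n := by exact_mod_cast hn
  linarith [h1.1]

theorem arg_mem (h : IsReturn g q s N lam R ρ ub xs ys δ) {t v : ℝ} (ht : |t| ≤ 5 / 2)
    (hv : |v| ≤ ρ) :
    Real.log xs + t * deriv q v - s v ∈ Icc (ub - 4 * lam) (ub + 4 * lam) := by
  have a1 := _root_.abs_le.1 (h.s_near _ hv)
  obtain ⟨a2, a3⟩ := h.freq v hv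
  have hl := h.lam_pos
  have a4 : |t * deriv q v| ≤ 5 / 2 * (5 * lam / 4) := by
    rw [abs_mul, abs_of_pos (show 0 < deriv q v by linarith)]
    exact mul_le_mul ht a3.le (by linarith) (by norm_num)
  have a5 := _root_.abs_le.1 a4
  constructor <;> linarith

theorem iterate_theta (h : IsReturn g q s N lam R ρ ub xs ys δ) {w : Plane} (h1 : |w.1| ≤ 5 / 2)
    (h2 : 0 < w.2) (h3 : w.2 < ρ / 2) :
    g^[N] (theta (Real.log xs + w.1 * deriv q w.2 - s w.2, w.2)) =
      chi (Real.log xs + (lift g q s N (Real.log xs) w).1 *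
        deriv q (lift g q s N (Real.log xs) w).2, (lift g q s N (Real.log xs) w).2) := by
  have hw := h.window w.2 (by rw [abs_of_pos h2]; linarith) _
    (h.arg_mem h1 (by rw [abs_of_pos h2]; linarith))
  have hL := h.lift_snd w h1 h2 h3
  have hp := (h.freq (lift g q s N (Real.log xs) w).2 (by rw [abs_of_pos hL.1]; linarith)).1
  rw [← chi_xi1 hw.2.2]
  change chi (trans g N _) = _
  have hp0 : deriv q (lift g q s N (Real.log xs) w).2 ≠ 0 := by linarith [h.lam_pos]
  unfold lift at hp0 ⊢
  simp only at hp0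
  simp only [div_mul_cancel₀ _ hp0, add_sub_cancel]

theorem lift_sub (h : IsReturn g q s N lam R ρ ub xs ys δ) {w : Plane} (h1 : |w.1| ≤ 5 / 2)
    (h2 : 0 < w.2) (h3 : w.2 < ρ / 2) :
    lift g q s N (Real.log xs) (w.1 - 1, w.2) =
      ((lift g q s N (Real.log xs) w).1 - 1, (lift g q s N (Real.log xs) w).2) := by
  have hL := h.lift_snd w h1 h2 h3
  refine lift_sub_one h.normal (h.window w.2 (by rw [abs_of_pos h2]; linarith) _
    (h.arg_mem h1 (by rw [abs_of_pos h2]; linarith))) ?_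
  have hp := (h.freq (lift g q s N (Real.log xs) w).2 (by rw [abs_of_pos hL.1]; linarith)).1
  linarith [h.lam_pos]

/-- The two charts differ by the shift `ln v`, which is the origin of the term `-ln y / q'` of `l`.
-/
theorem theta_eq_chi {u v : ℝ} (hv : 0 < v) : theta (u, v) = chi (u + Real.log v, v) := by
  ext
  · simp [theta, chi, Real.exp_add, Real.exp_log hv, mul_comm]
  · simp only [theta, chi, neg_add, Real.exp_add, Real.exp_neg (Real.log v), Real.exp_log hv]
    field_simp

/-- The first return in the fundamental domain. -/
theorem exists_isLeast (h : IsReturn g q s N lam R ρ ub xs ys δ) {t v : ℝ}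
    (ht : t ∈ Ioc (-1 : ℝ) 0) (hv : v ∈ Ioo 0 δ) :
    ∃ j : ℕ, IsLeast (returnSet g N (fundDomain g xs ys) (chi (Real.log xs + t * deriv q v, v))) j ∧
      |t + (s v / deriv q v - Real.log v / deriv q v) - j| ≤ 5 / 2 ∧
      (lift g q s N (Real.log xs)
        (t + (s v / deriv q v - Real.log v / deriv q v) - j, v)).1 ∈ Ioc (-1 : ℝ) 0 ∧
      (lift g q s N (Real.log xs)
        (t + (s v / deriv q v - Real.log v / deriv q v) - j, v)).2 ∈ Ioo 0 (xs * ys) ∧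
      g^[N + j] (chi (Real.log xs + t * deriv q v, v)) =
        chi (Real.log xs + (lift g q s N (Real.log xs)
          (t + (s v / deriv q v - Real.log v / deriv q v) - j, v)).1 *
          deriv q (lift g q s N (Real.log xs)
          (t + (s v / deriv q v - Real.log v / deriv q v) - j, v)).2,
          (lift g q s N (Real.log xs)
          (t + (s v / deriv q v - Real.log v / deriv q v) - j, v)).2) := by
  have hl := h.lam_pos
  have hδ := h.δ_le
  have hc := h.c_lt
  have hxy : 0 < xs * ys := mul_pos h.xs_pos h.ys_pos
  have hv1 : v ∈ Ioo 0 (xs * ys) := ⟨hv.1, by linarith [hv.2]⟩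
  have hv2 : v < ρ / 2 := by linarith [hv1.2]
  have hp := h.deriv_pos hv1
  obtain ⟨hp1, hp2⟩ := h.freq v (h.abs_le hv1)
  have hs := _root_.abs_le.1 (h.s_near v (h.abs_le hv1))
  set p := deriv q v with hpd
  -- `St = t + l(v)`; after `j` steps near the origin the argument to be given to `lift` is `St -
  -- j`.
  set St := t + (s v / p - Real.log v / p) with hSt
  have hSp : St * p = t * p + (s v - Real.log v) := by rw [hSt]; field_simp
  have hlog : Real.log v ≤ Real.log xs - ub - 8 * lam := by
    rw [← Real.log_exp (Real.log xs - ub - 8 * lam)]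
    exact Real.log_le_log hv.1 (hv.2.le.trans h.δ_le_exp)
  -- The exponential bound on `δ` forces a long passage near the origin, so that every candidate for
  -- `j` below is at least `1`.
  have hS4 : 4 ≤ St := by
    by_contra! hcon
    have : St * p < 4 * p := mul_lt_mul_of_pos_right hcon hp
    rw [hSp] at this
    nlinarith [ht.1]
  -- the image of the orbit in the coordinates at the unstable axis
  have hsize : ∀ n : ℕ, -(5 / 2) ≤ St - n →
      (chi (Real.log xs + t * p, v)).2 * Real.exp (n * p) < R := by
    intro n hn
    have e : (chi (Real.log xs + t * p, v)).2 * Real.exp (n * p) =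
        Real.exp (-(Real.log xs + (St - n) * p - s v)) := by
      have e0 : -(Real.log xs + (St - n) * p - s v) =
          Real.log v + -(Real.log xs + t * p) + n * p := by rw [sub_mul, hSp]; ring
      rw [e0, Real.exp_add, Real.exp_add, Real.exp_log hv.1]
      rfl
    rw [e]
    refine lt_of_le_of_lt ?_ h.ub_lt
    rw [← Real.exp_add, Real.exp_le_exp]
    have : -(5 / 2) * p ≤ (St - n) * p := mul_le_mul_of_nonneg_right hn hp.le
    nlinarith
  have hiter : ∀ n : ℕ, -(5 / 2) ≤ St - n → g^[n] (chi (Real.log xs + t * p, v)) =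
      theta (Real.log xs + (St - n) * p - s v, v) := by
    intro n hn
    rw [h.iterate_chi hv1 ht.2 (hsize n hn), theta_eq_chi hv.1]
    congr 2
    rw [← hpd]
    linear_combination -hSp
  set L : ℕ → Plane := fun j => lift g q s N (Real.log xs) (St - j, v) with hL
  have hret : ∀ j : ℕ, |St - j| ≤ 5 / 2 → g^[N + j] (chi (Real.log xs + t * p, v)) =
      chi (Real.log xs + (L j).1 * deriv q (L j).2, (L j).2) := by
    intro j hj
    rw [Function.iterate_add_apply, hiter j (_root_.abs_le.1 hj).1]
    exact h.iterate_theta (w := (St - j, v)) hj hv.1 hv2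
  have hLsnd : ∀ j : ℕ, |St - j| ≤ 5 / 2 → (L j).2 ∈ Ioo 0 (xs * ys) := by
    intro j hj
    have := h.lift_snd (St - j, v) hj hv.1 hv2
    exact ⟨this.1, by have := this.2; simp only at this; linarith [hv.2]⟩
  -- the minimality of the return time
  have hmin : ∀ j : ℕ, |St - j| ≤ 5 / 2 → (L j).1 ∈ Ioc (-1 : ℝ) 0 →
      ∀ i ∈ returnSet g N (fundDomain g xs ys) (chi (Real.log xs + t * p, v)), j ≤ i := by
    rintro j hj hLj i ⟨hi1, hi2⟩
    by_contra! hij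
    rw [← Function.iterate_add_apply] at hi2
    -- An earlier return either happens while the orbit is still in the box, or gives a point of the
    -- domain that comes back to it after `m = j - i < N` steps. Both contradict `iterate_not_mem`.
    rcases le_or_gt (N + i) j with hle | hgt
    · refine h.iterate_not_mem (by omega) hv1 ht.2 (hsize (N + i) ?_) hi2
      have := (_root_.abs_le.1 hj).1
      have h5 : ((N + i : ℕ) : ℝ) ≤ j := by exact_mod_cast hle
      linarith
    · obtain ⟨t', ht', v', hv', e⟩ := h.mem_fundDomain_iff.1 hi2
      obtain ⟨m, rfl⟩ : ∃ m, j = m + i := ⟨j - i, by omega⟩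
      have hD : g^[N + (m + i)] (chi (Real.log xs + t * p, v)) ∈ fundDomain g xs ys := by
        rw [hret _ hj]; exact (h.chi_mem_iff (hLsnd _ hj)).2 hLj
      rw [show N + (m + i) = m + (N + i) by ring, Function.iterate_add_apply, e] at hD
      refine h.iterate_not_mem (by omega) hv' ht'.2 ?_ hD
      have hp' := h.deriv_pos hv'
      obtain ⟨_, hp2'⟩ := h.freq v' (h.abs_le hv')
      have e1 : (chi (Real.log xs + t' * deriv q v', v')).2 * Real.exp (m * deriv q v') =
          v' / xs * Real.exp ((m - t') * deriv q v') := by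
        rw [show (m - t') * deriv q v' = -(t' * deriv q v') + m * deriv q v' by ring]
        simp only [chi, neg_add, Real.exp_add, Real.exp_neg (Real.log xs), Real.exp_log h.xs_pos]
        ring
      rw [e1]
      -- Here `m - t' ≤ N + 1` and the frequency is below `5 lam / 4`, whence the exponent in
      -- `ys_lt`.
      refine lt_of_le_of_lt ?_ h.ys_lt
      refine mul_le_mul ?_ ?_ (Real.exp_pos _).le h.ys_pos.le
      · rw [div_le_iff₀ h.xs_pos]; linarith [hv'.2]
      · rw [Real.exp_le_exp]
        have hmN : (m : ℝ) ≤ N := by exact_mod_cast (by omega : m ≤ N)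
        have hm0 : (0 : ℝ) ≤ m := Nat.cast_nonneg m
        exact mul_le_mul (by linarith [ht'.1]) hp2'.le hp'.le (by positivity)
  have hgoal : ∃ j : ℕ, 1 ≤ j ∧ |St - j| ≤ 5 / 2 ∧ (L j).1 ∈ Ioc (-1 : ℝ) 0 := by
    -- With this `j`, `St - j` is in `]-1, 0]`. The map `lift` moves the first coordinate by at most
    -- `1/2` and commutes with the unit translation, so one of `j - 1`, `j`, `j + 1` brings the
    -- image into `]-1, 0]`.
    set j := ⌈St⌉₊ with hj
    have hj1 : St ≤ j := Nat.le_ceil St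
    have hj2 : (j : ℝ) < St + 1 := Nat.ceil_lt_add_one (by linarith)
    have hj4 : 4 ≤ j := by exact_mod_cast hS4.trans hj1
    have hjabs : |St - j| ≤ 5 / 2 := _root_.abs_le.2 ⟨by linarith, by linarith⟩
    have hLj := _root_.abs_le.1 (h.lift_fst (St - j, v) hjabs (by rwa [abs_of_pos hv.1]))
    simp only at hLj
    change -(1 / 2) ≤ (L j).1 - (St - j) ∧ (L j).1 - (St - j) ≤ 1 / 2 at hLj
    rcases le_or_gt (L j).1 (-1) with h1 | h1
    · have hc1 : ((j - 1 : ℕ) : ℝ) = j - 1 := by push_cast [Nat.cast_sub (by omega : 1 ≤ j)]; ring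
      have habs : |St - (j - 1 : ℕ)| ≤ 5 / 2 := by
        rw [hc1]; exact _root_.abs_le.2 ⟨by linarith, by linarith⟩
      have := h.lift_sub (w := (St - (j - 1 : ℕ), v)) habs hv.1 hv2
      simp only at this
      have e : St - ((j - 1 : ℕ) : ℝ) - 1 = St - j := by rw [hc1]; ring
      rw [e] at this
      have e2 : (L j).1 = (L (j - 1)).1 - 1 := by simp only [hL]; rw [this]
      exact ⟨j - 1, by omega, habs, by linarith, by linarith⟩
    · rcases le_or_gt (L j).1 0 with h2 | h2
      · exact ⟨j, by omega, hjabs, h1, h2⟩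
      · have habs : |St - (j + 1 : ℕ)| ≤ 5 / 2 := by
          push_cast; exact _root_.abs_le.2 ⟨by linarith, by linarith⟩
        have := h.lift_sub (w := (St - j, v)) hjabs hv.1 hv2
        simp only at this
        have e : St - (j : ℝ) - 1 = St - (j + 1 : ℕ) := by push_cast; ring
        rw [e] at this
        have e2 : (L (j + 1)).1 = (L j).1 - 1 := by simp only [hL]; rw [this]
        exact ⟨j + 1, by omega, habs, by linarith, by linarith⟩
  obtain ⟨j, hj1, hj2, hj3⟩ := hgoal
  refine ⟨j, ⟨⟨hj1, ?_⟩, fun i hi => hmin j hj2 hj3 i hi⟩, hj2, hj3, hLsnd j hj2, hret j hj2⟩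
  rw [← Function.iterate_add_apply, hret j hj2]
  exact (h.chi_mem_iff (hLsnd j hj2)).2 hj3

end IsReturn

/-- The displacement of the map of the cylinder whose lift is `lift g q s N (log xs)`. -/
noncomputable def displacement (g : Plane → Plane) (q s : ℝ → ℝ) (N : ℕ) (xs : ℝ) : Cyl → Plane :=
  periodize fun w => lift g q s N (Real.log xs) w - w

theorem isLocallyPeriodic_lift_sub (hn : IsNormalOn g q R)
    (hw : ∀ w : Plane, |w.1| ≤ 5 / 2 → |w.2| < ρ / 2 →
      InWindow g N R (Real.log xs + w.1 * deriv q w.2 - s w.2, w.2))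
    (hp : ∀ w : Plane, |w.1| ≤ 5 / 2 → |w.2| < ρ / 2 →
      deriv q (lift g q s N (Real.log xs) w).2 ≠ 0) :
    IsLocallyPeriodic (fun w => lift g q s N (Real.log xs) w - w) (ρ / 2) := by
  intro x v hv hx _
  have := lift_sub_one hn (w := (x, v)) (hw (x, v) hx hv) (hp (x, v) hx hv)
  simp only at this ⊢
  rw [this]
  ext <;> simp

/-- `(St, v)` and `(St - j, v)` are the same point of the cylinder, so the formula does not see the
return time `j`, and its jumps do not affect the smoothness of `η`. -/
theorem IsReturn.renorm_eq (h : IsReturn g q s N lam R ρ ub xs ys δ)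
    (hper : IsLocallyPeriodic (fun w => lift g q s N (Real.log xs) w - w) (ρ / 2)) {w : Cyl}
    (hw : w ∈ annulus δ) :
    (returnSet g N (fundDomain g xs ys)
      (Function.invFunOn (fun z => proj (normalize q xs z)) (fundDomain g xs ys) w)).Nonempty ∧
    renorm g q N xs ys w ∈ annulus (xs * ys) ∧
    firstReturn g N (fundDomain g xs ys)
      (Function.invFunOn (fun z => proj (normalize q xs z)) (fundDomain g xs ys) w) ∈
        fundDomain g xs ys ∧
    renorm g q N xs ys w = (fun w : Cyl =>
      (w.1 + ((displacement g q s N xs w).1 : UnitAddCircle), w.2 + (displacement g q s N xs w).2))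
      (cylTwist (fun y =>
            ((s y / deriv q y - Real.log y / deriv q y : ℝ) : UnitAddCircle)) w) := by
  have hxy : 0 < xs * ys := mul_pos h.xs_pos h.ys_pos
  obtain ⟨t, ht, hθ⟩ := exists_coe_eq w.1
  set v := w.2 with hvd
  have hv : v ∈ Ioo 0 δ := hw
  have hv1 : v ∈ Ioo 0 (xs * ys) := ⟨hv.1, by linarith [hv.2, h.δ_le]⟩
  have hp := h.deriv_pos hv1
  have hwe : w = proj (t, v) := Prod.ext hθ.symm rfl
  set z := chi (Real.log xs + t * deriv q v, v) with hz
  have hzD : z ∈ fundDomain g xs ys := (h.chi_mem_iff hv1).2 ht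
  have hψz : (fun z => proj (normalize q xs z)) z = w := by
    simp only [hz, normalize_chi hp.ne', hwe]
  have hinv : Function.invFunOn (fun z => proj (normalize q xs z)) (fundDomain g xs ys) w = z := by
    rw [← hψz]; exact h.bijOn.injOn.leftInvOn_invFunOn hzD
  obtain ⟨j, hleast, hj, hL1, hL2, heq⟩ := h.exists_isLeast ht hv
  have hsInf : sInf (returnSet g N (fundDomain g xs ys) z) = j := hleast.csInf_eq
  set St := t + (s v / deriv q v - Real.log v / deriv q v) with hSt
  have hfr : firstReturn g N (fundDomain g xs ys) z = chi (Real.log xs +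
      (lift g q s N (Real.log xs) (St - j, v)).1 *
        deriv q (lift g q s N (Real.log xs) (St - j, v)).2,
      (lift g q s N (Real.log xs) (St - j, v)).2) := by
    rw [firstReturn, hsInf]; exact heq
  have hren : renorm g q N xs ys w = proj (lift g q s N (Real.log xs) (St - j, v)) := by
    rw [renorm, hinv, hfr, normalize_chi (h.deriv_pos hL2).ne']
  refine ⟨?_, ?_, ?_, ?_⟩
  · rw [hinv]; exact ⟨j, hleast.1⟩
  · rw [hren]; exact hL2
  · rw [hinv, hfr]; exact (h.chi_mem_iff hL2).2 hL1
  · have htw : cylTwist (fun y =>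
            ((s y / deriv q y - Real.log y / deriv q y : ℝ) : UnitAddCircle)) w = proj (St, v) := by
      rw [hwe]
      rfl
    have hvρ : |v| < ρ / 2 := by rw [abs_of_pos hv.1]; linarith [hv1.2, h.c_lt]
    have hdis : displacement g q s N xs (proj (St, v)) =
        lift g q s N (Real.log xs) (St - j, v) - (St - j, v) := by
      have := hper.periodize_eq (p := (St, v)) (n := j) hvρ (by simpa using hj)
      simpa [displacement] using this
    rw [hren, htw]
    simp only [hdis]
    refine Prod.ext ?_ ?_
    · refine circle_eq_iff.2 ⟨-(j : ℤ), ?_⟩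
      simp
      ring
    · simp [proj]

end ReturnMap

/-! ### The invariant measure -/

section InvariantMeasure

/-- Area-preserving injective differentiable maps preserve the area of measurable sets. -/
theorem volume_image_of_det {F : Plane → Plane} (hF : Differentiable ℝ F)
    (hdet : ∀ z, (fderiv ℝ F z).det = 1) (hinj : Function.Injective F) {E : Set Plane}
    (hE : MeasurableSet E) : volume (F '' E) = volume E := by
  rw [← lintegral_abs_det_fderiv_eq_addHaar_image volume hE
    (fun z _ => (hF z).hasFDerivAt.hasFDerivWithinAt) hinj.injOn]
  simp [hdet]

/-- The inverse of the normalizing coordinates. -/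
noncomputable def denormalize (q : ℝ → ℝ) (xs : ℝ) (w : Plane) : Plane :=
  chi (Real.log xs + w.1 * deriv q w.2, w.2)

theorem hasFDerivAt_chi (w : Plane) : HasFDerivAt chi
    ((Real.exp w.1 • ContinuousLinearMap.fst ℝ ℝ ℝ).prod
      (-(w.2 * Real.exp (-w.1)) • ContinuousLinearMap.fst ℝ ℝ ℝ +
        Real.exp (-w.1) • ContinuousLinearMap.snd ℝ ℝ ℝ)) w := by
  have h1 : HasFDerivAt (fun w : Plane => w.1) (ContinuousLinearMap.fst ℝ ℝ ℝ) w := hasFDerivAt_fst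
  have h2 : HasFDerivAt (fun w : Plane => w.2) (ContinuousLinearMap.snd ℝ ℝ ℝ) w := hasFDerivAt_snd
  refine h1.exp.prodMk ((h2.mul h1.neg.exp).congr_fderiv ?_)
  ext <;> simp

theorem det_fderiv_denormalize {q : ℝ → ℝ} {xs : ℝ} (hq : Differentiable ℝ (deriv q)) (w : Plane) :
    DifferentiableAt ℝ (denormalize q xs) w ∧
      (fderiv ℝ (denormalize q xs) w).det = deriv q w.2 := by
  have h1 : HasFDerivAt (fun w : Plane => w.1) (ContinuousLinearMap.fst ℝ ℝ ℝ) w := hasFDerivAt_fst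
  have h2 : HasFDerivAt (fun w : Plane => w.2) (ContinuousLinearMap.snd ℝ ℝ ℝ) w := hasFDerivAt_snd
  have h3 := ((hq w.2).hasDerivAt.comp_hasFDerivAt w h2)
  have h4 := ((h1.mul h3).const_add (Real.log xs)).prodMk h2
  have h5 := HasFDerivAt.comp w (hasFDerivAt_chi (Real.log xs + w.1 * deriv q w.2, w.2)) h4
  refine ⟨h5.differentiableAt, ?_⟩
  have h6 : fderiv ℝ (denormalize q xs) w = _ := h5.fderiv
  rw [h6, det_comp_plane, det_plane, det_plane]
  simp [← Real.exp_add]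

variable {g : Plane → Plane} {q s : ℝ → ℝ} {N : ℕ} {lam R ρ ub xs ys δ : ℝ}

namespace IsReturn

theorem measurableSet_fundDomain (hg : Continuous g) : MeasurableSet (fundDomain g xs ys) := by
  have h1 : Measurable fun z : Plane => (g (xs, z.1 * z.2 / xs)).1 := by
    have : Continuous fun z : Plane => (g (xs, z.1 * z.2 / xs)).1 := by fun_prop
    exact this.measurable
  have h2 : Measurable fun z : Plane => z.1 * z.2 := measurable_fst.mul measurable_snd
  exact (measurableSet_lt measurable_const measurable_fst).inter
    ((measurableSet_lt measurable_const h2).inter ((measurableSet_lt h2 measurable_const).inter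
      ((measurableSet_lt h1 measurable_fst).inter (measurableSet_le measurable_fst measurable_const))))

theorem measurable_normalize (hq : Continuous (deriv q)) : Measurable (normalize q xs) := by
  have h2 : Measurable fun z : Plane => z.1 * z.2 := measurable_fst.mul measurable_snd
  have h3 := hq.measurable.comp h2
  have h4 : Measurable fun z : Plane => Real.log z.1 := Real.measurable_log.comp measurable_fst
  exact ((h4.div h3).sub (measurable_const.div h3)).prodMk h2

theorem measurable_denormalize (hq : Continuous (deriv q)) : Measurable (denormalize q xs) := by
  have : Continuous (denormalize q xs) := by unfold denormalize chi; fun_prop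
  exact this.measurable

theorem map_proj_volume (c : ℝ) :
    ((volume : Measure Plane).restrict (Ioc (-1) 0 ×ˢ Ioo 0 c)).map proj =
      (volume : Measure Cyl).restrict (annulus c) := by
  have h1 := UnitAddCircle.measurePreserving_mk (-1)
  have h2 := h1.prod (MeasurePreserving.id ((volume : Measure ℝ).restrict (Ioo 0 c)))
  have h3 := h2.map_eq
  rw [Measure.prod_restrict, neg_add_cancel] at h3
  rw [Measure.volume_eq_prod]
  refine h3.trans ?_
  have h4 : annulus c = univ ×ˢ Ioo 0 c := by ext w; simp [annulus]
  rw [h4, Measure.volume_eq_prod, ← Measure.prod_restrict, Measure.restrict_univ]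

/-- Change of variables: `denormalize` has Jacobian `q'(v)`, so the area of the fundamental domain
becomes the measure of density `q'` on the annulus. -/
theorem map_normalize (h : IsReturn g q s N lam R ρ ub xs ys δ)
    (hq : ContDiff ℝ 1 (deriv q)) {B : Set Cyl} (hB : MeasurableSet B) :
    volume (fundDomain g xs ys ∩ (fun z => proj (normalize q xs z)) ⁻¹' B) =
      ((volume : Measure Cyl).restrict (annulus (xs * ys))).withDensity
        (fun w => ENNReal.ofReal (deriv q w.2)) B := by
  set K : Set Plane := Ioc (-1) 0 ×ˢ Ioo 0 (xs * ys) with hK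
  have hKm : MeasurableSet K := measurableSet_Ioc.prod measurableSet_Ioo
  have hpm : Measurable proj := continuous_proj.measurable
  have hψ : ∀ w ∈ K, proj (normalize q xs (denormalize q xs w)) = proj w := by
    rintro ⟨t, v⟩ hw
    rw [denormalize, normalize_chi (h.deriv_pos hw.2).ne']
  have himg : fundDomain g xs ys ∩ (fun z => proj (normalize q xs z)) ⁻¹' B =
      denormalize q xs '' (proj ⁻¹' B ∩ K) := by
    ext z
    constructor
    · rintro ⟨hz, hzB⟩
      obtain ⟨t, ht, v, hv, rfl⟩ := h.mem_fundDomain_iff.1 hz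
      refine ⟨(t, v), ⟨?_, ht, hv⟩, rfl⟩
      have := hψ (t, v) ⟨ht, hv⟩
      rw [mem_preimage, ← this]; exact hzB
    · rintro ⟨w, ⟨hw, hwK⟩, rfl⟩
      refine ⟨h.mem_fundDomain_iff.2 ⟨w.1, hwK.1, w.2, hwK.2, rfl⟩, ?_⟩
      rw [mem_preimage, hψ w hwK]; exact hw
  have hinj : InjOn (denormalize q xs) K := by
    intro w hw w' hw' e
    have e1 : normalize q xs (denormalize q xs w) = normalize q xs (denormalize q xs w') := by rw [e]
    rwa [denormalize, denormalize, normalize_chi (h.deriv_pos hw.2).ne',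
      normalize_chi (h.deriv_pos hw'.2).ne'] at e1
  have hqd : Differentiable ℝ (deriv q) := hq.differentiable one_ne_zero
  rw [himg, ← lintegral_abs_det_fderiv_eq_addHaar_image volume ((hpm hB).inter hKm)
    (fun w _ => (det_fderiv_denormalize hqd w).1.hasFDerivAt.hasFDerivWithinAt)
    (hinj.mono inter_subset_right)]
  have hmeas : Measurable fun w : Cyl => ENNReal.ofReal (deriv q w.2) :=
    (hq.continuous.measurable.comp measurable_snd).ennreal_ofReal
  rw [withDensity_apply _ hB, ← map_proj_volume, Measure.restrict_map hpm hB,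
    lintegral_map hmeas hpm, Measure.restrict_restrict (hpm hB)]
  refine setLIntegral_congr_fun ((hpm hB).inter hKm) fun w hw => ?_
  rw [(det_fderiv_denormalize hqd w).2, abs_of_pos (h.deriv_pos hw.2.2)]
  rfl

theorem invFunOn_normalize (h : IsReturn g q s N lam R ρ ub xs ys δ) {z : Plane}
    (hz : z ∈ fundDomain g xs ys) :
    Function.invFunOn (fun z => proj (normalize q xs z)) (fundDomain g xs ys)
      (proj (normalize q xs z)) = z :=
  h.bijOn.injOn.leftInvOn_invFunOn hz

theorem measurableSet_mem_returnSet {D : Set Plane} (hg : Continuous g) (hD : MeasurableSet D)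
    (j : ℕ) : MeasurableSet {z | j ∈ returnSet g N D z} := by
  have : {z | j ∈ returnSet g N D z} = {z | 1 ≤ j} ∩ g^[j] ⁻¹' (g^[N] ⁻¹' D) := rfl
  rw [this]
  exact (MeasurableSet.const _).inter
    ((hg.iterate j).measurable ((hg.iterate N).measurable hD))

theorem measurable_firstReturn {D : Set Plane} (hg : Continuous g) (hD : MeasurableSet D) :
    Measurable (firstReturn g N D) := by
  intro B hB
  have hret := measurableSet_mem_returnSet (N := N) hg hD
  have hgm : ∀ n, MeasurableSet (g^[n] ⁻¹' B) := fun n => (hg.iterate n).measurable hB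
  -- The preimage is cut according to the return time. Points that never return have `sInf ∅ = 0`,
  -- whence the last piece, with exponent `N`.
  have : firstReturn g N D ⁻¹' B =
      (⋃ j, ({z | j ∈ returnSet g N D z} ∩ ⋂ i ∈ Finset.range j, {z | i ∈ returnSet g N D z}ᶜ) ∩
        g^[N + j] ⁻¹' B) ∪ ((⋂ j, {z | j ∈ returnSet g N D z}ᶜ) ∩ g^[N] ⁻¹' B) := by
    ext z
    rcases (returnSet g N D z).eq_empty_or_nonempty with h | h
    · simp [firstReturn, h]
    · have h1 : z ∉ ⋂ j, {z | j ∈ returnSet g N D z}ᶜ := fun h2 =>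
        let ⟨j, hj⟩ := h
        mem_iInter.1 h2 j hj
      constructor
      · intro hz
        refine Or.inl (mem_iUnion.2 ⟨sInf (returnSet g N D z), ⟨Nat.sInf_mem h, ?_⟩, hz⟩)
        exact mem_iInter₂.2 fun i hi h1 =>
          absurd (Nat.sInf_le h1) (not_le.2 (Finset.mem_range.1 hi))
      · rintro (hz | hz)
        · obtain ⟨j, ⟨hj, hj'⟩, hz⟩ := mem_iUnion.1 hz
          have : sInf (returnSet g N D z) = j := IsLeast.csInf_eq ⟨hj, fun i hi => by
            by_contra! hij
            exact mem_iInter₂.1 hj' i (Finset.mem_range.2 hij) hi⟩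
          rw [mem_preimage, firstReturn, this]
          exact hz
        · exact absurd hz.1 h1
  rw [this]
  exact (MeasurableSet.iUnion fun j => ((hret j).inter (Finset.measurableSet_biInter _
    fun i _ => (hret i).compl)).inter (hgm _)).union
    ((MeasurableSet.iInter fun j => (hret j).compl).inter (hgm _))

/-- On each set of constant return time the map is an iterate of `g`, injective and area preserving.
Injectivity on `E` makes the images of these sets disjoint, so the areas add up. -/
theorem volume_image_firstReturn {D E : Set Plane} (hg : ContDiff ℝ 1 g)
    (hdet : ∀ z, (fderiv ℝ g z).det = 1) (hinj : Function.Injective g) (hD : MeasurableSet D)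
    (hE : MeasurableSet E) (hne : ∀ z ∈ E, (returnSet g N D z).Nonempty)
    (hF : InjOn (firstReturn g N D) E) :
    volume (firstReturn g N D '' E) = volume E := by
  have hgd : Differentiable ℝ g := hg.differentiable one_ne_zero
  have hret := measurableSet_mem_returnSet (N := N) hg.continuous hD
  set P : ℕ → Set Plane := fun j => E ∩ ({z | j ∈ returnSet g N D z} ∩
    ⋂ i ∈ Finset.range j, {z | i ∈ returnSet g N D z}ᶜ) with hP
  have hPm : ∀ j, MeasurableSet (P j) := fun j => hE.inter ((hret j).inter
    (Finset.measurableSet_biInter _ fun i _ => (hret i).compl))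
  have hPj : ∀ j, ∀ z ∈ P j, sInf (returnSet g N D z) = j := by
    rintro j z ⟨_, h1, h2⟩
    refine IsLeast.csInf_eq ⟨h1, fun i hi => ?_⟩
    by_contra! hij
    have := mem_iInter₂.1 h2 i (Finset.mem_range.2 hij)
    exact this hi
  have hEP : E = ⋃ j, P j := by
    refine Subset.antisymm (fun z hz => ?_) (iUnion_subset fun j => inter_subset_left)
    refine mem_iUnion.2 ⟨sInf (returnSet g N D z), hz, Nat.sInf_mem (hne z hz), ?_⟩
    refine mem_iInter₂.2 fun i hi h1 => ?_
    exact absurd (Nat.sInf_le h1) (not_le.2 (Finset.mem_range.1 hi))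
  have hPd : Pairwise (Function.onFun Disjoint P) := by
    intro i j hij
    refine Set.disjoint_left.2 fun z hi hj => hij ?_
    rw [← hPj i z hi, hPj j z hj]
  have himg : ∀ j, firstReturn g N D '' P j = g^[N + j] '' P j := by
    intro j
    refine image_congr fun z hz => ?_
    rw [firstReturn, hPj j z hz]
  have hvol : ∀ j, volume (firstReturn g N D '' P j) = volume (P j) := by
    intro j
    rw [himg]
    exact volume_image_of_det (hgd.iterate _) (det_fderiv_iterate hgd hdet _)
      (hinj.iterate _) (hPm j)
  have hPE : ∀ j, P j ⊆ E := fun j => inter_subset_left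
  conv_lhs => rw [hEP]
  conv_rhs => rw [hEP]
  rw [image_iUnion, measure_iUnion _ hPm]
  · rw [measure_iUnion]
    · simp_rw [hvol]
    · intro i j hij
      exact (hPd hij).image hF (hPE i) (hPE j)
    · intro j
      rw [himg]
      exact (hPm j).image_of_continuousOn_injOn (hg.continuous.iterate _).continuousOn
        (hinj.iterate _).injOn
  · exact hPd

/-- `normalize` conjugates the renormalized map to the first return map. As `A` is in the image, the
latter sends the preimage onto, and not merely into, the set of points over `A`. -/
theorem volume_preimage_renorm (h : IsReturn g q s N lam R ρ ub xs ys δ) (hg : ContDiff ℝ 1 g)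
    (hdet : ∀ z, (fderiv ℝ g z).det = 1) (hginj : Function.Injective g)
    (hq : ContDiff ℝ 1 (deriv q))
    (hper : IsLocallyPeriodic (fun w => lift g q s N (Real.log xs) w - w) (ρ / 2))
    (hinj : InjOn (renorm g q N xs ys) (annulus δ)) {A : Set Cyl} (hA : MeasurableSet A)
    (hAS : A ⊆ renorm g q N xs ys '' annulus δ) :
    MeasurableSet (annulus δ ∩ renorm g q N xs ys ⁻¹' A) ∧
    volume (fundDomain g xs ys ∩ (fun z => proj (normalize q xs z)) ⁻¹'
      (annulus δ ∩ renorm g q N xs ys ⁻¹' A)) =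
    volume (fundDomain g xs ys ∩ (fun z => proj (normalize q xs z)) ⁻¹' A) := by
  set D := fundDomain g xs ys with hDdef
  set ψ : Plane → Cyl := fun z => proj (normalize q xs z) with hψ
  set F := firstReturn g N D with hF
  have hDm : MeasurableSet D := measurableSet_fundDomain hg.continuous
  have hψm : Measurable ψ := continuous_proj.measurable.comp (measurable_normalize hq.continuous)
  have hinv : ∀ z ∈ D, Function.invFunOn ψ D (ψ z) = z := fun z hz => h.invFunOn_normalize hz
  have hren : ∀ z ∈ D, renorm g q N xs ys (ψ z) = ψ (F z) := by
    intro z hz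
    have : renorm g q N xs ys (ψ z) = ψ (F (Function.invFunOn ψ D (ψ z))) := rfl
    rw [this, hinv z hz]
  have hFD : ∀ z ∈ D, ψ z ∈ annulus δ → F z ∈ D ∧ (returnSet g N D z).Nonempty := by
    intro z hz hzS
    obtain ⟨h1, _, h3, _⟩ := h.renorm_eq hper hzS
    change (returnSet g N D (Function.invFunOn ψ D (ψ z))).Nonempty at h1
    change F (Function.invFunOn ψ D (ψ z)) ∈ D at h3
    rw [hinv z hz] at h1 h3
    exact ⟨h3, h1⟩
  have hSm : MeasurableSet (annulus δ) := by
    have : annulus δ = Prod.snd ⁻¹' Ioo 0 δ := rfl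
    rw [this]; exact measurable_snd measurableSet_Ioo
  have hFinj : InjOn F (D ∩ ψ ⁻¹' annulus δ) := by
    rintro z ⟨hz, hzS⟩ z' ⟨hz', hzS'⟩ e
    have := hinj hzS hzS' (by rw [hren z hz, hren z' hz', e])
    exact h.bijOn.injOn hz hz' this
  have hretm : Measurable F := measurable_firstReturn hg.continuous hDm
  set E := D ∩ ψ ⁻¹' (annulus δ ∩ renorm g q N xs ys ⁻¹' A) with hE
  have hEeq : E = (D ∩ ψ ⁻¹' annulus δ) ∩ F ⁻¹' (ψ ⁻¹' A) := by
    ext z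
    constructor
    · rintro ⟨h1, h2, h3⟩
      exact ⟨⟨h1, h2⟩, by rw [mem_preimage, hren z h1] at h3; exact h3⟩
    · rintro ⟨⟨h1, h2⟩, h3⟩
      exact ⟨h1, h2, by rw [mem_preimage, hren z h1]; exact h3⟩
  have hEm : MeasurableSet E := by
    rw [hEeq]; exact (hDm.inter (hψm hSm)).inter (hretm (hψm hA))
  refine ⟨?_, ?_⟩
  -- `renorm` involves a chosen inverse; its measurability on the annulus goes through the
  -- measurable section `r` of the covering, with values in `]-1, 0]`.
  · set r : Cyl → Plane := fun w => ((AddCircle.measurableEquivIoc 1 (-1) w.1 : ℝ), w.2) with hr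
    have hrm : Measurable r := (measurable_subtype_coe.comp
      ((AddCircle.measurableEquivIoc 1 (-1)).measurable.comp measurable_fst)).prodMk measurable_snd
    have hBeq : annulus δ ∩ renorm g q N xs ys ⁻¹' A =
        annulus δ ∩ (fun w => denormalize q xs (r w)) ⁻¹' E := by
      ext w
      refine and_congr_right fun hw => ?_
      have hv : w.2 ∈ Ioo 0 (xs * ys) :=
        ⟨hw.1, by linarith [hw.2, h.δ_le, mul_pos h.xs_pos h.ys_pos]⟩
      have ht : (AddCircle.measurableEquivIoc 1 (-1) w.1 : ℝ) ∈ Ioc (-1 : ℝ) 0 := by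
        have := (AddCircle.measurableEquivIoc 1 (-1) w.1).2
        simpa using this
      have hc : (((AddCircle.measurableEquivIoc 1 (-1) w.1 : ℝ)) : UnitAddCircle) = w.1 :=
        AddCircle.coe_equivIoc
      have hz : denormalize q xs (r w) ∈ D := (h.chi_mem_iff hv).2 ht
      have hψz : ψ (denormalize q xs (r w)) = w := by
        simp only [hψ, denormalize, normalize_chi (h.deriv_pos hv).ne', hr]
        exact Prod.ext hc rfl
      simp only [hE, mem_preimage, mem_inter_iff, hψz, hz, hw, true_and]
    rw [hBeq]
    exact hSm.inter (((measurable_denormalize hq.continuous).comp hrm) hEm)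
  · have himg : F '' E = D ∩ ψ ⁻¹' A := by
      rw [hEeq]
      refine Subset.antisymm ?_ ?_
      · rintro _ ⟨z, ⟨⟨h1, h2⟩, h3⟩, rfl⟩
        exact ⟨(hFD z h1 h2).1, h3⟩
      · rintro y ⟨hy, hyA⟩
        obtain ⟨w, hw, hwy⟩ := hAS hyA
        obtain ⟨z, hz, hzw⟩ := h.bijOn.surjOn (show w ∈ annulus (xs * ys) from
          ⟨hw.1, by linarith [hw.2, h.δ_le, mul_pos h.xs_pos h.ys_pos]⟩)
        change ψ z = w at hzw
        have hzS : ψ z ∈ annulus δ := by rw [hzw]; exact hw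
        have e : F z = y := by
          refine h.bijOn.injOn (hFD z hz hzS).1 hy ?_
          change ψ (F z) = ψ y
          rw [← hren z hz, hzw]; exact hwy
        exact ⟨z, ⟨⟨hz, hzS⟩, by rw [mem_preimage, e]; exact hyA⟩, e⟩
    rw [← himg]
    refine (volume_image_firstReturn hg hdet hginj hDm hEm (fun z hz => ?_) (hFinj.mono ?_)).symm
    · exact (hFD z hz.1 hz.2.1).2
    · rw [hEeq]; exact inter_subset_left

/-- The measure is the normalized area of the fundamental domain; the two bounds on the frequency
make its total mass positive and finite. -/
theorem exists_invariant_measure (h : IsReturn g q s N lam R ρ ub xs ys δ) (hg : ContDiff ℝ 1 g)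
    (hdet : ∀ z, (fderiv ℝ g z).det = 1) (hginj : Function.Injective g)
    (hq : ContDiff ℝ 1 (deriv q))
    (hper : IsLocallyPeriodic (fun w => lift g q s N (Real.log xs) w - w) (ρ / 2))
    (hinj : InjOn (renorm g q N xs ys) (annulus δ)) :
    ∃ μ : Measure Cyl, IsProbWithPosDensity (xs * ys) μ ∧
      PreservesOn (renorm g q N xs ys) (annulus δ) μ := by
  have hxy : 0 < xs * ys := mul_pos h.xs_pos h.ys_pos
  set ν := ((volume : Measure Cyl).restrict (annulus (xs * ys))).withDensity
        (fun w => ENNReal.ofReal (deriv q w.2)) with hν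
  have hmeas : Measurable fun w : Cyl => ENNReal.ofReal (deriv q w.2) :=
    (hq.continuous.measurable.comp measurable_snd).ennreal_ofReal
  have hSm : MeasurableSet (annulus (xs * ys)) := by
    have : annulus (xs * ys) = Prod.snd ⁻¹' Ioo 0 (xs * ys) := rfl
    rw [this]; exact measurable_snd measurableSet_Ioo
  have hvol : (volume : Measure Cyl) (annulus (xs * ys)) = ENNReal.ofReal (xs * ys) := by
    have h4 : annulus (xs * ys) = univ ×ˢ Ioo 0 (xs * ys) := by ext w; simp [annulus]
    rw [h4, Measure.volume_eq_prod, Measure.prod_prod]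
    simp
  have hupper : ν univ ≤ ENNReal.ofReal (5 * lam / 4) * ENNReal.ofReal (xs * ys) := by
    rw [hν, withDensity_apply _ MeasurableSet.univ, Measure.restrict_univ, ← hvol]
    rw [← setLIntegral_const]
    refine setLIntegral_mono' hSm fun w hw => ENNReal.ofReal_le_ofReal ?_
    exact (h.freq w.2 (h.abs_le hw)).2.le
  have hlower : ENNReal.ofReal (3 * lam / 4) * ENNReal.ofReal (xs * ys) ≤ ν univ := by
    rw [hν, withDensity_apply _ MeasurableSet.univ, Measure.restrict_univ, ← hvol]
    rw [← setLIntegral_const]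
    refine setLIntegral_mono' hSm fun w hw => ENNReal.ofReal_le_ofReal ?_
    exact (h.freq w.2 (h.abs_le hw)).1.le
  have hl := h.lam_pos
  have htop : ν univ ≠ ∞ := ne_top_of_le_ne_top (by finiteness) hupper
  have hpos : 0 < ν univ := lt_of_lt_of_le (ENNReal.mul_pos
    (ENNReal.ofReal_pos.2 (by positivity)).ne' (ENNReal.ofReal_pos.2 hxy).ne') hlower
  set Z := (ν univ).toReal with hZ
  have hZpos : 0 < Z := ENNReal.toReal_pos hpos.ne' htop
  have hZe : (ν univ)⁻¹ = ENNReal.ofReal Z⁻¹ := by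
    rw [ENNReal.ofReal_inv_of_pos hZpos, hZ, ENNReal.ofReal_toReal htop]
  refine ⟨(ν univ)⁻¹ • ν, ⟨⟨?_⟩, fun w => Z⁻¹ * deriv q w.2, ?_, ?_, ?_⟩, ?_⟩
  · rw [Measure.smul_apply, smul_eq_mul, ENNReal.inv_mul_cancel hpos.ne' htop]
  · exact (continuous_const.mul (hq.continuous.comp continuous_snd)).continuousOn
  · intro w hw
    exact mul_pos (inv_pos.2 hZpos) (h.deriv_pos hw)
  · rw [hZe, hν, ← withDensity_smul _ hmeas]
    congr 1
    funext w
    rw [Pi.smul_apply, smul_eq_mul, ENNReal.ofReal_mul (inv_pos.2 hZpos).le]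
  · intro A hA hAS
    obtain ⟨h1, h2⟩ := h.volume_preimage_renorm hg hdet hginj hq hper hinj hA hAS
    rw [Measure.smul_apply, Measure.smul_apply, hν, ← h.map_normalize hq h1,
      ← h.map_normalize hq hA, h2]

end IsReturn

end InvariantMeasure

/-! ### Maps of the cylinder close to the identity and preserving the axis -/

section CloseToId

/-- The map `L` is close to the identity for `|x| ≤ 5/2`, `|y| ≤ r`, commutes with the horizontal
unit translation and preserves the horizontal axis. -/
structure IsCloseToId (k : ℕ) (L : Plane → Plane) (r : ℝ) : Prop where
  contDiffAt : ∀ w : Plane, |w.1| ≤ 5 / 2 → |w.2| ≤ r → ContDiffAt ℝ k (fun w => L w - w) w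
  norm_le : ∀ w : Plane, |w.1| ≤ 5 / 2 → |w.2| ≤ r → ‖L w - w‖ ≤ 1 / 2
  norm_fderiv_le : ∀ w : Plane, |w.1| ≤ 5 / 2 → |w.2| ≤ r → ‖fderiv ℝ (fun w => L w - w) w‖ ≤ 1 / 2
  snd_zero : ∀ x : ℝ, |x| ≤ 5 / 2 → (L (x, 0)).2 = 0
  periodic : IsLocallyPeriodic (fun w => L w - w) r

/-- The second component of the displacement is `1/2`-Lipschitz and vanishes on the axis. In
particular points above the axis stay above it. -/
theorem abs_snd_sub_le {L : Plane → Plane} {r : ℝ}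
    (hd : ∀ w : Plane, |w.1| ≤ 5 / 2 → |w.2| ≤ r → DifferentiableAt ℝ (fun w => L w - w) w)
    (hf : ∀ w : Plane, |w.1| ≤ 5 / 2 → |w.2| ≤ r → ‖fderiv ℝ (fun w => L w - w) w‖ ≤ 1 / 2)
    (h0 : ∀ x : ℝ, |x| ≤ 5 / 2 → (L (x, 0)).2 = 0) {w : Plane} (h1 : |w.1| ≤ 5 / 2)
    (h2 : |w.2| ≤ r) : |(L w).2 - w.2| ≤ |w.2| / 2 := by
  have hconv : Convex ℝ (Icc (-(5 / 2) : ℝ) (5 / 2) ×ˢ Icc (-r) r) :=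
    (convex_Icc _ _).prod (convex_Icc _ _)
  have h3 := hconv.norm_image_sub_le_of_norm_fderiv_le (𝕜 := ℝ) (f := fun w => L w - w)
    (fun w hw => hd w (abs_le.2 hw.1) (abs_le.2 hw.2))
    (fun w hw => hf w (abs_le.2 hw.1) (abs_le.2 hw.2)) (x := (w.1, 0)) (y := w)
    ⟨abs_le.1 h1, abs_le.1 (by simpa using (abs_nonneg _).trans h2)⟩ ⟨abs_le.1 h1, abs_le.1 h2⟩
  have h4 : ‖w - (w.1, 0)‖ = |w.2| := by
    rw [Prod.norm_def]; simp
  rw [h4] at h3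
  have h5 := (norm_snd_le (L w - w - (L (w.1, 0) - (w.1, 0)))).trans h3
  simp only [Prod.snd_sub, h0 w.1 h1, sub_zero, Real.norm_eq_abs] at h5
  linarith

variable {k : ℕ} {L : Plane → Plane} {r : ℝ}

namespace IsCloseToId

theorem contDiffAt_periodize (h : IsCloseToId k L r) {p : Plane} (hp : |p.2| < r) :
    ContDiffAt ℝ k (fun p => periodize (fun w => L w - w) (proj p)) p :=
  h.periodic.contDiffAt (fun w h1 h2 => h.contDiffAt w h1 h2.le) hp

theorem isCkDiffeoOn (h : IsCloseToId k L r) (hk : 1 ≤ k) {δ : ℝ} (hδ : δ ≤ r) :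
    IsCkDiffeoOn k (fun w => (w.1 + ((periodize (fun w => L w - w) w).1 : UnitAddCircle),
      w.2 + (periodize (fun w => L w - w) w).2)) (annulus δ) := by
  have hr : ∀ p : Plane, p.2 ∈ Ioo 0 δ → |p.2| < r := fun p hp => by
    rw [abs_of_pos hp.1]; linarith [hp.2]
  refine isCkDiffeoOn_of_small hk (fun p hp => h.contDiffAt_periodize (hr p hp)) fun p hp => ?_
  rw [← norm_iteratedFDeriv_one]
  refine h.periodic.norm_iteratedFDeriv_le (fun w h1 h2 => ?_) (hr p hp)
  rw [norm_iteratedFDeriv_one]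
  exact h.norm_fderiv_le w h1 h2.le

theorem periodize_snd_zero (h : IsCloseToId k L r) (θ : UnitAddCircle) :
    (periodize (fun w => L w - w) (θ, 0)).2 = 0 := by
  have h1 := rep_mem θ
  simp only [periodize, Prod.snd_sub, sub_zero]
  exact h.snd_zero _ (abs_le.2 ⟨by linarith [h1.1], by linarith [h1.2]⟩)

theorem hadamardQuot_add_int {D : Plane → ℝ} (hD : ∀ (p : Plane) (n : ℤ), D (p.1 + n, p.2) = D p)
    (p : Plane) (n : ℤ) : hadamardQuot D (p.1 + n, p.2) = hadamardQuot D p := by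
  have h1 : (fun p : Plane => D (p + ((n : ℝ), 0))) = D := by
    funext p
    rw [← hD p n]
    congr 1
    ext <;> simp
  refine intervalIntegral.integral_congr fun t _ => ?_
  have h2 := fderiv_comp_add_right (𝕜 := ℝ) (f := D) (x := (p.1, t * p.2)) ((n : ℝ), 0)
  rw [h1] at h2
  simp only
  rw [h2]
  simp

/-- The function `b` such that the second component of the map with lift `L` is `y + y b`. -/
noncomputable def relDisplacement (L : Plane → Plane) (w : Cyl) : ℝ :=
  hadamardQuot (fun p => (periodize (fun w => L w - w) (proj p)).2) (rep w.1, w.2)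

theorem relDisplacement_proj (L : Plane → Plane) (p : Plane) : relDisplacement L (proj p) =
    hadamardQuot (fun p => (periodize (fun w => L w - w) (proj p)).2) p := by
  obtain ⟨n, hn⟩ := proj_eq_iff.1 (proj_rep (proj p))
  unfold relDisplacement
  rw [hn]
  exact hadamardQuot_add_int (fun p n => by simp only [proj_add_int]) p n

theorem contDiffOn_snd (h : IsCloseToId k L r) :
    ContDiffOn ℝ k (fun p => (periodize (fun w => L w - w) (proj p)).2) {p | |p.2| < r} :=
  fun _ hp => (h.contDiffAt_periodize hp).snd.contDiffWithinAt

theorem mul_relDisplacement (h : IsCloseToId k L r) (hk : 1 ≤ k) {w : Cyl} (hw : |w.2| < r) :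
    w.2 * relDisplacement L w = (periodize (fun w => L w - w) w).2 := by
  have h1 : ContDiffOn ℝ 1 (fun p => (periodize (fun w => L w - w) (proj p)).2)
      {p | |p.2| < r} := h.contDiffOn_snd.of_le (by exact_mod_cast hk)
  have h2 := mul_hadamardQuot h1 (fun x => h.periodize_snd_zero _) (p := (rep w.1, w.2)) hw
  rw [relDisplacement, h2, proj_rep]

theorem contDiffOn_relDisplacement (h : IsCloseToId k L r) (hk : 1 ≤ k) :
    ContDiffOn ℝ (k - 1 : ℕ) (fun p => relDisplacement L (proj p)) {p | |p.2| < r} := by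
  simp only [relDisplacement_proj]
  refine contDiffOn_hadamardQuot ?_
  have : ((k - 1 : ℕ) : WithTop ℕ∞) + 1 = k := by
    exact_mod_cast congrArg (Nat.cast : ℕ → WithTop ℕ∞) (Nat.sub_add_cancel hk)
  rw [this]
  exact h.contDiffOn_snd

/-- Near each point `(a, y b)` coincides with the periodized displacement, so no separate estimate
of `b` is needed. -/
theorem ckNorm_le (h : IsCloseToId k L r) (hk : 1 ≤ k) {δ τ : ℝ} (hδ : δ ≤ r)
    (hτ : ∀ w : Plane, |w.1| ≤ 5 / 2 → |w.2| ≤ r → ∀ i ≤ k,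
      ‖iteratedFDeriv ℝ i (fun w => L w - w) w‖ ≤ τ) :
    ckNorm k (univ ×ˢ Ioo 0 δ) (fun p => ((periodize (fun w => L w - w) (proj p)).1,
      p.2 * relDisplacement L (proj p))) ≤ ENNReal.ofReal τ := by
  refine iSup₂_le fun i hi => iSup₂_le fun p hp => ?_
  have hr : |p.2| < r := by rw [abs_of_pos hp.2.1]; linarith [hp.2.2]
  have hev : (fun p => ((periodize (fun w => L w - w) (proj p)).1,
      p.2 * relDisplacement L (proj p))) =ᶠ[𝓝 p]
      fun p => periodize (fun w => L w - w) (proj p) := by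
    have e1 : ∀ᶠ p' : Plane in 𝓝 p, |p'.2| < r :=
      (isOpen_lt (by fun_prop) continuous_const).mem_nhds hr
    filter_upwards [e1] with p' hp'
    exact Prod.ext rfl (h.mul_relDisplacement hk (w := proj p') hp')
  rw [(hev.iteratedFDeriv ℝ i).self_of_nhds, ← ofReal_norm]
  refine ENNReal.ofReal_le_ofReal ?_
  exact h.periodic.norm_iteratedFDeriv_le
    (fun w h1 h2 => hτ w h1 h2.le i (by simpa [Nat.lt_succ_iff] using hi)) hr

end IsCloseToId

end CloseToId

/-! ### From the estimates on the family to the return map -/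

section Assembly

variable {k : ℕ} {I : Set ℝ} {f : ℝ → Equiv.Perm Plane} {S : ℝ → Set Plane}
    {lam : ℝ} {q : ℝ → ℝ → ℝ} {V₀ : Set Plane} {H : Plane → ℝ} {R : ℝ}
    {N : ℕ} {xs ub ρ : ℝ} {s : ℝ → ℝ}

theorem IsSeparatrixFamily.eventually_isCloseToId (hk : 2 ≤ k)
    (hf : IsSeparatrixFamily k I f S lam q V₀ H) (hR : IsGoodRadius (q 0) V₀ R)
    (hT : IsTransition k I f lam q R N (Real.log xs) ub s ρ) :
    ∀ᶠ ε in 𝓝 (0 : ℝ), |ε| < ρ ∧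
      IsCloseToId k (lift (f ε) (q ε) s N (Real.log xs)) (ρ / 2) := by
  have hlam := hf.lam_pos
  have hρ := hT.pos
  have hε : ∀ᶠ ε in 𝓝 (0 : ℝ), |ε| < ρ :=
    (isOpen_lt continuous_abs continuous_const).mem_nhds (by simpa using hρ)
  filter_upwards [hε, hf.eventually_lift_small hR hT (τ := 1 / 2) (by norm_num),
    hf.eventually_unstable_eq_stable hk hR (N := N) (ub := ub) (A := 4 * lam) (by linarith) hρ
      fun ε v h1 h2 => ⟨hT.mem ε h1, hT.window ε v h1 h2.le⟩] with ε hε hsmall hzero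
  have hbox : ∀ w : Plane, |w.1| ≤ 5 / 2 → |w.2| ≤ ρ / 2 →
      w ∈ Icc (-5 / 2 : ℝ) (5 / 2) ×ˢ Icc (-(ρ / 2)) (ρ / 2) := fun w h1 h2 =>
    ⟨⟨by linarith [(abs_le.1 h1).1], (abs_le.1 h1).2⟩, abs_le.1 h2⟩
  have hc : ∀ w : Plane, |w.1| ≤ 5 / 2 → |w.2| ≤ ρ / 2 → ContDiffAt ℝ k
      (fun w => lift (f ε) (q ε) s N (Real.log xs) w - w) w := fun w h1 h2 =>
    (hsmall w (hbox w h1 h2)).1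
  have hd : ∀ w : Plane, |w.1| ≤ 5 / 2 → |w.2| ≤ ρ / 2 → ‖fderiv ℝ
      (fun w => lift (f ε) (q ε) s N (Real.log xs) w - w) w‖ ≤ 1 / 2 := fun w h1 h2 => by
    rw [← norm_iteratedFDeriv_one]
    exact ((hsmall w (hbox w h1 h2)).2 1 (by omega)).le
  have h0 : ∀ x : ℝ, |x| ≤ 5 / 2 → (lift (f ε) (q ε) s N (Real.log xs) (x, 0)).2 = 0 :=
    fun x hx => hzero _ (hT.arg_mem (w := (x, 0)) hlam hε (by simp only; linarith)
      (by simpa using hρ.le))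
  refine ⟨hε, hc, fun w h1 h2 => ?_, hd, h0, ?_⟩
  · have := ((hsmall w (hbox w h1 h2)).2 0 (by omega)).le
    rwa [norm_iteratedFDeriv_zero] at this
  · refine isLocallyPeriodic_lift_sub (hf.isNormalOn hR (hT.mem ε hε)) (fun w h1 h2 =>
      hT.window_arg hlam hε (by linarith) (by linarith)) fun w h1 h2 => ?_
    -- The second coordinate of the image is at most `3/2` times the initial one in absolute value,
    -- so it remains in the range where the frequency is bounded below.
    have h3 := abs_snd_sub_le (fun w h1 h2 => (hc w h1 h2).differentiableAt
      (by exact_mod_cast (by omega : k ≠ 0))) hd h0 h1 h2.le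
    have h4 := (abs_sub_abs_le_abs_sub (lift (f ε) (q ε) s N (Real.log xs) w).2 w.2).trans h3
    have := (hT.freq ε (lift (f ε) (q ε) s N (Real.log xs) w).2 hε (by linarith)).1
    linarith

theorem IsTransition.isReturn (hk : 1 ≤ k)
    (hf : IsSeparatrixFamily k I f S lam q V₀ H) (hR : IsGoodRadius (q 0) V₀ R)
    (hT : IsTransition k I f lam q R N (Real.log xs) ub s ρ) {ε : ℝ} (hε : |ε| < ρ)
    (hL : IsCloseToId k (lift (f ε) (q ε) s N (Real.log xs)) (ρ / 2))
    (hxs : 0 < xs) (hxR : xs < R) (huR : Real.exp (-ub) * Real.exp (4 * lam) < R) {ys δ : ℝ}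
    (hys : 0 < ys) (hc : xs * ys < ρ / 2) (hysR : ys * Real.exp ((N + 1) * (5 * lam / 4)) < R)
    (hδc : δ ≤ xs * ys / 2) (hδe : δ ≤ Real.exp (Real.log xs - ub - 8 * lam)) :
    IsReturn (f ε) (q ε) s N lam R ρ ub xs ys δ where
  lam_pos := hf.lam_pos
  normal := hf.isNormalOn hR (hT.mem ε hε)
  xs_pos := hxs
  xs_lt := hxR
  ub_lt := huR
  freq := fun v hv => hT.freq ε v hε hv
  s_near := hT.s_near
  window := fun v hv => hT.window ε v hε hv
  lift_fst := fun w h1 h2 => (norm_fst_le _).trans (hL.norm_le w h1 h2.le)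
  lift_snd := fun w h1 h2 h3 => by
    have h4 := abs_snd_sub_le (fun w h1 h2 => (hL.contDiffAt w h1 h2).differentiableAt
      (by exact_mod_cast (by omega : k ≠ 0))) hL.norm_fderiv_le hL.snd_zero h1
      (by rw [abs_of_pos h2]; exact h3.le)
    rw [abs_of_pos h2] at h4
    have h5 := abs_le.1 h4
    exact ⟨by linarith, by linarith⟩
  ys_pos := hys
  c_lt := hc
  ys_lt := hysR
  δ_le := hδc
  δ_le_exp := hδe

/-- The function `s` is the function `σ` with `Ξ₁ ∘ f₀^N ∘ Ξ₂⁻¹ = T_σ`. -/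
theorem IsTransition.xi1_iterate (hT : IsTransition k I f lam q R N (Real.log xs) ub s ρ) {ε ys δ : ℝ}
    (h : IsReturn (f ε) (q ε) s N lam R ρ ub xs ys δ) {w : Plane}
    (hw : (f 0)^[N] w ∈ fundDomain (f ε) xs ys) :
    0 < w.2 ∧ xi1 ((f 0)^[N] w) = planeTwist s (xi2 w) := by
  obtain ⟨t, ht, v, hv, hz⟩ := h.mem_fundDomain_iff.1 hw
  have hv' := h.abs_le hv
  have harg := h.arg_mem (t := t) (abs_le.2 ⟨by linarith [ht.1], by linarith [ht.2]⟩) hv'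
  set u := Real.log xs + t * deriv (q ε) v - s v with hu
  have htr := hT.trans_zero (u, v) harg hv'
  have hwin := hT.window 0 v (by simpa using hT.pos) hv' u harg
  -- The abscissa `u` is the one that the shear by `s` sends to the given point; injectivity of the
  -- iterate identifies `w` with `theta (u, v)`.
  have e : (f 0)^[N] (theta (u, v)) = (f 0)^[N] w := by
    rw [← chi_xi1 hwin.2.2, hz]
    change chi (trans (f 0) N (u, v)) = _
    rw [htr, hu]
    simp
  have hwe := ((f 0).injective.iterate N) e
  refine ⟨by rw [← hwe]; exact Real.exp_pos _, ?_⟩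
  rw [hz, xi1_chi, ← hwe, xi2_theta, planeTwist, hu]
  simp

theorem IsReturn.injOn_renorm {g : Plane → Plane} {q : ℝ → ℝ} {ys δ : ℝ} (hk : 1 ≤ k)
    (h : IsReturn g q s N lam R ρ ub xs ys δ)
    (hL : IsCloseToId k (lift g q s N (Real.log xs)) (ρ / 2)) :
    InjOn (renorm g q N xs ys) (annulus δ) := by
  have hδ : δ ≤ ρ / 2 := by
    linarith [h.δ_le, h.c_lt, mul_pos h.xs_pos h.ys_pos]
  intro w hw w' hw' e
  rw [(h.renorm_eq hL.periodic hw).2.2.2, (h.renorm_eq hL.periodic hw').2.2.2] at e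
  have e1 := (hL.isCkDiffeoOn hk hδ).1 (show cylTwist _ w ∈ annulus δ from hw)
    (show cylTwist _ w' ∈ annulus δ from hw') e
  simp only [cylTwist, Prod.mk.injEq] at e1
  obtain ⟨e1, e2⟩ := e1
  rw [e2] at e1
  exact Prod.ext (add_right_cancel e1) e2

end Assembly

end Sep

/-! ### The proposition -/

theorem proposition5p4
    (k : ℕ) (hk : 2 ≤ k) (I : Set ℝ) (f : ℝ → Equiv.Perm Sep.Plane) (S : ℝ → Set Sep.Plane)
    (lam : ℝ) (q : ℝ → ℝ → ℝ) (V₀ : Set Sep.Plane) (H : Sep.Plane → ℝ)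
    (hf : Sep.IsSeparatrixFamily k I f S lam q V₀ H) :
    -- `V` is any small enough star-shaped open neighbourhood of the origin
    ∃ r : ℝ, 0 < r ∧ ∀ V : Set Sep.Plane, IsOpen V → (0 : Sep.Plane) ∈ V → StarConvex ℝ 0 V →
      V ⊆ Metric.ball 0 r →
    -- choice of `x_*`
    ∀ xs : ℝ, 0 < xs → ((xs, 0) : Sep.Plane) ∈ V →
      (∀ᶠ ε in 𝓝 (0 : ℝ), (f ε).symm (xs, 0) ∉ V) →
    ∀ N : ℕ, N = Sep.transitTime (f 0) V xs →
    ∃ σ : ℝ → ℝ, ContDiff ℝ k σ ∧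
    ∃ y₀ : ℝ, 0 < y₀ ∧ ∀ ys : ℝ, 0 < ys → ys < y₀ → ∀ c : ℝ, c = xs * ys →
    ∃ δ : ℝ, 0 < δ ∧ δ < c ∧
    ∃ ε₀ : ℝ, 0 < ε₀ ∧ Ioo (-ε₀) ε₀ ⊆ I ∧
    ∃ (η : ℝ → Sep.Cyl → Sep.Cyl) (a b : ℝ → Sep.Cyl → ℝ),
      (∀ ε ∈ Ioo (-ε₀) ε₀,
        -- `σ` is the function with `Ξ₁ ∘ f₀^N ∘ Ξ₂⁻¹ = T_σ`
        (∀ w : Sep.Plane, (f 0)^[N] w ∈ Sep.fundDomain (f ε) xs ys →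
          0 < w.2 ∧ Sep.xi1 ((f 0)^[N] w) = Sep.planeTwist σ (Sep.xi2 w)) ∧
        -- the renormalized map is well defined from `ℝ/ℤ × ]0, δ[` to `ℝ/ℤ × ]0, c[`
        BijOn (fun z => Sep.proj (Sep.normalize (q ε) xs z))
          (Sep.fundDomain (f ε) xs ys) (Sep.annulus c) ∧
        (∀ z ∈ Sep.fundDomain (f ε) xs ys, z.1 * z.2 < δ →
          (Sep.returnSet (f ε) N (Sep.fundDomain (f ε) xs ys) z).Nonempty) ∧
        MapsTo (Sep.renorm (f ε) (q ε) N xs ys) (Sep.annulus δ) (Sep.annulus c) ∧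
        -- the function `l` is of class `C^k`, and the renormalized map is `η ∘ T_l`
        (∀ y ∈ Ioo 0 c, 0 < deriv (q ε) y) ∧
        ContDiffOn ℝ k (fun y => σ y / deriv (q ε) y - Real.log y / deriv (q ε) y) (Ioo 0 c) ∧
        (∀ w ∈ Sep.annulus δ, Sep.renorm (f ε) (q ε) N xs ys w =
          η ε (Sep.cylTwist (fun y =>
            ((σ y / deriv (q ε) y - Real.log y / deriv (q ε) y : ℝ) : UnitAddCircle)) w)) ∧
        -- `η` is a `C^k` diffeomorphism of the form `(x + a, y + y b)`, up to the boundary `y = 0`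
        Sep.IsCkDiffeoOn k (η ε) (Sep.annulus δ) ∧
        (∀ w ∈ Sep.annulus δ,
          η ε w = (w.1 + ((a ε w : ℝ) : UnitAddCircle), w.2 + w.2 * b ε w)) ∧
        ContDiffOn ℝ k (fun p => a ε (Sep.proj p)) (univ ×ˢ Ico 0 δ) ∧
        ContDiffOn ℝ (k - 1 : ℕ) (fun p => b ε (Sep.proj p)) (univ ×ˢ Ico 0 δ) ∧
        -- invariant probability measure
        (∃ μ : Measure Sep.Cyl, Sep.IsProbWithPosDensity c μ ∧
          Sep.PreservesOn (Sep.renorm (f ε) (q ε) N xs ys) (Sep.annulus δ) μ)) ∧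
      -- `‖η - id‖_{C^k} → 0`
      Tendsto (fun ε => Sep.ckNorm k (univ ×ˢ Ioo 0 δ)
        (fun p => (a ε (Sep.proj p), p.2 * b ε (Sep.proj p)))) (𝓝 0) (𝓝 0) := by
  have hlam := hf.lam_pos
  have hk1 : 1 ≤ k := by omega
  obtain ⟨R, hR⟩ := hf.exists_isGoodRadius
  have hRp := hR.pos
  -- Points of `V` then remain in the box of size `R` after multiplication by `e^{4λ}`, the
  -- half-width of the window.
  refine ⟨R * Real.exp (-(5 * lam)), by positivity, ?_⟩
  intro V hV h0V hstar hVr xs hxs hxV hesc N hN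
  have hr : ∀ A, A < 5 * lam → R * Real.exp (-(5 * lam)) * Real.exp A < R := by
    intro A hA
    rw [mul_assoc, ← Real.exp_add]
    exact mul_lt_of_lt_one_right hRp (Real.exp_lt_one_iff.2 (by linarith))
  have hrR : R * Real.exp (-(5 * lam)) < R := by simpa using hr 0 (by linarith)
  obtain ⟨-, yb, hyb, hybr, hbase⟩ := hf.exists_unstable_base hk1 hR hrR.le hV h0V hstar hVr hxs
    hxV hesc.self_of_nhds (hr lam (by linarith)).le
  rw [← hN] at hbase
  have hxr : xs < R * Real.exp (-(5 * lam)) := by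
    have := (Sep.plane_mem_ball.1 (hVr hxV)).1
    rwa [abs_of_pos hxs] at this
  set ub := -Real.log yb with hub
  have hube : Real.exp (-ub) = yb := by rw [hub, neg_neg, Real.exp_log hyb]
  have hth : Sep.theta (ub, 0) = (0, yb) := by
    simp [Sep.theta, hube]
  have hx4 : xs * Real.exp (4 * lam) < R :=
    (mul_lt_mul_of_pos_right hxr (Real.exp_pos _)).trans (hr _ (by linarith))
  have hu4 : Real.exp (-ub) * Real.exp (4 * lam) < R := by
    rw [hube]
    exact (mul_lt_mul_of_pos_right hybr (Real.exp_pos _)).trans (hr _ (by linarith))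
  obtain ⟨σ, ρ, hT⟩ := hf.exists_isTransition hk hR hxs hx4 hu4 (by rw [hth]; exact hbase)
  have hρ := hT.pos
  -- The first bound on `y_*` gives `c < ρ / 2`; the second keeps the points of the fundamental
  -- domain in the box during `N` iterates.
  refine ⟨σ, hT.contDiff, min (ρ / 2 / xs) (R * Real.exp (-((N + 1) * (5 * lam / 4)))),
    by positivity, ?_⟩
  rintro ys hys hys0 c rfl
  have hxy : 0 < xs * ys := mul_pos hxs hys
  have hc : xs * ys < ρ / 2 := by
    have := hys0.trans_le (min_le_left _ _)
    rw [lt_div_iff₀ hxs] at this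
    linarith
  have hysR : ys * Real.exp ((N + 1) * (5 * lam / 4)) < R := by
    have := mul_lt_mul_of_pos_right (hys0.trans_le (min_le_right _ _))
      (Real.exp_pos ((N + 1) * (5 * lam / 4)))
    rwa [mul_assoc, ← Real.exp_add, neg_add_cancel, Real.exp_zero, mul_one] at this
  -- The first bound ensures that the final value of `v`, less than twice the initial one, is below
  -- `c`; the second ensures a long enough passage near the origin.
  set δ := min (xs * ys / 2) (Real.exp (Real.log xs - ub - 8 * lam)) with hδ
  have hδp : 0 < δ := by positivity
  have hδc : δ ≤ xs * ys / 2 := min_le_left _ _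
  have hδρ : δ ≤ ρ / 2 := by linarith
  obtain ⟨ε₀, hε₀, hclose⟩ := Metric.eventually_nhds_iff.1 (hf.eventually_isCloseToId hk hR hT)
  have hclose' : ∀ ε ∈ Ioo (-ε₀) ε₀, |ε| < ρ ∧
      Sep.IsCloseToId k (Sep.lift (f ε) (q ε) σ N (Real.log xs)) (ρ / 2) := fun ε hε =>
    hclose (by rw [Real.dist_eq, sub_zero]; exact abs_lt.2 hε)
  refine ⟨δ, hδp, by linarith, ε₀, hε₀, fun ε hε => hT.mem ε (hclose' ε hε).1,
    fun ε w => (w.1 + ((Sep.displacement (f ε) (q ε) σ N xs w).1 : UnitAddCircle),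
      w.2 + (Sep.displacement (f ε) (q ε) σ N xs w).2),
    fun ε w => (Sep.displacement (f ε) (q ε) σ N xs w).1,
    fun ε => Sep.IsCloseToId.relDisplacement (Sep.lift (f ε) (q ε) σ N (Real.log xs)), ?_, ?_⟩
  · intro ε hε
    obtain ⟨hερ, hL⟩ := hclose' ε hε
    have hεI := hT.mem ε hερ
    have h : Sep.IsReturn (f ε) (q ε) σ N lam R ρ ub xs ys δ :=
      hT.isReturn hk1 hf hR hερ hL hxs (hxr.trans hrR) hu4 hys hc hysR hδc
        (min_le_right _ _)
    have hq := hf.contDiff_deriv_q hεI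
    have hsub : (univ ×ˢ Ico 0 δ : Set Sep.Plane) ⊆ {p | |p.2| < ρ / 2} := fun p hp => by
      change |p.2| < ρ / 2
      rw [abs_of_nonneg hp.2.1]
      linarith [hp.2.2]
    refine ⟨fun w hw => hT.xi1_iterate h hw, h.bijOn, fun z hz hzδ => ?_,
      fun w hw => (h.renorm_eq hL.periodic hw).2.1, fun y hy => h.deriv_pos hy, ?_,
      fun w hw => (h.renorm_eq hL.periodic hw).2.2.2, hL.isCkDiffeoOn hk1 hδρ, fun w hw => ?_,
      fun p hp => (hL.contDiffAt_periodize (hsub hp)).fst.contDiffWithinAt,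
      (hL.contDiffOn_relDisplacement hk1).mono hsub, ?_⟩
    · have := (h.renorm_eq hL.periodic (w := Sep.proj (Sep.normalize (q ε) xs z)) ⟨hz.2.1, hzδ⟩).1
      rwa [h.invFunOn_normalize hz] at this
    · have hne : ∀ y ∈ Ioo 0 (xs * ys), deriv (q ε) y ≠ 0 := fun y hy => (h.deriv_pos hy).ne'
      refine (hT.contDiff.contDiffOn.div hq.contDiffOn hne).sub
        (ContDiffOn.div (fun y hy => ?_) hq.contDiffOn hne)
      exact (Real.contDiffAt_log.2 hy.1.ne').contDiffWithinAt
    · refine Prod.ext rfl ?_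
      simp only
      rw [hL.mul_relDisplacement hk1 (by rw [abs_of_pos hw.1]; linarith [hw.2])]
      rfl
    · exact h.exists_invariant_measure ((hf.symplectic ε hεI).contDiff.of_le (by exact_mod_cast hk1))
        (hf.symplectic ε hεI).det_eq_one (f ε).injective (hq.of_le (by exact_mod_cast hk1))
        hL.periodic (h.injOn_renorm hk1 hL)
  · rw [ENNReal.tendsto_nhds_zero]
    intro τ hτ
    -- `τ` may be infinite, so a positive real bound below it is chosen.
    obtain ⟨τ', hτ'0, hτ'⟩ : ∃ τ' : ℝ, 0 < τ' ∧ ENNReal.ofReal τ' ≤ τ := by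
      obtain ⟨t, ht0, ht⟩ := ENNReal.lt_iff_exists_nnreal_btwn.1 hτ
      exact ⟨t, by exact_mod_cast ht0, by simpa using ht.le⟩
    filter_upwards [hf.eventually_isCloseToId hk hR hT, hf.eventually_lift_small hR hT hτ'0]
      with ε hε hsmall
    refine (hε.2.ckNorm_le hk1 hδρ fun w h1 h2 i hi => ?_).trans hτ'
    exact ((hsmall w ⟨⟨by linarith [(abs_le.1 h1).1], (abs_le.1 h1).2⟩, abs_le.1 h2⟩).2 i hi).le
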